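/- Let $L>0$ and let $U:\mathbb R\to\mathbb R$ satisfy: (U1) $U\in C^3$; (U2) $U$ has exactly three stationary points $u_-<0<u_+$, the points $u_\pm$ are local minima with $U''(u_\pm)\neq0$, and $0$ is a local maximum with $U''(0)=-1$; (U3) for some $M_0>0$, $p_0\ge 2$: $|U^{(j)}(u)|\le M_0(1+|u|^{2p_0-j})$ for $j=0,1,2,3$ and all $u$; (U4) $U(u)\ge\beta u^2-\alpha$ for some $\alpha\in\mathbb R$, $\beta>0$ and all $u$; (U5) for every $\gamma>0$ there is $M_1(\gamma)$ with $U'(u)^2\ge\gamma u^2-M_1(\gamma)$ for all $u$, and there are $a>0$ and $b,c\in\mathbb R$ with $U'(u+v)-U'(u)\ge a v^{2p_0-1}+b|u|^{2p_0-1}+c$ for all $u\in\mathbb R$, $v\ge0$; (U6) for some $M_2$ and all $u$: $U''(u)\ge -M_2$ and $u^{2(p_0-1)}U''(u)-2(p_0-1)u^{2p_0-3}U'(u)\ge -M_2$ (for non-integer $p_0$ the powers are read as $|u|^{2(p_0-1)}$ and $|u|^{2p_0-4}u$). Fix Neumann ($b=1$) or periodic ($b=2$) boundary conditions on $[0,L]$.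 Consider sequences $z=(z_k)_{k\in\mathbb Z}$ of complex numbers with $z_{-k}=\overline{z_k}$ (and moreover $z_{-k}=z_k$ in the Neumann case) and $\sum_k(1+k^2)|z_k|^2<\infty$; these are the Fourier coefficients of the functions $u(x)=L^{-1/2}\sum_k z_k e^{\mathrm i bk\pi x/L}$ in $H^1$ that are compatible with the boundary condition. On the space of such $z$ define $$\widehat V(z)=\int_0^L\Bigl[\tfrac12u'(x)^2+U(u(x))\Bigr]dx=\frac12\sum_{k\in\mathbb Z}\frac{(b\pi k)^2}{L^2}|z_k|^2+\int_0^LU\Bigl(\sum_{k\in\mathbb Z} z_k\frac{e^{\mathrm i bk\pi x/L}}{\sqrt L}\Bigr)dx ,$$ and let $\widehat V^{(d)}$ be its restriction to the subspace $\{z: z_k=0 \text{ for } |k|>d\}$. Eigenvalues of a Hessian are taken with respect to the $\ell^2$ inner product $\sum_k z_k\overline{w_k}$, and a critical point is called nondegenerate if $0$ is not an eigenvalue of the Hessian there. In the Neumann case, assume in addition that every nonconstant critical point of $\widehat V$ is nondegenerate and that, if $L\in\pi\mathbb N$ (that is, if the critical point $u\equiv0$ is degenerate), then $U\in C^4$ and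 $U^{(4)}(0)\neq-\frac53U'''(0)^2$. In the periodic case nothing more is assumed. Then there is $d_0<\infty$ such that for every $d\ge d_0$ the potentials $\widehat V$ and $\widehat V^{(d)}$ have the same finite number of nondegenerate critical points, with the same numbers of negative eigenvalues: there is a bijection between the nondegenerate critical points of $\widehat V$ and those of $\widehat V^{(d)}$ that preserves the number of negative eigenvalues of the Hessian, counted with multiplicity. -/

import Mathlib

noncomputable section

/-- The assumptions on the local potential `U`: class `C³`; exactly three stationary points
`uminus < 0 < uplus`, a local maximum at `0` with `U'' 0 = -1` and two nondegenerate local minima;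
growth, coercivity and monotonicity bounds with exponent `2 * p₀`. Real exponents `p₀` are allowed,
so the powers `u ^ (2 * (p₀ - 1))` and `u ^ (2 * p₀ - 3)` of the last bound are written as
`|u| ^ (2 * (p₀ - 1))` and `|u| ^ (2 * p₀ - 4) * u`, which is the same for integer `p₀`. -/
structure IsDoubleWell (U : ℝ → ℝ) : Prop where
  contDiff : ContDiff ℝ 3 U
  stationary : ∃ uminus uplus : ℝ, uminus < 0 ∧ 0 < uplus ∧
    (∀ u : ℝ, deriv U u = 0 ↔ u = uminus ∨ u = 0 ∨ u = uplus) ∧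
    IsLocalMin U uminus ∧ IsLocalMin U uplus ∧ IsLocalMax U 0 ∧
    iteratedDeriv 2 U uminus ≠ 0 ∧ iteratedDeriv 2 U uplus ≠ 0 ∧ iteratedDeriv 2 U 0 = -1
  quadratic_lower : ∃ α β : ℝ, 0 < β ∧ ∀ u : ℝ, β * u ^ 2 - α ≤ U u
  deriv_sq_lower : ∀ γ : ℝ, 0 < γ → ∃ M₁ : ℝ, ∀ u : ℝ, γ * u ^ 2 - M₁ ≤ (deriv U u) ^ 2
  growth : ∃ p₀ : ℝ, 2 ≤ p₀ ∧
    (∃ M₀ : ℝ, 0 < M₀ ∧ ∀ j : ℕ, j ≤ 3 → ∀ u : ℝ,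
      |iteratedDeriv j U u| ≤ M₀ * (1 + |u| ^ (2 * p₀ - (j : ℝ)))) ∧
    (∃ a b c : ℝ, 0 < a ∧ ∀ u v : ℝ, 0 ≤ v →
      a * v ^ (2 * p₀ - 1) + b * |u| ^ (2 * p₀ - 1) + c ≤ deriv U (u + v) - deriv U u) ∧
    (∃ M₂ : ℝ, ∀ u : ℝ, -M₂ ≤ iteratedDeriv 2 U u ∧
      -M₂ ≤ |u| ^ (2 * (p₀ - 1)) * iteratedDeriv 2 U u
        - 2 * (p₀ - 1) * (|u| ^ (2 * p₀ - 4) * u) * deriv U u)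

/-- The two types of boundary conditions on `[0, L]`. -/
inductive BoundaryCondition
  | neumann
  | periodic

/-- The factor `b` in the Fourier modes `exp (i b k π x / L)`: `1` for Neumann, `2` for periodic. -/
def BoundaryCondition.factor : BoundaryCondition → ℝ
  | .neumann => 1
  | .periodic => 2

/-- Fourier coefficients `z : ℤ → ℂ` of the real functions of class `H¹` on `[0, L]` compatible
with the boundary condition: `z (-k)` is the conjugate of `z k`, in the Neumann case moreover
`z (-k) = z k` (cosine series), and `∑ (1 + k²) |z k|² < ∞`. -/
def sobolevSpace (bc : BoundaryCondition) : Submodule ℝ (ℤ → ℂ) where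
  carrier := {z | (∀ k : ℤ, z (-k) = starRingEnd ℂ (z k)) ∧
    (bc = .neumann → ∀ k : ℤ, z (-k) = z k) ∧
    Summable fun k : ℤ => (1 + (k : ℝ) ^ 2) * ‖z k‖ ^ 2}
  zero_mem' := by
    refine ⟨by simp, by simp, by simp⟩
  add_mem' := by
    rintro z w ⟨hz, hz', hz''⟩ ⟨hw, hw', hw''⟩
    refine ⟨fun k => by simp [hz k, hw k], fun h k => by simp [hz' h k, hw' h k], ?_⟩
    refine Summable.of_nonneg_of_le (fun k => by positivity) (fun k => ?_)
      ((hz''.add hw'').mul_left 2)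
    have h1 : ‖z k + w k‖ ^ 2 ≤ 2 * (‖z k‖ ^ 2 + ‖w k‖ ^ 2) := by
      have h2 := norm_add_le (z k) (w k)
      nlinarith [norm_nonneg (z k + w k), sq_nonneg (‖z k‖ - ‖w k‖)]
    calc (1 + (k : ℝ) ^ 2) * ‖(z + w) k‖ ^ 2
        ≤ (1 + (k : ℝ) ^ 2) * (2 * (‖z k‖ ^ 2 + ‖w k‖ ^ 2)) := by
          simpa using mul_le_mul_of_nonneg_left h1 (by positivity : 0 ≤ 1 + (k : ℝ) ^ 2)
      _ = 2 * ((1 + (k : ℝ) ^ 2) * ‖z k‖ ^ 2 + (1 + (k : ℝ) ^ 2) * ‖w k‖ ^ 2) := by ring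
  smul_mem' := by
    rintro c z ⟨hz, hz', hz''⟩
    refine ⟨fun k => by simp [hz k], fun h k => by simp [hz' h k], ?_⟩
    refine (hz''.mul_left (c ^ 2)).congr (fun k => ?_)
    simp only [Pi.smul_apply, norm_smul, Real.norm_eq_abs, mul_pow, sq_abs]
    ring

/-- The subspace of the Fourier modes `z k` with `|k| ≤ d`. -/
def truncatedSpace (bc : BoundaryCondition) (d : ℕ) : Submodule ℝ (ℤ → ℂ) where
  carrier := {z | z ∈ sobolevSpace bc ∧ ∀ k : ℤ, (d : ℤ) < |k| → z k = 0}
  zero_mem' := ⟨Submodule.zero_mem _, fun _ _ => rfl⟩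
  add_mem' := by
    rintro z w ⟨hz, hz'⟩ ⟨hw, hw'⟩
    exact ⟨Submodule.add_mem _ hz hw, fun k hk => by simp [hz' k hk, hw' k hk]⟩
  smul_mem' := by
    rintro c z ⟨hz, hz'⟩
    exact ⟨Submodule.smul_mem _ c hz, fun k hk => by simp [hz' k hk]⟩

/-- The function `u x = ∑ k, z k * exp (i b k π x / L) / √L` with Fourier coefficients `z`
(the sum is real on `sobolevSpace bc`). -/
def fourierSum (bc : BoundaryCondition) (L : ℝ) (z : ℤ → ℂ) (x : ℝ) : ℝ :=
  (∑' k : ℤ, z k * (Complex.exp (Complex.I * (bc.factor * k * Real.pi * x / L : ℝ)) /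
    (Real.sqrt L : ℝ))).re

/-- The potential energy `V[u] = ∫₀ᴸ (u'² / 2 + U(u)) dx` in Fourier variables. -/
def potentialEnergy (U : ℝ → ℝ) (L : ℝ) (bc : BoundaryCondition) (z : ℤ → ℂ) : ℝ :=
  (1 / 2) * ∑' k : ℤ, (bc.factor * Real.pi * k) ^ 2 / L ^ 2 * ‖z k‖ ^ 2
    + ∫ x in (0 : ℝ)..L, U (fourierSum bc L z x)

/-- The full potential, on the space of all Fourier coefficients of class `H¹`. -/
def fullPotential (U : ℝ → ℝ) (L : ℝ) (bc : BoundaryCondition) (z : sobolevSpace bc) : ℝ :=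
  potentialEnergy U L bc z

/-- The truncated potential: the restriction to the Fourier modes with `|k| ≤ d`. -/
def truncatedPotential (U : ℝ → ℝ) (L : ℝ) (bc : BoundaryCondition) (d : ℕ)
    (z : truncatedSpace bc d) : ℝ :=
  potentialEnergy U L bc z

/-- The `ℓ²` inner product of (conjugation symmetric) Fourier coefficients; by Parseval it is the
`L²(0, L)` inner product of the corresponding functions. -/
def ellTwoInner (z w : ℤ → ℂ) : ℝ :=
  ∑' k : ℤ, (z k * starRingEnd ℂ (w k)).re

section Critical

variable {W : Submodule ℝ (ℤ → ℂ)}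

/-- All directional derivatives of `f` at `z` exist and vanish. -/
def IsCriticalPoint (f : W → ℝ) (z : W) : Prop :=
  ∀ h : W, HasLineDerivAt ℝ f 0 z h

/-- The second derivative of `f` at `z` in the directions `v` and `h`. -/
def hessianForm (f : W → ℝ) (z v h : W) : ℝ :=
  lineDeriv ℝ (fun y : W => lineDeriv ℝ f y v) z h

/-- `v` is in the kernel of the Hessian minus `μ`; for `v ≠ 0` this says that `v` is an eigenvector
of the Hessian (with respect to the `ℓ²` inner product) for the eigenvalue `μ`. -/
def IsHessianEigen (f : W → ℝ) (z : W) (μ : ℝ) (v : W) : Prop :=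
  ∀ h : W, hessianForm f z v h = μ * ellTwoInner v h

/-- Zero is not an eigenvalue of the Hessian of `f` at `z`. -/
def IsNondegenerate (f : W → ℝ) (z : W) : Prop :=
  ∀ v : W, IsHessianEigen f z 0 v → v = 0

/-- The number of negative eigenvalues of the Hessian of `f` at `z`, counted with multiplicity:
the dimension of the span of all eigenvectors for negative eigenvalues. -/
def negativeEigenvalueCount (f : W → ℝ) (z : W) : ℕ∞ :=
  Cardinal.toENat (Module.rank ℝ
    (Submodule.span ℝ {v : W | ∃ μ : ℝ, μ < 0 ∧ IsHessianEigen f z μ v}))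

/-- The set of nondegenerate critical points of `f`. -/
def nondegenerateCriticalPoints (f : W → ℝ) : Set W :=
  {z | IsCriticalPoint f z ∧ IsNondegenerate f z}

end Critical

end

/-! Neumann case. In orthonormal `H¹` coordinates `w` the gradient of the energy is `w - Φ w` with
`Φ = S† ∘ G ∘ S`, where `S` builds the function from its coordinates and `G u = u - U' u`. The
adjoint `S†` is compact. Critical points of the full potential are therefore fixed points of `Φ`,
and those of the truncated potential are the Galerkin solutions of `w = Φ w`. The Hessian is `1 - K`
with `K` compact and symmetric; its `ℓ²` eigenvalues are the eigenvalues of `1 - K` relative to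
`D†D`, with `D` the compact embedding of `H¹` into `L²`.

Since `s² - U'(s) s` is bounded above, all these solutions satisfy one `H¹` bound independent of
`d`. By compactness the Galerkin solutions for large `d` lie near fixed points
(`exists_forall_isGalerkinSolution_mem`). Near a nondegenerate fixed point a quantitative inverse
function theorem gives exactly one of them (`exists_local_galerkin`). The number of negative
eigenvalues is the dimension of a subspace on which the form is negative, with the form coercive on
a complement; such a splitting survives small perturbation and projection
(`exists_forall_rank_negSpace_compress`). `exists_galerkin_equiv` assembles the bijection, provided
that each degenerate fixed point is isolated and has only degenerate Galerkin solutions nearby.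

A degenerate fixed point is constant by assumption. At the wells `U'' > 0`, so it is `u = 0`, and
then `L = n π`. There a Lyapunov–Schmidt expansion `u = r cos + v` with `v = O(r²)` shows that the
equations for the modes `0`, `n`, `2 n` force `r³ (b + 5 a² / 3)` to be of smaller order than `r³`,
where `a = U'''(0)` and `b = U⁗(0)`. The excluded value of `U⁗(0)` is thus the only obstruction to
isolation. The same argument applies to Galerkin solutions with `d ≥ 2 n`, so near `0` only `0`
itself remains, and it is degenerate for the truncated potential too.

Periodic case. Translation invariance puts `u'` in the kernel of the Hessian at every critical point
`u`, for the truncated potential as well, since the truncated space is invariant under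
differentiation. Nondegenerate critical points are therefore constant. At a constant the Hessian is
diagonal in Fourier modes, and for `d ≥ L` the discarded modes have positive eigenvalues only, so
both potentials have literally the same nondegenerate critical points and negative eigenvectors. -/

noncomputable section

/-! ### Negative eigenspaces of `1 - K` relative to `D†D` -/

open Filter Topology Module.End in
/-- A compact symmetric operator, all of whose eigenvectors for eigenvalues larger than `c` are
orthogonal to `x`, satisfies `⟪T x, x⟫ ≤ c ‖x‖²`. -/
theorem IsCompactOperator.inner_le_of_orthogonal_eigenvectors {E : Type*} [NormedAddCommGroup E]
    [InnerProductSpace ℝ E] [CompleteSpace E] {T : E →L[ℝ] E} (hT : IsCompactOperator T)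
    (hsym : T.IsSymmetric) {c : ℝ} {x : E}
    (hx : ∀ τ : ℝ, c < τ → ∀ y : E, T y = τ • y → inner ℝ x y = 0) :
    inner ℝ (T x) x ≤ c * ‖x‖ ^ 2 := by
  set V : Submodule ℝ E := ⨆ τ : {τ : ℝ // τ ≤ c}, eigenspace (T : Module.End ℝ E) τ with hV
  have hsum : ∀ y ∈ V, inner ℝ (T y) y ≤ c * ‖y‖ ^ 2 := by
    intro y hy
    rw [hV, Submodule.mem_iSup_iff_exists_finsupp] at hy
    obtain ⟨f, hf, rfl⟩ := hy
    have hf' : ∀ τ, T (f τ) = (τ : ℝ) • f τ := fun τ => by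
      have := hf τ
      rwa [mem_eigenspace_iff] at this
    have horth : ∀ σ τ, σ ≠ τ → inner ℝ (f σ) (f τ) = 0 := by
      intro σ τ hστ
      have h1 : inner ℝ (T (f σ)) (f τ) = inner ℝ (f σ) (T (f τ)) := hsym _ _
      rw [hf', hf', real_inner_smul_left, real_inner_smul_right] at h1
      have h2 : (σ : ℝ) - τ ≠ 0 := sub_ne_zero.2 fun h => hστ (Subtype.ext h)
      have h3 : ((σ : ℝ) - τ) * inner ℝ (f σ) (f τ) = 0 := by linarith
      exact (mul_eq_zero.1 h3).resolve_left h2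
    have hTf : T (f.sum fun _ v => v) = ∑ τ ∈ f.support, (τ : ℝ) • f τ := by
      simp [Finsupp.sum, map_sum, hf']
    rw [hTf, ← real_inner_self_eq_norm_sq]
    simp only [Finsupp.sum, sum_inner, inner_sum, real_inner_smul_left]
    rw [Finset.mul_sum]
    refine Finset.sum_le_sum fun σ hσ => ?_
    rw [Finset.sum_eq_single σ (fun τ _ h => by rw [horth _ _ h, mul_zero])
      (fun h => absurd hσ h),
      Finset.sum_eq_single σ (fun τ _ h => by rw [horth _ _ h])
      (fun h => absurd hσ h)]
    exact mul_le_mul_of_nonneg_right σ.2 real_inner_self_nonneg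
  have hcl : ∀ y ∈ V.topologicalClosure, inner ℝ (T y) y ≤ c * ‖y‖ ^ 2 := by
    intro y hy
    have hclosed : IsClosed {y : E | inner ℝ (T y) y ≤ c * ‖y‖ ^ 2} :=
      isClosed_le (by fun_prop) (by fun_prop)
    exact closure_minimal (s := (V : Set E)) hsum hclosed hy
  refine hcl x ?_
  -- The part of `x` off the closure of `V` is orthogonal to eigenvectors for `τ ≤ c` by projection,
  -- and to those for `τ > c` because both `x` and `V` are. The spectral theorem then makes it zero.
  have hx' : x - V.topologicalClosure.starProjection x ∈
      (⨆ μ, eigenspace (T : Module.End ℝ E) μ)ᗮ := by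
    rw [Submodule.mem_orthogonal']
    intro u hu
    have hle : (⨆ μ, eigenspace (T : Module.End ℝ E) μ) ≤
        (ℝ ∙ (x - V.topologicalClosure.starProjection x))ᗮ := by
      refine iSup_le fun τ y hy => ?_
      rw [Submodule.mem_orthogonal_singleton_iff_inner_right]
      by_cases hτ : τ ≤ c
      · have hyV : y ∈ V.topologicalClosure :=
          V.le_topologicalClosure (Submodule.mem_iSup_of_mem (⟨τ, hτ⟩ : {τ : ℝ // τ ≤ c}) hy)
        have := Submodule.sub_starProjection_mem_orthogonal (K := V.topologicalClosure) x
        rw [Submodule.mem_orthogonal'] at this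
        exact this y hyV
      · have hTy : T y = τ • y := by
          rwa [mem_eigenspace_iff] at hy
        rw [inner_sub_left, hx τ (not_le.1 hτ) y hTy, zero_sub, neg_eq_zero]
        have hclosed : IsClosed {v : E | inner ℝ v y = 0} :=
          isClosed_eq (by fun_prop) (by fun_prop)
        refine closure_minimal (s := (V : Set E)) ?_ hclosed
          (Submodule.starProjection_apply_mem V.topologicalClosure x)
        intro v hv
        have hle' : V ≤ (ℝ ∙ y)ᗮ := by
          refine iSup_le fun σ w hw => ?_
          rw [Submodule.mem_orthogonal_singleton_iff_inner_left]
          have hTw : T w = (σ : ℝ) • w := by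
            rwa [mem_eigenspace_iff] at hw
          have h1 : inner ℝ (T w) y = inner ℝ w (T y) := hsym _ _
          rw [hTw, hTy, real_inner_smul_left, real_inner_smul_right] at h1
          have h2 : (σ : ℝ) - τ ≠ 0 := by
            have := σ.2
            push Not at hτ
            linarith
          have h3 : ((σ : ℝ) - τ) * inner ℝ w y = 0 := by linarith
          exact (mul_eq_zero.1 h3).resolve_left h2
        exact (Submodule.mem_orthogonal_singleton_iff_inner_left).1 (hle' hv)
    exact (Submodule.mem_orthogonal_singleton_iff_inner_right).1 (hle hu)
  rw [ContinuousLinearMap.orthogonalComplement_iSup_eigenspaces_eq_bot hT hsym,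
    Submodule.mem_bot, sub_eq_zero] at hx'
  rw [hx']
  exact Submodule.starProjection_apply_mem _ _

section NegSpace

variable {W E : Type*} [NormedAddCommGroup W] [InnerProductSpace ℝ W]
  [NormedAddCommGroup E] [InnerProductSpace ℝ E]

/-- `v` satisfies `(1 - K) v = μ D†D v`. -/
def IsFormEigen (K : W →L[ℝ] W) (D : W →L[ℝ] E) (μ : ℝ) (v : W) : Prop :=
  ∀ h : W, inner ℝ (v - K v) h = μ * inner ℝ (D v) (D h)

/-- The span of the eigenvectors of `1 - K` relative to `D†D` for negative eigenvalues. -/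
def negSpace (K : W →L[ℝ] W) (D : W →L[ℝ] E) : Submodule ℝ W :=
  Submodule.span ℝ {v : W | ∃ μ : ℝ, μ < 0 ∧ IsFormEigen K D μ v}

/-- Eigenvectors for different eigenvalues are orthogonal for `D†D`, so on a finite sum the form is
diagonal and equals `∑ μ ‖D f_μ‖²`. Injectivity of `D` makes this strictly negative. -/
theorem inner_self_neg_of_mem_negSpace {K : W →L[ℝ] W} {D : W →L[ℝ] E} (hK : K.IsSymmetric)
    (hD : Function.Injective D) {v : W} (hv : v ∈ negSpace K D) (hv0 : v ≠ 0) :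
    inner ℝ (v - K v) v < 0 := by
  -- group the eigenvectors by eigenvalue
  let V : {μ : ℝ // μ < 0} → Submodule ℝ W := fun μ =>
    { carrier := {v | IsFormEigen K D μ v}
      zero_mem' := fun h => by simp
      add_mem' := fun {a b} ha hb h => by
        have := ha h
        have := hb h
        simp only [map_add, inner_add_left, inner_sub_left] at *
        linarith
      smul_mem' := fun c a ha h => by
        have := ha h
        simp only [map_smul, inner_sub_left, real_inner_smul_left] at *
        linear_combination c * this }
  have hle : negSpace K D ≤ ⨆ μ, V μ := by
    refine Submodule.span_le.2 ?_
    rintro w ⟨μ, hμ, hw⟩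
    exact Submodule.mem_iSup_of_mem (⟨μ, hμ⟩ : {μ : ℝ // μ < 0}) hw
  have hv' := hle hv
  rw [Submodule.mem_iSup_iff_exists_finsupp] at hv'
  obtain ⟨f, hf, rfl⟩ := hv'
  have horth : ∀ σ τ, σ ≠ τ → inner ℝ (D (f σ)) (D (f τ)) = 0 := by
    intro σ τ hστ
    have h1 : inner ℝ (f σ - K (f σ)) (f τ) = σ * inner ℝ (D (f σ)) (D (f τ)) := hf σ _
    have h2 : inner ℝ (f τ - K (f τ)) (f σ) = τ * inner ℝ (D (f τ)) (D (f σ)) := hf τ _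
    have h3 : inner ℝ (K (f σ)) (f τ) = inner ℝ (f σ) (K (f τ)) := hK _ _
    rw [inner_sub_left] at h1 h2
    rw [real_inner_comm (f σ) (f τ), real_inner_comm (D (f σ)),
      real_inner_comm (f σ) (K (f τ))] at h2
    have h4 : (σ : ℝ) - τ ≠ 0 := sub_ne_zero.2 fun h => hστ (Subtype.ext h)
    have h5 : ((σ : ℝ) - τ) * inner ℝ (D (f σ)) (D (f τ)) = 0 := by linarith
    exact (mul_eq_zero.1 h5).resolve_left h4
  have hexp : inner ℝ ((f.sum fun _ v => v) - K (f.sum fun _ v => v)) (f.sum fun _ v => v) =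
      ∑ σ ∈ f.support, (σ : ℝ) * ‖D (f σ)‖ ^ 2 := by
    simp only [Finsupp.sum, map_sum, ← Finset.sum_sub_distrib, sum_inner]
    refine Finset.sum_congr rfl fun σ hσ => ?_
    rw [inner_sum, Finset.sum_eq_single σ]
    · rw [hf σ (f σ), real_inner_self_eq_norm_sq]
    · intro τ _ h
      rw [hf σ (f τ), horth _ _ h.symm, mul_zero]
    · exact fun h => absurd hσ h
  rw [hexp]
  have hne : f.support.Nonempty := by
    rw [Finsupp.support_nonempty_iff]
    rintro rfl
    simp at hv0
  refine Finset.sum_neg (fun σ hσ => ?_) hne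
  have : D (f σ) ≠ 0 := by
    rw [Finsupp.mem_support_iff] at hσ
    exact fun h => hσ (hD (by rw [h, map_zero]))
  have h2 : 0 < ‖D (f σ)‖ ^ 2 := by positivity
  nlinarith [σ.2]

end NegSpace

section IndexForm

variable {W E : Type*} [NormedAddCommGroup W] [InnerProductSpace ℝ W] [CompleteSpace W]
  [NormedAddCommGroup E] [InnerProductSpace ℝ E] [CompleteSpace E]

/-- Cauchy–Schwarz for a nonnegative symmetric operator. -/
theorem LinearMap.IsSymmetric.inner_sq_le_of_nonneg {F : Type*} [NormedAddCommGroup F]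
    [InnerProductSpace ℝ F] {P : F →ₗ[ℝ] F} (hP : P.IsSymmetric) {v w : F}
    (hpos : ∀ t : ℝ, 0 ≤ inner ℝ (P (v + t • w)) (v + t • w)) :
    inner ℝ (P v) w ^ 2 ≤ inner ℝ (P v) v * inner ℝ (P w) w := by
  have h : ∀ t : ℝ, 0 ≤ inner ℝ (P w) w * (t * t) + 2 * inner ℝ (P v) w * t + inner ℝ (P v) v := by
    intro t
    have := hpos t
    simp only [map_add, map_smul, inner_add_left, inner_add_right, real_inner_smul_left,
      real_inner_smul_right] at this
    have h2 : inner ℝ (P w) v = inner ℝ (P v) w := by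
      rw [hP w v, real_inner_comm]
    rw [h2] at this
    linarith
  have := discrim_le_zero h
  rw [discrim] at this
  nlinarith

/-- The relative eigenvalue problem is inverted. The shifted operator `P = 1 - K + M D†D` is
coercive, and `T = D P⁻¹ D†` is compact and symmetric. Eigenvalues `τ > M⁻¹` of `T` correspond to
relative eigenvalues `τ⁻¹ - M < 0`, so `D v` is orthogonal to all those eigenvectors of `T`, which
bounds `⟪T D v, D v⟫` by `M⁻¹ ‖D v‖²`. -/
theorem inner_self_nonneg_of_orthogonal_negSpace {K : W →L[ℝ] W} {D : W →L[ℝ] E}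
    (hK : K.IsSymmetric) (hD : IsCompactOperator D) {M : ℝ}
    (hM : ∀ v, inner ℝ (K v) v ≤ M * ‖D v‖ ^ 2) {v : W}
    (hv : ∀ e ∈ negSpace K D, inner ℝ (D v) (D e) = 0) :
    0 ≤ inner ℝ (v - K v) v := by
  wlog hM0 : 0 < M generalizing M
  · refine this (M := 1) (fun v => (hM v).trans ?_) one_pos
    gcongr
    linarith
  let D' := ContinuousLinearMap.adjoint D
  let P : W →L[ℝ] W := ContinuousLinearMap.id ℝ W - K + M • (D' ∘L D)
  have hPapp : ∀ v, P v = v - K v + M • D' (D v) := fun v => rfl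
  have hP1 : ∀ v w, inner ℝ (P v) w = inner ℝ (v - K v) w + M * inner ℝ (D v) (D w) := by
    intro v w
    rw [hPapp, inner_add_left, real_inner_smul_left, ContinuousLinearMap.adjoint_inner_left]
  have hPge : ∀ v, ‖v‖ ^ 2 ≤ inner ℝ (P v) v := by
    intro v
    rw [hP1, inner_sub_left, real_inner_self_eq_norm_sq, real_inner_self_eq_norm_sq]
    linarith [hM v]
  have hPsym : (P : W →ₗ[ℝ] W).IsSymmetric := by
    intro v w
    change inner ℝ (P v) w = inner ℝ v (P w)
    have : inner ℝ (K v) w = inner ℝ v (K w) := hK v w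
    rw [real_inner_comm (P w), hP1, hP1, inner_sub_left, inner_sub_left, this,
      real_inner_comm v w, real_inner_comm (D v), real_inner_comm v (K w)]
  have hcoer : IsCoercive ((innerSL ℝ).comp P : W →L[ℝ] W →L[ℝ] ℝ) := by
    refine ⟨1, one_pos, fun u => ?_⟩
    have := hPge u
    simpa [sq] using this
  let Pe := hcoer.continuousLinearEquivOfBilin
  have hPe : ∀ v, Pe v = P v := by
    intro v
    refine ext_inner_right ℝ fun w => ?_
    rw [hcoer.continuousLinearEquivOfBilin_apply]
    rfl
  let R : W →L[ℝ] W := (Pe.symm : W →L[ℝ] W)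
  have hPR : ∀ w, P (R w) = w := fun w => by
    rw [← hPe]; exact Pe.apply_symm_apply w
  let T : E →L[ℝ] E := D ∘L R ∘L D'
  have hTapp : ∀ y, T y = D (R (D' y)) := fun y => rfl
  have hTc : IsCompactOperator T := by
    exact hD.comp_clm (R ∘L D')
  have hTin : ∀ y z, inner ℝ (T y) z = inner ℝ (P (R (D' y))) (R (D' z)) := by
    intro y z
    have h1 : inner ℝ (P (R (D' y))) (R (D' z)) = inner ℝ (R (D' y)) (P (R (D' z))) :=
      hPsym _ _
    rw [h1, hPR, hTapp, ContinuousLinearMap.adjoint_inner_right]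
  have hTsym : T.IsSymmetric := by
    intro y z
    change inner ℝ (T y) z = inner ℝ y (T z)
    rw [real_inner_comm (T z), hTin, hTin, real_inner_comm (R (D' y))]
    exact hPsym _ _
  have hTle : inner ℝ (T (D v)) (D v) ≤ M⁻¹ * ‖D v‖ ^ 2 := by
    refine hTc.inner_le_of_orthogonal_eigenvectors hTsym fun τ hτ y hy => ?_
    have hτ0 : 0 < τ := lt_trans (inv_pos.2 hM0) hτ
    -- With `e = R D† y` one has `P e = D† y` and `D e = T y = τ y`, hence `(1 - K) e = (τ⁻¹ - M)
    -- D†D e`.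
    have he : R (D' y) ∈ negSpace K D := by
      refine Submodule.subset_span ⟨τ⁻¹ - M, ?_, fun h => ?_⟩
      · rw [sub_neg]
        exact inv_lt_of_inv_lt₀ hM0 hτ
      · have h1 := hP1 (R (D' y)) h
        have h2 : inner ℝ (P (R (D' y))) h = τ⁻¹ * inner ℝ (D (R (D' y))) (D h) := by
          rw [hPR, ContinuousLinearMap.adjoint_inner_left, ← hTapp, hy, real_inner_smul_left]
          field_simp
        linear_combination h2 - h1
    have h3 := hv _ he
    rw [← hTapp, hy, real_inner_smul_right] at h3
    exact (mul_eq_zero.1 h3).resolve_left hτ0.ne'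
  rw [hTin] at hTle
  -- Cauchy–Schwarz for `P` gives `‖D v‖⁴ ≤ ⟪T D v, D v⟫ ⟪P v, v⟫ ≤ M⁻¹ ‖D v‖² ⟪P v, v⟫`, so `⟪P v,
  -- v⟫` is at least the shift `M ‖D v‖²`.
  have hcs := hPsym.inner_sq_le_of_nonneg (v := R (D' (D v))) (w := v)
    (fun t => (sq_nonneg _).trans (hPge _))
  simp only [ContinuousLinearMap.coe_coe] at hcs
  rw [hPR (D' (D v)), ContinuousLinearMap.adjoint_inner_left] at hcs
  rw [hPR (D' (D v))] at hTle
  rw [real_inner_self_eq_norm_sq] at hcs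
  have hQ := hP1 v v
  rw [real_inner_self_eq_norm_sq] at hQ
  rcases eq_or_ne (‖D v‖) 0 with h0 | h0
  · have := (sq_nonneg _).trans (hPge v)
    rw [h0] at hQ
    linarith
  · have hpos : 0 < ‖D v‖ ^ 2 := by positivity
    have h4 : 0 ≤ inner ℝ (P v) v := (sq_nonneg _).trans (hPge v)
    have h5 : (‖D v‖ ^ 2) ^ 2 ≤ M⁻¹ * ‖D v‖ ^ 2 * inner ℝ (P v) v :=
      hcs.trans (mul_le_mul_of_nonneg_right hTle h4)
    have h6 : M * ‖D v‖ ^ 2 ≤ inner ℝ (P v) v := by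
      have h7 : ‖D v‖ ^ 2 * (M * ‖D v‖ ^ 2) ≤ ‖D v‖ ^ 2 * inner ℝ (P v) v := by
        calc ‖D v‖ ^ 2 * (M * ‖D v‖ ^ 2) = M * (‖D v‖ ^ 2) ^ 2 := by ring
          _ ≤ M * (M⁻¹ * ‖D v‖ ^ 2 * inner ℝ (P v) v) := by gcongr
          _ = ‖D v‖ ^ 2 * inner ℝ (P v) v := by field_simp
      exact le_of_mul_le_mul_left h7 hpos
    linarith

end IndexForm

/-! ### Fredholm alternative, projections and coercivity for forms -/

/-- The Fredholm alternative for `1 - A` with `A` compact. -/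
theorem exists_bounded_below_of_isCompactOperator {X : Type*} [NormedAddCommGroup X]
    [NormedSpace ℝ X] [CompleteSpace X] {A : X →L[ℝ] X} (hA : IsCompactOperator A)
    (hnd : ∀ v, A v = v → v = 0) :
    ∃ c > 0, (∀ v, c * ‖v‖ ≤ ‖(ContinuousLinearMap.id ℝ X - A) v‖) ∧
      Function.Surjective (ContinuousLinearMap.id ℝ X - A) := by
  have h1 : ¬ Module.End.HasEigenvalue (A : Module.End ℝ X) 1 := by
    intro h
    obtain ⟨v, hv⟩ := h.exists_hasEigenvector
    exact hv.2 (hnd v (by simpa using hv.apply_eq_smul))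
  obtain ⟨k, hk⟩ := hA.antilipschitz_of_not_hasEigenvalue one_ne_zero h1
  -- The `+ 1` avoids inverting a possibly zero Lipschitz constant.
  refine ⟨((k : ℝ) + 1)⁻¹, by positivity, fun v => ?_, ?_⟩
  · have := hk.le_mul_dist v 0
    rw [dist_zero_right, map_zero, dist_zero_right] at this
    have h2 : ‖(A - (1 : ℝ) • 1 : X →L[ℝ] X) v‖ = ‖(ContinuousLinearMap.id ℝ X - A) v‖ := by
      rw [← norm_neg]; simp
    rw [h2] at this
    rw [inv_mul_le_iff₀ (by positivity)]
    nlinarith [norm_nonneg ((ContinuousLinearMap.id ℝ X - A) v)]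
  · have h3 := (hA.hasEigenvalue_or_mem_resolventSet one_ne_zero).resolve_left h1
    rw [spectrum.mem_resolventSet_iff, ContinuousLinearMap.isUnit_iff_bijective] at h3
    intro y
    obtain ⟨x, hx⟩ := h3.2 y
    exact ⟨x, by simpa using hx⟩

section Form

variable {H E : Type*} [NormedAddCommGroup H] [InnerProductSpace ℝ H]
  [NormedAddCommGroup E] [InnerProductSpace ℝ E]

/-- On an eigenvector the pairing is `μ ⟪D e, D v⟫`. Orthogonality for `D†D` to the negative space
is thus also orthogonality for the form, which makes the later splitting block diagonal. -/
theorem inner_eq_zero_of_mem_negSpace {K : H →L[ℝ] H} {D : H →L[ℝ] E} {e v : H}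
    (he : e ∈ negSpace K D) (hv : ∀ e ∈ negSpace K D, inner ℝ (D v) (D e) = 0) :
    inner ℝ (e - K e) v = 0 := by
  have key : ∀ e ∈ negSpace K D, inner ℝ (D v) (D e) = 0 → inner ℝ (e - K e) v = 0 := by
    intro e he _
    refine Submodule.span_induction (p := fun e _ => inner ℝ (e - K e) v = 0) ?_ ?_ ?_ ?_ he
    · rintro x ⟨μ, hμ, hx⟩
      rw [hx v, real_inner_comm, hv x (Submodule.subset_span ⟨μ, hμ, hx⟩), mul_zero]
    · simp
    · intro x y _ _ hx hy
      rw [map_add, add_sub_add_comm, inner_add_left, hx, hy, add_zero]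
    · intro c x _ hx
      rw [map_smul, ← smul_sub, real_inner_smul_left, hx, mul_zero]
  exact key e he (hv e he)

/-- Projection onto a finite-dimensional subspace, orthogonal for the inner product of `D`. -/
theorem exists_form_projection {D : H →L[ℝ] E} (hD : Function.Injective D) (V : Submodule ℝ H)
    [FiniteDimensional ℝ V] :
    ∃ π : H →L[ℝ] V, (∀ h, ∀ e ∈ V, inner ℝ (D (h - π h)) (D e) = 0) ∧ ∀ e : V, π e = e := by
  let L : V →ₗ[ℝ] E := (D : H →ₗ[ℝ] E) ∘ₗ V.subtype
  have hL : Function.Injective L := hD.comp Subtype.val_injective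
  let e := LinearEquiv.ofInjective L hL
  let π : H →L[ℝ] V := (LinearMap.toContinuousLinearMap (e.symm : L.range →ₗ[ℝ] V)) ∘L
    L.range.orthogonalProjectionOnto ∘L D
  have hπ : ∀ h, D (π h) = L.range.starProjection (D h) := by
    intro h
    have : e (π h) = L.range.orthogonalProjectionOnto (D h) := e.apply_symm_apply _
    rw [Submodule.starProjection_apply, ← this]
    rfl
  have hV : ∀ x ∈ V, D x ∈ L.range := fun x hx => ⟨⟨x, hx⟩, rfl⟩
  refine ⟨π, fun h x hx => ?_, fun x => ?_⟩
  · rw [map_sub, hπ]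
    have := Submodule.sub_starProjection_mem_orthogonal (K := L.range) (D h)
    rw [Submodule.mem_orthogonal'] at this
    exact this _ (hV x hx)
  · refine Subtype.ext (hD ?_)
    rw [hπ, Submodule.starProjection_eq_self_iff]
    exact hV _ x.2

/-- Cauchy–Schwarz for the form with test vector `ρ (P v)` gives `‖P v‖⁴ ≤ ⟪P v, v⟫ N ‖P v‖²`, and
`‖P v‖` controls `‖v‖`. The map `ρ` is there because `P v` may leave `V`, where the form need not be
nonnegative. -/
theorem coercive_of_nonneg_of_bounded_below {P : H →L[ℝ] H} (hP : P.IsSymmetric)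
    {V : Submodule ℝ H} (hV : ∀ v ∈ V, 0 ≤ inner ℝ (P v) v) {ρ : H →L[ℝ] H}
    (hρV : ∀ h, ρ h ∈ V) (hρ : ∀ v ∈ V, ∀ h, inner ℝ (P v) h = inner ℝ (P v) (ρ h))
    {c : ℝ} (hc : 0 < c) (hbelow : ∀ v, c * ‖v‖ ≤ ‖P v‖) :
    ∃ c' > 0, ∀ v ∈ V, c' * ‖v‖ ^ 2 ≤ inner ℝ (P v) v := by
  set N := ‖P‖ * ‖ρ‖ ^ 2 + 1 with hN
  have hN0 : 0 < N := by positivity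
  refine ⟨c ^ 2 / N, by positivity, fun v hv => ?_⟩
  have hcs := LinearMap.IsSymmetric.inner_sq_le_of_nonneg hP (v := v) (w := ρ (P v))
    (fun t => hV _ (V.add_mem hv (V.smul_mem t (hρV _))))
  simp only [ContinuousLinearMap.coe_coe] at hcs
  rw [← hρ v hv, real_inner_self_eq_norm_sq] at hcs
  have hub : inner ℝ (P (ρ (P v))) (ρ (P v)) ≤ N * ‖P v‖ ^ 2 := by
    calc inner ℝ (P (ρ (P v))) (ρ (P v)) ≤ ‖P (ρ (P v))‖ * ‖ρ (P v)‖ := real_inner_le_norm _ _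
      _ ≤ (‖P‖ * (‖ρ‖ * ‖P v‖)) * (‖ρ‖ * ‖P v‖) := by
          gcongr
          · exact (P.le_opNorm _).trans (by gcongr; exact ρ.le_opNorm _)
          · exact ρ.le_opNorm _
      _ ≤ N * ‖P v‖ ^ 2 := by rw [hN]; nlinarith [sq_nonneg (‖P v‖)]
  have h0 := hV v hv
  have h1 : ‖P v‖ ^ 2 ≤ N * inner ℝ (P v) v := by
    rcases eq_or_ne ‖P v‖ 0 with h | h
    · rw [h]; simpa using mul_nonneg hN0.le h0
    · have hpos : 0 < ‖P v‖ ^ 2 := by positivity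
      have : ‖P v‖ ^ 2 * ‖P v‖ ^ 2 ≤ ‖P v‖ ^ 2 * (N * inner ℝ (P v) v) := by
        calc ‖P v‖ ^ 2 * ‖P v‖ ^ 2 = (‖P v‖ ^ 2) ^ 2 := by ring
          _ ≤ inner ℝ (P v) v * (N * ‖P v‖ ^ 2) := hcs.trans (by gcongr)
          _ = _ := by ring
      exact le_of_mul_le_mul_left this hpos
  have h2 : c ^ 2 * ‖v‖ ^ 2 ≤ ‖P v‖ ^ 2 := by
    rw [← mul_pow]
    exact pow_le_pow_left₀ (by positivity) (hbelow v) 2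
  rw [div_mul_eq_mul_div, div_le_iff₀ hN0]
  linarith

theorem abs_inner_apply_self_sub_le (P : H →L[ℝ] H) {p e : H} (hp : ‖p‖ ≤ ‖e‖) {δ : ℝ}
    (hδ : ‖e - p‖ ≤ δ * ‖e‖) :
    |inner ℝ (P p) p - inner ℝ (P e) e| ≤ 2 * ‖P‖ * δ * ‖e‖ ^ 2 := by
  have h1 : inner ℝ (P p) p - inner ℝ (P e) e =
      - inner ℝ (P p) (e - p) - inner ℝ (P (e - p)) e := by
    rw [map_sub, inner_sub_left, inner_sub_right]; ring
  have h2 : |inner ℝ (P p) (e - p)| ≤ ‖P‖ * ‖e‖ * (δ * ‖e‖) :=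
    (abs_real_inner_le_norm _ _).trans (by gcongr; exact (P.le_opNorm _).trans (by gcongr))
  have h3 : |inner ℝ (P (e - p)) e| ≤ ‖P‖ * (δ * ‖e‖) * ‖e‖ :=
    (abs_real_inner_le_norm _ _).trans (by gcongr; exact (P.le_opNorm _).trans (by gcongr))
  rw [h1]
  rw [abs_le] at h2 h3 ⊢
  constructor <;> linarith [h2.1, h2.2, h3.1, h3.2]

end Form

/-! ### Galerkin projections and stability of the index -/

section Galerkin

variable {H E : Type*} [NormedAddCommGroup H] [InnerProductSpace ℝ H]
  [NormedAddCommGroup E] [InnerProductSpace ℝ E]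

/-- The compression of an operator to a subspace. -/
def compress (K : H →L[ℝ] H) (V : Submodule ℝ H) [V.HasOrthogonalProjection] : V →L[ℝ] V :=
  V.orthogonalProjectionOnto ∘L K ∘L V.subtypeL

theorem inner_compress (K : H →L[ℝ] H) (V : Submodule ℝ H) [V.HasOrthogonalProjection]
    (v h : V) : inner ℝ (compress K V v) h = inner ℝ (K v) (h : H) := by
  simp [compress]

theorem compress_isSymmetric {K : H →L[ℝ] H} (hK : K.IsSymmetric) (V : Submodule ℝ H)
    [V.HasOrthogonalProjection] : (compress K V).IsSymmetric := by
  intro v h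
  have h1 : inner ℝ (K v) (h : H) = inner ℝ (v : H) (K h) := hK v h
  change inner ℝ (compress K V v) h = inner ℝ v (compress K V h)
  rw [inner_compress, h1, real_inner_comm (compress K V h) v, inner_compress,
    real_inner_comm]

variable {F : ℕ → Submodule ℝ H} [∀ d, FiniteDimensional ℝ (F d)]

/-- The projections converge strongly and `1 - P_d` never increases norms, so a finite net of mesh
`ε / 2` makes the convergence uniform on compact sets. -/
theorem eventually_norm_sub_starProjection_lt (hF : Monotone F)
    (hdense : ⊤ ≤ (⨆ d, F d).topologicalClosure) {C : Set H} (hC : IsCompact C) {ε : ℝ}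
    (hε : 0 < ε) : ∃ d₀, ∀ d ≥ d₀, ∀ y ∈ C, ‖y - (F d).starProjection y‖ < ε := by
  obtain ⟨t, htC, htf, ht⟩ := hC.finite_cover_balls (half_pos hε)
  have h1 : ∀ᶠ d in Filter.atTop, ∀ y ∈ t, ‖y - (F d).starProjection y‖ < ε / 2 := by
    rw [Filter.eventually_all_finite htf]
    intro y _
    have := Submodule.starProjection_tendsto_self F hF y hdense
    have h2 := (tendsto_const_nhds (x := y)).sub this
    rw [sub_self] at h2
    have h3 := h2.norm
    rw [norm_zero] at h3
    exact h3.eventually_lt_const (half_pos hε)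
  obtain ⟨d₀, hd₀⟩ := Filter.eventually_atTop.1 h1
  refine ⟨d₀, fun d hd y hy => ?_⟩
  obtain ⟨z, hz, hyz⟩ := Set.mem_iUnion₂.1 (ht hy)
  have h4 : y - (F d).starProjection y =
      (y - z - (F d).starProjection (y - z)) + (z - (F d).starProjection z) := by
    rw [map_sub]; abel
  have h5 : ‖y - z - (F d).starProjection (y - z)‖ ≤ ‖y - z‖ := by
    have := (F d)ᗮ.norm_starProjection_apply_le (y - z)
    rwa [Submodule.starProjection_orthogonal] at this
  rw [Metric.mem_ball, dist_eq_norm] at hyz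
  calc _ ≤ _ := by rw [h4]; exact norm_add_le _ _
    _ < ε / 2 + ε / 2 := add_lt_add (h5.trans_lt hyz) (hd₀ d hd z hz)
    _ = ε := add_halves ε

/-- Composition with a compact operator turns strong convergence of the projections into convergence
in operator norm. -/
theorem eventually_norm_sub_starProjection_comp_le (hF : Monotone F)
    (hdense : ⊤ ≤ (⨆ d, F d).topologicalClosure) {X : Type*} [NormedAddCommGroup X]
    [NormedSpace ℝ X] {K : X →L[ℝ] H} (hK : IsCompactOperator K) {ε : ℝ} (hε : 0 < ε) :
    ∃ d₀, ∀ d ≥ d₀, ∀ x, ‖K x - (F d).starProjection (K x)‖ ≤ ε * ‖x‖ := by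
  obtain ⟨C, hC, hKC⟩ := hK.image_closedBall_subset_compact (f := (K : X →ₗ[ℝ] H)) 1
  obtain ⟨d₀, hd₀⟩ := eventually_norm_sub_starProjection_lt hF hdense hC hε
  refine ⟨d₀, fun d hd x => ?_⟩
  rcases eq_or_ne x 0 with rfl | hx
  · simp
  have hx' : 0 < ‖x‖ := norm_pos_iff.2 hx
  have h1 := hd₀ d hd (K (‖x‖⁻¹ • x)) (hKC ⟨_, by simp [norm_smul, hx'.ne'], rfl⟩)
  rw [map_smul, map_smul, ← smul_sub, norm_smul, norm_inv, norm_norm,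
    inv_mul_lt_iff₀ hx'] at h1
  linarith

/-- For suitable `d` the operator `A` is within `1 / 2` of `P_d A`. A nonzero vector of the negative
space killed by `P_d` would satisfy `⟪A v, v⟫ ≤ ‖v‖² / 2`, while negativity of the form says `⟪A v,
v⟫ > ‖v‖²`. So `P_d` is injective there. -/
theorem finiteDimensional_negSpace (hF : Monotone F)
    (hdense : ⊤ ≤ (⨆ d, F d).topologicalClosure) {A : H →L[ℝ] H} (hA : IsCompactOperator A)
    (hAs : A.IsSymmetric) {D : H →L[ℝ] E} (hD : Function.Injective D) :
    FiniteDimensional ℝ (negSpace A D) := by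
  obtain ⟨d, hd⟩ := eventually_norm_sub_starProjection_comp_le hF hdense hA
    (half_pos one_pos : (0 : ℝ) < 1 / 2)
  let f : negSpace A D →ₗ[ℝ] F d :=
    ((F d).orthogonalProjectionOnto : H →ₗ[ℝ] F d) ∘ₗ (negSpace A D).subtype
  refine FiniteDimensional.of_injective f ?_
  rw [← LinearMap.ker_eq_bot, LinearMap.ker_eq_bot']
  intro v hv
  by_contra hv0
  have hv0' : (v : H) ≠ 0 := fun h => hv0 (Subtype.ext h)
  have h1 := inner_self_neg_of_mem_negSpace hAs hD v.2 hv0'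
  have hv1 : (F d).starProjection (v : H) = 0 := by
    rw [Submodule.starProjection_apply]
    exact congrArg Subtype.val hv
  have h2 : inner ℝ (A v) (v : H) = inner ℝ (A v - (F d).starProjection (A v)) (v : H) := by
    rw [inner_sub_left, Submodule.inner_starProjection_left_eq_right, hv1, inner_zero_right,
      sub_zero]
  have h3 : inner ℝ (A v - (F d).starProjection (A v)) (v : H) ≤ 1 / 2 * ‖(v : H)‖ * ‖(v : H)‖ :=
    (real_inner_le_norm _ _).trans (by gcongr; exact hd d le_rfl _)
  rw [inner_sub_left, real_inner_self_eq_norm_sq, h2] at h1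
  have : 0 < ‖(v : H)‖ := norm_pos_iff.2 hv0'
  nlinarith

variable [CompleteSpace H] [CompleteSpace E]

set_option maxHeartbeats 1000000 in
/-- Stability of nondegeneracy and of the index under Galerkin approximation. -/
theorem exists_forall_rank_negSpace_compress (hF : Monotone F)
    (hdense : ⊤ ≤ (⨆ d, F d).topologicalClosure) {A : H →L[ℝ] H} (hA : IsCompactOperator A)
    (hAs : A.IsSymmetric) {D : H →L[ℝ] E} (hD : Function.Injective D)
    (hDc : IsCompactOperator D) {M : ℝ} (hM : ∀ v, inner ℝ (A v) v ≤ M * ‖D v‖ ^ 2)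
    (hnd : ∀ v, A v = v → v = 0) :
    ∃ ε > 0, ∃ d₀, ∀ d ≥ d₀, ∀ B : H →L[ℝ] H, B.IsSymmetric →
      (∃ M : ℝ, ∀ v, inner ℝ (B v) v ≤ M * ‖D v‖ ^ 2) → (∀ v, ‖B v - A v‖ ≤ ε * ‖v‖) →
      (∀ v ∈ F d, (∀ h ∈ F d, inner ℝ (v - B v) h = 0) → v = 0) ∧
      Module.rank ℝ (negSpace (compress B (F d)) (D ∘L (F d).subtypeL)) =
        Module.rank ℝ (negSpace A D) := by
  have := finiteDimensional_negSpace hF hdense hA hAs hD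
  -- `H` splits into the negative space and `ker π`, orthogonally both for `D†D` and for the form of
  -- `1 - A`.
  obtain ⟨π, hπ, hπe⟩ := exists_form_projection hD (negSpace A D)
  set π' : H →L[ℝ] H := (negSpace A D).subtypeL ∘L π with hπ'
  set P : H →L[ℝ] H := ContinuousLinearMap.id ℝ H - A with hPdef
  have hPapp : ∀ v, P v = v - A v := fun v => rfl
  have hPs : P.IsSymmetric := by
    intro v w
    have : inner ℝ (A v) w = inner ℝ v (A w) := hAs v w
    simp [hPdef, inner_sub_left, inner_sub_right, this]
  obtain ⟨c, hc, hbelow, -⟩ := exists_bounded_below_of_isCompactOperator hA hnd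
  -- the form is coercive on the complement of the negative space
  let C : Submodule ℝ H := LinearMap.ker (π : H →ₗ[ℝ] negSpace A D)
  have hC : ∀ v, π v = 0 → ∀ e ∈ negSpace A D, inner ℝ (D v) (D e) = 0 := by
    intro v hv e he
    have := hπ v e he
    rwa [hv, ZeroMemClass.coe_zero, sub_zero] at this
  have hcross : ∀ e ∈ negSpace A D, ∀ v, π v = 0 → inner ℝ (P e) v = 0 := fun e he v hv =>
    inner_eq_zero_of_mem_negSpace he (hC v hv)
  have hππ : ∀ h, π (h - π h) = 0 := fun h => by rw [map_sub, hπe, sub_self]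
  obtain ⟨c₁, hc₁, hpos⟩ := coercive_of_nonneg_of_bounded_below hPs (V := C)
    (fun v hv => inner_self_nonneg_of_orthogonal_negSpace hAs hDc hM (hC v hv))
    (ρ := ContinuousLinearMap.id ℝ H - π') (fun h => hππ h)
    (fun v hv h => by
      have h1 : inner ℝ (P v) (π h : H) = 0 := by
        have h2 : inner ℝ (P v) (π h : H) = inner ℝ v (P (π h)) := hPs v _
        rw [h2, real_inner_comm, hcross _ (π h).2 v hv]
      change inner ℝ (P v) h = inner ℝ (P v) (h - (π h : H))
      rw [inner_sub_right, h1, sub_zero]) hc hbelow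
  obtain ⟨c₂, hc₂, hneg⟩ := coercive_of_nonneg_of_bounded_below (P := -P)
    (fun v w => by
      have : inner ℝ (P v) w = inner ℝ v (P w) := hPs v w
      simp [this]) (V := negSpace A D)
    (fun v hv => by
      rcases eq_or_ne v 0 with rfl | h0
      · simp
      · have := inner_self_neg_of_mem_negSpace hAs hD hv h0
        rw [neg_apply, inner_neg_left, hPapp]
        linarith)
    (ρ := π') (fun h => (π h).2)
    (fun v hv h => by
      have h1 : inner ℝ (P v) (h - π h) = 0 := hcross v hv _ (hππ h)
      rw [inner_sub_right] at h1
      simp only [neg_apply, inner_neg_left]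
      change - inner ℝ (P v) h = - inner ℝ (P v) (π h : H)
      linarith) hc (fun v => by rw [neg_apply, norm_neg]; exact hbelow v)
  -- `c / 4` keeps the two errors of the compression below the lower bound `c`; `c₁ / 2` keeps the
  -- form of `1 - B` positive on `ker π`; `c₂ / 4`, with another `c₂ / 4` from `δ`, keeps it at most
  -- `-(c₂ / 2) ‖e‖²` at the projection of a vector `e` of the negative space.
  set ε := min (c / 4) (min (c₁ / 2) (c₂ / 4)) with hε
  have hε0 : 0 < ε := by positivity
  have hε1 : ε ≤ c / 4 := min_le_left _ _
  have hε2 : ε ≤ c₁ / 2 := (min_le_right _ _).trans (min_le_left _ _)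
  have hε3 : ε ≤ c₂ / 4 := (min_le_right _ _).trans (min_le_right _ _)
  have hπc : IsCompactOperator π' :=
    ((isCompactOperator_id (E := negSpace A D)).clm_comp (negSpace A D).subtypeL).comp_clm π
  set δ := c₂ / (4 * (2 * ‖P‖ + 1)) with hδ
  have hδ0 : 0 < δ := by positivity
  obtain ⟨d₁, hd₁⟩ := eventually_norm_sub_starProjection_comp_le hF hdense hA hε0
  obtain ⟨d₂, hd₂⟩ := eventually_norm_sub_starProjection_comp_le hF hdense hπc hδ0
  refine ⟨ε, hε0, max d₁ d₂, fun d hd B hBs ⟨MB, hMB⟩ hBA => ⟨fun v hv h => ?_, ?_⟩⟩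
  · have h1 : (F d).starProjection (v - B v) = 0 := by
      rw [Submodule.starProjection_apply_eq_zero_iff, Submodule.mem_orthogonal']
      exact h
    have h2 : (F d).starProjection v = v := Submodule.starProjection_eq_self_iff.2 hv
    have h3 : P v = (F d).starProjection (B v - A v) - (A v - (F d).starProjection (A v)) := by
      rw [map_sub, h2, sub_eq_zero] at h1
      rw [map_sub, ← h1, hPapp]; abel
    have h4 : ‖P v‖ ≤ ε * ‖v‖ + ε * ‖v‖ := by
      rw [h3]
      refine (norm_sub_le _ _).trans (add_le_add ?_ (hd₁ d ((le_max_left _ _).trans hd) v))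
      exact ((F d).norm_starProjection_apply_le _).trans (hBA v)
    have h5 := hbelow v
    rw [← norm_eq_zero]
    nlinarith [norm_nonneg v]
  set Bd := compress B (F d) with hBd
  set Dd : F d →L[ℝ] E := D ∘L (F d).subtypeL with hDd
  have hBds : Bd.IsSymmetric := compress_isSymmetric hBs _
  have hDdi : Function.Injective Dd := hD.comp Subtype.val_injective
  have hQB : ∀ v : F d, inner ℝ (v - Bd v) v = inner ℝ ((v : H) - B v) (v : H) := by
    intro v
    rw [inner_sub_left, inner_sub_left, inner_compress]
    rfl
  have hQBP : ∀ v : H, |inner ℝ (v - B v) v - inner ℝ (P v) v| ≤ ε * ‖v‖ ^ 2 := by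
    intro v
    have h1 : inner ℝ (v - B v) v - inner ℝ (P v) v = - inner ℝ (B v - A v) v := by
      rw [hPapp, ← inner_sub_left, ← inner_neg_left]; congr 1; abel
    rw [h1, abs_neg, sq, ← mul_assoc]
    exact (abs_real_inner_le_norm _ _).trans (by gcongr; exact hBA v)
  obtain ⟨πd, hπd, -⟩ := exists_form_projection hDdi (negSpace Bd Dd)
  -- `π` is injective on the compressed negative space: in `ker π` the form of `1 - B` is positive.
  have hle1 : Module.finrank ℝ (negSpace Bd Dd) ≤ Module.finrank ℝ (negSpace A D) := by
    let f : negSpace Bd Dd →ₗ[ℝ] negSpace A D :=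
      (π : H →ₗ[ℝ] negSpace A D) ∘ₗ (F d).subtype ∘ₗ (negSpace Bd Dd).subtype
    refine LinearMap.finrank_le_finrank_of_injective (f := f) ?_
    rw [← LinearMap.ker_eq_bot, LinearMap.ker_eq_bot']
    intro v hv
    by_contra hv0
    have hv0' : (v : F d) ≠ 0 := fun h => hv0 (Subtype.ext h)
    have h1 := inner_self_neg_of_mem_negSpace hBds hDdi v.2 hv0'
    rw [hQB] at h1
    have h2 := hpos ((v : F d) : H) hv
    have h3 := abs_le.1 (hQBP ((v : F d) : H))
    have h4 : 0 < ‖((v : F d) : H)‖ := norm_pos_iff.2 fun h => hv0' (Subtype.ext h)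
    nlinarith [h3.1, h3.2, sq_nonneg ‖((v : F d) : H)‖]
  -- Conversely, let `p` be the projection of `e` to `F d`. If `πd p = 0`, the form of `1 - B` is
  -- nonnegative at `p`; but `p` is close to `e`, where the form of `1 - A` is at most `-c₂ ‖e‖²`,
  -- so `e = 0`.
  have hle2 : Module.finrank ℝ (negSpace A D) ≤ Module.finrank ℝ (negSpace Bd Dd) := by
    let f : negSpace A D →ₗ[ℝ] negSpace Bd Dd :=
      (πd : F d →ₗ[ℝ] negSpace Bd Dd) ∘ₗ ((F d).orthogonalProjectionOnto : H →ₗ[ℝ] F d) ∘ₗ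
        (negSpace A D).subtype
    refine LinearMap.finrank_le_finrank_of_injective (f := f) ?_
    rw [← LinearMap.ker_eq_bot, LinearMap.ker_eq_bot']
    intro e he
    set p : F d := (F d).orthogonalProjectionOnto (e : H) with hp
    have he' : πd p = 0 := he
    have h1 : 0 ≤ inner ℝ (p - Bd p) p := by
      refine inner_self_nonneg_of_orthogonal_negSpace (D := Dd) hBds (hDc.comp_clm (F d).subtypeL)
        (M := MB)
        (fun v => ?_) (fun x hx => ?_)
      · rw [inner_compress]; exact hMB v
      · have := hπd p x hx
        rwa [he', ZeroMemClass.coe_zero, sub_zero] at this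
    rw [hQB] at h1
    have h2 := hneg e e.2
    rw [neg_apply, inner_neg_left] at h2
    have h3 := abs_le.1 (hQBP (p : H))
    have h4 : ‖(p : H)‖ ≤ ‖(e : H)‖ := (F d).norm_orthogonalProjectionOnto_apply_le _
    have h5 : ‖(e : H) - p‖ ≤ δ * ‖(e : H)‖ := by
      have := hd₂ d ((le_max_right _ _).trans hd) e
      have hee : π' (e : H) = e := by
        change ((π (e : H) : negSpace A D) : H) = e
        rw [hπe]
      rwa [hee] at this
    have h6 : |inner ℝ (P p) (p : H) - inner ℝ (P e) (e : H)| ≤ c₂ / 4 * ‖(e : H)‖ ^ 2 := by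
      refine (abs_inner_apply_self_sub_le P h4 h5).trans ?_
      have h10 : 2 * ‖P‖ * δ ≤ c₂ / 4 := by
        rw [hδ, mul_div_assoc', div_le_div_iff₀ (by positivity) (by positivity)]
        nlinarith [norm_nonneg P]
      gcongr
    have h11 := abs_le.1 h6
    have h12 : ε * ‖(p : H)‖ ^ 2 ≤ c₂ / 4 * ‖(e : H)‖ ^ 2 := by gcongr
    have h13 : c₂ / 2 * ‖(e : H)‖ ^ 2 ≤ 0 := by linarith [h3.1, h3.2, h11.1, h11.2]
    have h14 : ‖(e : H)‖ ^ 2 ≤ 0 := by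
      by_contra hh
      push Not at hh
      have : 0 < c₂ / 2 * ‖(e : H)‖ ^ 2 := by positivity
      linarith
    have h15 : ‖(e : H)‖ = 0 := by
      have := sq_nonneg ‖(e : H)‖
      exact pow_eq_zero_iff (two_ne_zero) |>.1 (le_antisymm h14 this)
    exact Subtype.ext (norm_eq_zero.1 h15)
  rw [← Module.finrank_eq_rank, ← Module.finrank_eq_rank, le_antisymm hle1 hle2]

end Galerkin

/-! ### Galerkin approximation of the fixed points of a map with compact derivative -/

section GalerkinTheorem

open Metric

variable {H E : Type*} [NormedAddCommGroup H] [InnerProductSpace ℝ H]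
  [NormedAddCommGroup E] [InnerProductSpace ℝ E]

/-- `w` solves the equation `w = Φ w`, projected to `V`. -/
def IsGalerkinSolution (Φ : H → H) (V : Submodule ℝ H) (w : H) : Prop :=
  w ∈ V ∧ ∀ h ∈ V, inner ℝ (w - Φ w) h = 0

/-- The compression of `1 - A` to `V` is injective. -/
def IsGalerkinNondegenerate (A : H →L[ℝ] H) (V : Submodule ℝ H) : Prop :=
  ∀ v ∈ V, (∀ h ∈ V, inner ℝ (v - A v) h = 0) → v = 0

theorem isGalerkinSolution_top_iff {Φ : H → H} {w : H} :
    IsGalerkinSolution Φ ⊤ w ↔ Φ w = w := by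
  constructor
  · intro h
    exact (sub_eq_zero.1 (inner_self_eq_zero (𝕜 := ℝ).1 (h.2 _ trivial))).symm
  · intro h
    exact ⟨trivial, fun x _ => by rw [h, sub_self, inner_zero_left]⟩

theorem isGalerkinNondegenerate_top_iff {A : H →L[ℝ] H} :
    IsGalerkinNondegenerate A ⊤ ↔ ∀ v, A v = v → v = 0 := by
  constructor
  · intro h v hv
    exact h v trivial fun x _ => by rw [hv, sub_self, inner_zero_left]
  · intro h v _ hv
    exact h v (sub_eq_zero.1 (inner_self_eq_zero (𝕜 := ℝ).1 (hv _ trivial))).symm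

theorem isGalerkinSolution_iff {Φ : H → H} {V : Submodule ℝ H} [V.HasOrthogonalProjection]
    {w : H} : IsGalerkinSolution Φ V w ↔ V.starProjection (Φ w) = w := by
  constructor
  · rintro ⟨hw, h⟩
    have h1 : V.starProjection (w - Φ w) = 0 := by
      rw [Submodule.starProjection_apply_eq_zero_iff, Submodule.mem_orthogonal']
      exact h
    rw [map_sub, Submodule.starProjection_eq_self_iff.2 hw, sub_eq_zero] at h1
    exact h1.symm
  · intro h
    have hw : w ∈ V := h ▸ Submodule.starProjection_apply_mem V _
    refine ⟨hw, ?_⟩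
    have h1 : V.starProjection (w - Φ w) = 0 := by
      rw [map_sub, h, Submodule.starProjection_eq_self_iff.2 hw, sub_self]
    rwa [Submodule.starProjection_apply_eq_zero_iff, Submodule.mem_orthogonal'] at h1

variable {F : ℕ → Submodule ℝ H} [∀ d, FiniteDimensional ℝ (F d)]

/-- Otherwise there are Galerkin solutions outside `U` with `d → ∞`. Their images `Φ w` subconverge
in `C`, and `Φ w - w = Φ w - P_d (Φ w)` tends to zero uniformly on `C`, so the limit is a fixed
point in the closed complement of `U`. -/
theorem exists_forall_isGalerkinSolution_mem (hF : Monotone F)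
    (hdense : ⊤ ≤ (⨆ d, F d).topologicalClosure) {Φ : H → H} (hΦ : Continuous Φ) {C : Set H}
    (hC : IsCompact C) (hΦC : ∀ d w, IsGalerkinSolution Φ (F d) w → Φ w ∈ C) {U : Set H}
    (hU : IsOpen U) (hsol : ∀ w, Φ w = w → w ∈ U) :
    ∃ d₀, ∀ d ≥ d₀, ∀ w, IsGalerkinSolution Φ (F d) w → w ∈ U := by
  by_contra! hcon
  choose d hd w hw hwU using hcon
  obtain ⟨y, -, φ, hφ, hy⟩ := hC.tendsto_subseq fun n => hΦC _ _ (hw n)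
  have hdiff : Filter.Tendsto (fun n => Φ (w (φ n)) - w (φ n)) Filter.atTop (nhds 0) := by
    rw [Metric.tendsto_atTop]
    intro ε hε
    obtain ⟨d₀, hd₀⟩ := eventually_norm_sub_starProjection_lt hF hdense hC hε
    refine ⟨d₀, fun n hn => ?_⟩
    have h1 := hd₀ (d (φ n)) (hn.le.trans ((hφ.id_le n).trans (hd _))) _ (hΦC _ _ (hw (φ n)))
    rw [isGalerkinSolution_iff.1 (hw (φ n))] at h1
    rwa [dist_zero_right]
  have hwy : Filter.Tendsto (fun n => w (φ n)) Filter.atTop (nhds y) := by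
    have := hy.sub hdiff
    simpa using this
  have hΦy : Φ y = y := tendsto_nhds_unique ((hΦ.tendsto y).comp hwy) hy
  obtain ⟨n, hn⟩ := (hwy.eventually (hU.mem_nhds (hsol y hΦy))).exists
  exact hwU _ hn

variable [CompleteSpace H] [CompleteSpace E]

/-- Near a nondegenerate solution there is, for large `d`, exactly one Galerkin solution; it is
nondegenerate and has the same index. -/
theorem exists_local_galerkin (hF : Monotone F) (hdense : ⊤ ≤ (⨆ d, F d).topologicalClosure)
    {D : H →L[ℝ] E} (hD : Function.Injective D) (hDc : IsCompactOperator D)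
    {Φ : H → H} {K : H → H →L[ℝ] H} {w : H} (hΦ : HasStrictFDerivAt Φ (K w) w)
    (hK : ContinuousAt K w) (hKc : IsCompactOperator (K w)) (hKs : ∀ w, (K w).IsSymmetric)
    (hM : ∀ w, ∃ M : ℝ, ∀ v, inner ℝ (K w v) v ≤ M * ‖D v‖ ^ 2)
    (hw : Φ w = w) (hnd : ∀ v, K w v = v → v = 0) :
    ∃ r₀ > 0, (∀ x ∈ closedBall w r₀, Φ x = x → x = w) ∧
      ∀ r > 0, r ≤ r₀ → ∃ d₀, ∀ d ≥ d₀,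
        (∃ x ∈ closedBall w r, IsGalerkinSolution Φ (F d) x) ∧
        (∀ x ∈ closedBall w r, ∀ y ∈ closedBall w r, IsGalerkinSolution Φ (F d) x →
          IsGalerkinSolution Φ (F d) y → x = y) ∧
        ∀ x ∈ closedBall w r, IsGalerkinNondegenerate (K x) (F d) ∧
          Module.rank ℝ (negSpace (compress (K x) (F d)) (D ∘L (F d).subtypeL)) =
            Module.rank ℝ (negSpace (K w) D) := by
  obtain ⟨c, hc, hbelow, hsurj⟩ := exists_bounded_below_of_isCompactOperator hKc hnd
  set A := ContinuousLinearMap.id ℝ H - K w with hA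
  have hAapp : ∀ v, A v = v - K w v := fun v => rfl
  choose g hg using hsurj
  let Ainv : A.NonlinearRightInverse :=
    { toFun := g
      nnnorm := ⟨c⁻¹, by positivity⟩
      bound' := fun y => by
        have := hbelow (g y)
        rw [hg] at this
        change ‖g y‖ ≤ c⁻¹ * ‖y‖
        rw [le_inv_mul_iff₀ hc]
        exact this
      right_inv' := hg }
  obtain ⟨M, hMw⟩ := hM w
  obtain ⟨ε, hε, d₁, hd₁⟩ := exists_forall_rank_negSpace_compress hF hdense hKc (hKs w) hD hDc
    hMw hnd
  -- Linearizing `Φ` and projecting `K w` each cost `c / 4`, which leaves half of the lower bound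
  -- `c` of `1 - K w`.
  let κ : NNReal := ⟨c / 4, by positivity⟩
  have hκ0 : 0 < κ := by
    change (0 : ℝ) < c / 4
    positivity
  have hκ : (κ : ℝ) = c / 4 := rfl
  obtain ⟨s, hs, hsΦ⟩ := hΦ.approximates_deriv_on_nhds (c := κ) (Or.inr hκ0)
  have hKn : {x | ‖K x - K w‖ < ε} ∈ nhds w := by
    filter_upwards [hK (ball_mem_nhds _ hε)] with x hx
    rwa [Set.mem_preimage, mem_ball, dist_eq_norm] at hx
  obtain ⟨r₀, hr₀, hball⟩ := Metric.nhds_basis_closedBall.mem_iff.1 (Filter.inter_mem hs hKn)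
  have happ := hsΦ.mono_set (fun x hx => (hball hx).1 : closedBall w r₀ ⊆ s)
  refine ⟨r₀, hr₀, fun x hx hΦx => ?_, fun r hr hrr₀ => ?_⟩
  · have h1 := happ x hx w (mem_closedBall_self hr₀.le)
    rw [hΦx, hw, ← hAapp, hκ] at h1
    have h2 := hbelow (x - w)
    have h3 : ‖x - w‖ = 0 := by nlinarith [norm_nonneg (x - w)]
    exact sub_eq_zero.1 (norm_eq_zero.1 h3)
  have hsub : closedBall w r ⊆ closedBall w r₀ := closedBall_subset_closedBall hrr₀
  obtain ⟨d₂, hd₂⟩ := eventually_norm_sub_starProjection_comp_le hF hdense hKc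
    (show 0 < c / 4 by positivity)
  obtain ⟨d₃, hd₃⟩ := eventually_norm_sub_starProjection_lt hF hdense
    (isCompact_singleton (x := Φ w)) (show 0 < c / 2 * r by positivity)
  refine ⟨max d₁ (max d₂ d₃), fun d hd => ?_⟩
  have hdd₁ : d₁ ≤ d := (le_max_left _ _).trans hd
  have hdd₂ : d₂ ≤ d := (le_max_left _ _).trans ((le_max_right _ _).trans hd)
  have hdd₃ : d₃ ≤ d := (le_max_right _ _).trans ((le_max_right _ _).trans hd)
  set P := (F d).starProjection with hP
  set f : H → H := fun x => x - P (Φ x) with hf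
  have hfapp : ApproximatesLinearOn f A (closedBall w r) (2 * κ) := by
    intro x hx y hy
    have h1 := happ x (hsub hx) y (hsub hy)
    have h2 := hd₂ d hdd₂ (x - y)
    have h3 : f x - f y - A (x - y) =
        (K w (x - y) - P (K w (x - y))) - P (Φ x - Φ y - K w (x - y)) := by
      simp only [hf, hAapp, map_sub]; abel
    have h4 : ((2 * κ : NNReal) : ℝ) * ‖x - y‖ = c / 4 * ‖x - y‖ + κ * ‖x - y‖ := by
      rw [NNReal.coe_mul, hκ]; push_cast; ring
    rw [h3, h4]
    refine (norm_sub_le _ _).trans (add_le_add h2 ?_)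
    exact ((F d).norm_starProjection_apply_le _).trans h1
  have h2κ : ((2 * κ : NNReal) : ℝ) = c / 2 := by
    rw [NNReal.coe_mul, hκ]; push_cast; ring
  have hsolf : ∀ x, IsGalerkinSolution Φ (F d) x ↔ f x = 0 := fun x => by
    rw [isGalerkinSolution_iff, hf, sub_eq_zero, eq_comm]
  refine ⟨?_, fun x hx y hy hxs hys => ?_, fun x hx => ?_⟩
  -- The image of the ball of radius `r` under `f` contains the ball of radius `(c - c / 2) r`
  -- around `f w = Φ w - P (Φ w)`, and this reaches `0` for large `d`.
  · have h1 := hfapp.surjOn_closedBall_of_nonlinearRightInverse Ainv hr.le subset_rfl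
    have h2 : (0 : H) ∈ closedBall (f w) (((Ainv.nnnorm : ℝ)⁻¹ - (2 * κ : NNReal)) * r) := by
      rw [h2κ, mem_closedBall, dist_comm, dist_zero_right]
      change ‖w - P (Φ w)‖ ≤ ((c⁻¹)⁻¹ - c / 2) * r
      have := hd₃ d hdd₃ (Φ w) rfl
      nth_rewrite 1 [← hw]
      rw [inv_inv]
      linarith
    obtain ⟨x, hx, hfx⟩ := h1 h2
    exact ⟨x, hx, (hsolf x).2 hfx⟩
  · have h1 := hfapp x hx y hy
    rw [(hsolf x).1 hxs, (hsolf y).1 hys, sub_self, zero_sub, norm_neg, h2κ] at h1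
    have h2 := hbelow (x - y)
    have h3 : ‖x - y‖ = 0 := by nlinarith [norm_nonneg (x - y)]
    exact sub_eq_zero.1 (norm_eq_zero.1 h3)
  · refine hd₁ d hdd₁ (K x) (hKs x) (hM x) fun v => ?_
    have h1 : ‖K x - K w‖ < ε := (hball (hsub hx)).2
    rw [← sub_apply]
    exact ((K x - K w).le_opNorm v).trans (by gcongr)

/-- The fixed points are isolated and form a compact set, so they are finitely many and have
disjoint balls of a common radius. For large `d` these balls contain all Galerkin solutions. A ball
around a nondegenerate fixed point holds exactly one, with the same index; a ball around a
degenerate one holds no nondegenerate solution. -/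
theorem exists_galerkin_equiv (hF : Monotone F) (hdense : ⊤ ≤ (⨆ d, F d).topologicalClosure)
    {D : H →L[ℝ] E} (hD : Function.Injective D) (hDc : IsCompactOperator D)
    {Φ : H → H} {K : H → H →L[ℝ] H} (hΦ : ∀ w, HasStrictFDerivAt Φ (K w) w)
    (hK : Continuous K) (hKc : ∀ w, IsCompactOperator (K w)) (hKs : ∀ w, (K w).IsSymmetric)
    (hM : ∀ w, ∃ M : ℝ, ∀ v, inner ℝ (K w v) v ≤ M * ‖D v‖ ^ 2)
    {C : Set H} (hC : IsCompact C) (hΦC : ∀ d w, IsGalerkinSolution Φ (F d) w → Φ w ∈ C)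
    (hΦC' : ∀ w, Φ w = w → w ∈ C)
    (hdeg : ∀ w, Φ w = w → ¬ IsGalerkinNondegenerate (K w) ⊤ →
      ∃ r > 0, (∀ x ∈ closedBall w r, Φ x = x → x = w) ∧ ∃ d₀, ∀ d ≥ d₀, ∀ x ∈ closedBall w r,
        IsGalerkinSolution Φ (F d) x → ¬ IsGalerkinNondegenerate (K x) (F d)) :
    ∃ d₀, ∀ d ≥ d₀,
      {w | IsGalerkinSolution Φ ⊤ w ∧ IsGalerkinNondegenerate (K w) ⊤}.Finite ∧
      ∃ e : {w | IsGalerkinSolution Φ ⊤ w ∧ IsGalerkinNondegenerate (K w) ⊤} ≃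
          {w | IsGalerkinSolution Φ (F d) w ∧ IsGalerkinNondegenerate (K w) (F d)},
        ∀ w, Module.rank ℝ (negSpace (compress (K (e w)) (F d)) (D ∘L (F d).subtypeL)) =
          Module.rank ℝ (negSpace (K w) D) := by
  have hΦcont : Continuous Φ := continuous_iff_continuousAt.2 fun w => (hΦ w).continuousAt
  set Z : Set H := {w | Φ w = w} with hZ
  -- every solution has a good radius
  have hgood : ∀ w, ∃ r₀ > 0, w ∈ Z → (∀ x ∈ closedBall w r₀, Φ x = x → x = w) ∧
      (∀ r > 0, r ≤ r₀ → ∃ d₀, ∀ d ≥ d₀,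
        (IsGalerkinNondegenerate (K w) ⊤ →
        (∃ x ∈ closedBall w r, IsGalerkinSolution Φ (F d) x) ∧
        (∀ x ∈ closedBall w r, ∀ y ∈ closedBall w r, IsGalerkinSolution Φ (F d) x →
          IsGalerkinSolution Φ (F d) y → x = y) ∧
        ∀ x ∈ closedBall w r, IsGalerkinNondegenerate (K x) (F d) ∧
          Module.rank ℝ (negSpace (compress (K x) (F d)) (D ∘L (F d).subtypeL)) =
            Module.rank ℝ (negSpace (K w) D)) ∧
        (¬ IsGalerkinNondegenerate (K w) ⊤ → ∀ x ∈ closedBall w r,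
          IsGalerkinSolution Φ (F d) x → ¬ IsGalerkinNondegenerate (K x) (F d))) := by
    intro w
    by_cases hw : w ∈ Z
    · by_cases hnd : IsGalerkinNondegenerate (K w) ⊤
      · obtain ⟨r₀, hr₀, h1, h2⟩ := exists_local_galerkin hF hdense hD hDc (hΦ w) hK.continuousAt
          (hKc w) hKs hM hw (isGalerkinNondegenerate_top_iff.1 hnd)
        refine ⟨r₀, hr₀, fun _ => ⟨h1, fun r hr hrr => ?_⟩⟩
        obtain ⟨d₀, hd₀⟩ := h2 r hr hrr
        exact ⟨d₀, fun d hd => ⟨fun _ => hd₀ d hd, fun h => absurd hnd h⟩⟩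
      · obtain ⟨r₀, hr₀, h1, d₀, hd₀⟩ := hdeg w hw hnd
        refine ⟨r₀, hr₀, fun _ => ⟨h1, fun r hr hrr => ⟨d₀, fun d hd => ⟨fun h => absurd h hnd,
          fun _ x hx => hd₀ d hd x (closedBall_subset_closedBall hrr hx)⟩⟩⟩⟩
    · exact ⟨1, one_pos, fun h => absurd h hw⟩
  choose r₀ hr₀ hgood using hgood
  have hZc : IsCompact Z := hC.of_isClosed_subset (isClosed_eq hΦcont continuous_id) hΦC'
  have hZf : Z.Finite := by
    obtain ⟨t, htZ, ht⟩ := hZc.elim_nhds_subcover (fun w => closedBall w (r₀ w))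
      fun w _ => closedBall_mem_nhds w (hr₀ w)
    refine t.finite_toSet.subset fun x hx => ?_
    obtain ⟨w, hwt, hxw⟩ := Set.mem_iUnion₂.1 (ht hx)
    rw [(hgood w (htZ w hwt)).1 x hxw hx]
    exact hwt
  -- Mutual distances above `2 * ρ` keep the closed balls disjoint, which gives injectivity of the
  -- bijection.
  obtain ⟨ρ, hρ0, hρ⟩ : ∃ ρ > 0, ∀ w ∈ Z, ρ ≤ r₀ w ∧ ∀ x ∈ Z, x ≠ w → 2 * ρ < dist x w := by
    have h1 : ∀ᶠ ρ : ℝ in nhdsWithin 0 (Set.Ioi 0), ∀ w ∈ Z,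
        ρ ≤ r₀ w ∧ ∀ x ∈ Z, x ≠ w → 2 * ρ < dist x w := by
      rw [Filter.eventually_all_finite hZf]
      intro w _
      refine Filter.Eventually.and ?_ ?_
      · exact nhdsWithin_le_nhds (eventually_le_nhds (hr₀ w))
      · rw [Filter.eventually_all_finite hZf]
        intro x _
        by_cases hxw : x = w
        · simp [hxw]
        · filter_upwards [nhdsWithin_le_nhds (eventually_lt_nhds (half_pos (dist_pos.2 hxw)))]
            with ρ hρ _
          linarith
    obtain ⟨ρ, h2, h3⟩ := (h1.and self_mem_nhdsWithin).exists
    exact ⟨ρ, h3, h2⟩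
  obtain ⟨d₁, hd₁⟩ := exists_forall_isGalerkinSolution_mem hF hdense hΦcont hC hΦC
    (U := ⋃ w ∈ Z, ball w ρ) (isOpen_biUnion fun _ _ => isOpen_ball)
    fun w hw => Set.mem_biUnion hw (mem_ball_self hρ0)
  have hev : ∀ᶠ d in Filter.atTop, ∀ w ∈ Z,
        (IsGalerkinNondegenerate (K w) ⊤ →
        (∃ x ∈ closedBall w ρ, IsGalerkinSolution Φ (F d) x) ∧
        (∀ x ∈ closedBall w ρ, ∀ y ∈ closedBall w ρ, IsGalerkinSolution Φ (F d) x →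
          IsGalerkinSolution Φ (F d) y → x = y) ∧
        ∀ x ∈ closedBall w ρ, IsGalerkinNondegenerate (K x) (F d) ∧
          Module.rank ℝ (negSpace (compress (K x) (F d)) (D ∘L (F d).subtypeL)) =
            Module.rank ℝ (negSpace (K w) D)) ∧
        (¬ IsGalerkinNondegenerate (K w) ⊤ → ∀ x ∈ closedBall w ρ,
          IsGalerkinSolution Φ (F d) x → ¬ IsGalerkinNondegenerate (K x) (F d)) := by
    rw [Filter.eventually_all_finite hZf]
    intro w hw
    obtain ⟨d₀, hd₀⟩ := (hgood w hw).2 ρ hρ0 (hρ w hw).1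
    exact Filter.eventually_atTop.2 ⟨d₀, hd₀⟩
  obtain ⟨d₂, hd₂⟩ := Filter.eventually_atTop.1 hev
  refine ⟨max d₁ d₂, fun d hd => ?_⟩
  have hd₁' := hd₁ d ((le_max_left _ _).trans hd)
  have hd₂' := hd₂ d ((le_max_right _ _).trans hd)
  have hfin : {w | IsGalerkinSolution Φ ⊤ w ∧ IsGalerkinNondegenerate (K w) ⊤}.Finite :=
    hZf.subset fun w hw => isGalerkinSolution_top_iff.1 hw.1
  refine ⟨hfin, ?_⟩
  have hex : ∀ w : {w | IsGalerkinSolution Φ ⊤ w ∧ IsGalerkinNondegenerate (K w) ⊤},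
      ∃ x : {w | IsGalerkinSolution Φ (F d) w ∧ IsGalerkinNondegenerate (K w) (F d)},
        (x : H) ∈ closedBall (w : H) ρ := by
    rintro ⟨w, hw, hnd⟩
    obtain ⟨⟨x, hx, hxs⟩, -, h3⟩ := (hd₂' w (isGalerkinSolution_top_iff.1 hw)).1 hnd
    exact ⟨⟨x, hxs, (h3 x hx).1⟩, hx⟩
  choose e he using hex
  refine ⟨Equiv.ofBijective e ⟨fun w w' h => ?_, fun x => ?_⟩, fun w => ?_⟩
  · by_contra hne
    have h1 := he w
    have h2 := he w'
    rw [← h] at h2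
    have h3 := (hρ (w' : H) (isGalerkinSolution_top_iff.1 w'.2.1)).2 w
      (isGalerkinSolution_top_iff.1 w.2.1) fun h => hne (Subtype.ext h)
    rw [mem_closedBall] at h1 h2
    have := dist_triangle_left (w : H) (w' : H) (e w : H)
    linarith
  · obtain ⟨w, hwZ, hxw⟩ := Set.mem_iUnion₂.1 (hd₁' x x.2.1)
    have hxw' := ball_subset_closedBall hxw
    have hnd : IsGalerkinNondegenerate (K w) ⊤ := by
      by_contra h
      exact (hd₂' w hwZ).2 h x hxw' x.2.1 x.2.2
    let w' : {w | IsGalerkinSolution Φ ⊤ w ∧ IsGalerkinNondegenerate (K w) ⊤} :=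
      ⟨w, isGalerkinSolution_top_iff.2 hwZ, hnd⟩
    exact ⟨w', Subtype.ext (((hd₂' w hwZ).1 hnd).2.1 _ (he w') _ hxw' (e w').2.1 x.2.1)⟩
  · exact (((hd₂' w (isGalerkinSolution_top_iff.1 w.2.1)).1 w.2.2).2.2 _ (he w)).2

end GalerkinTheorem

/-! ### The sequence space `ℓ²` and compact operators into it -/

/-- The real Hilbert space of square summable sequences. -/
abbrev EllTwo : Type := lp (fun _ : ℕ => ℝ) 2

namespace EllTwo

theorem summable_sq (f : EllTwo) : Summable fun n => f n ^ 2 := by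
  have := lp.summable_inner (𝕜 := ℝ) f f
  simpa [sq] using this

theorem norm_sq_eq (f : EllTwo) : ‖f‖ ^ 2 = ∑' n, f n ^ 2 := by
  rw [← real_inner_self_eq_norm_sq, lp.inner_eq_tsum]
  simp [sq]

theorem inner_eq (f g : EllTwo) : inner ℝ f g = ∑' n, f n * g n := by
  rw [lp.inner_eq_tsum]
  simp [mul_comm]

theorem memℓp_of_summable_sq {f : ℕ → ℝ} (hf : Summable fun n => f n ^ 2) :
    Memℓp f 2 := by
  refine memℓp_gen ?_
  simpa using hf

theorem norm_le_of_forall_abs_le {f : EllTwo} {b : ℕ → ℝ} (hb : Summable fun n => b n ^ 2)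
    (h : ∀ n, |f n| ≤ b n) : ‖f‖ ≤ Real.sqrt (∑' n, b n ^ 2) := by
  refine Real.le_sqrt_of_sq_le ?_
  rw [norm_sq_eq]
  refine (summable_sq f).tsum_le_tsum (fun n => ?_) hb
  rw [← sq_abs (f n)]
  exact pow_le_pow_left₀ (abs_nonneg _) (h n) 2

theorem abs_apply_le (f : EllTwo) (n : ℕ) : |f n| ≤ ‖f‖ := by
  have := lp.norm_apply_le_norm two_ne_zero f n
  simpa using this

theorem summable_abs_mul (f : EllTwo) {a : ℕ → ℝ} (ha : Summable fun n => a n ^ 2) :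
    Summable fun n => |f n * a n| := by
  have := lp.summable_inner (𝕜 := ℝ) f ⟨a, memℓp_of_summable_sq ha⟩
  have h2 := this.abs
  simpa [mul_comm] using h2

theorem tsum_abs_mul_le (f : EllTwo) {a : ℕ → ℝ} (ha : Summable fun n => a n ^ 2) :
    ∑' n, |f n * a n| ≤ ‖f‖ * Real.sqrt (∑' n, a n ^ 2) := by
  let f' : EllTwo := ⟨fun n => |f n|, memℓp_of_summable_sq (by simpa using summable_sq f)⟩
  let a' : EllTwo := ⟨fun n => |a n|, memℓp_of_summable_sq (by simpa using ha)⟩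
  have h1 : inner ℝ f' a' = ∑' n, |f n * a n| := by
    rw [inner_eq]
    simp only [abs_mul]
    rfl
  have h2 : ‖f'‖ = ‖f‖ := by
    rw [← sq_eq_sq₀ (norm_nonneg _) (norm_nonneg _), norm_sq_eq, norm_sq_eq]
    exact tsum_congr fun n => sq_abs _
  have h3 : ‖a'‖ = Real.sqrt (∑' n, a n ^ 2) := by
    rw [← Real.sqrt_sq (norm_nonneg a'), norm_sq_eq]
    congr 1
    exact tsum_congr fun n => sq_abs _
  rw [← h1, ← h2, ← h3]
  exact real_inner_le_norm _ _

section Operators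

variable {X : Type*} [NormedAddCommGroup X] [NormedSpace ℝ X] {a : ℕ → ℝ}
  (ha : Summable fun n => a n ^ 2)

theorem summable_sq_of_abs_le {f b : ℕ → ℝ} (hb : Summable fun n => b n ^ 2)
    (h : ∀ n, |f n| ≤ b n) : Summable fun n => f n ^ 2 := by
  refine Summable.of_nonneg_of_le (fun n => sq_nonneg _) (fun n => ?_) hb
  rw [← sq_abs (f n)]
  exact pow_le_pow_left₀ (abs_nonneg _) (h n) 2

/-- The operator into `ℓ²` with coordinates `ℓ n`, where the norms of the functionals `ℓ n` are
square summable. -/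
def ofFunctionals (ℓ : ℕ → X →L[ℝ] ℝ) (hℓ : ∀ n, ‖ℓ n‖ ≤ a n) : X →L[ℝ] EllTwo :=
  have hb : ∀ x n, |ℓ n x| ≤ a n * ‖x‖ := fun x n =>
    ((ℓ n).le_opNorm x).trans (by gcongr; exact hℓ n)
  have hs : ∀ x : X, Summable fun n => (a n * ‖x‖) ^ 2 := fun x => by
    simpa only [mul_pow] using ha.mul_right (‖x‖ ^ 2)
  LinearMap.mkContinuous
    { toFun := fun x => ⟨fun n => ℓ n x,
        memℓp_of_summable_sq (summable_sq_of_abs_le (hs x) (hb x))⟩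
      map_add' := fun x y => by ext n; exact map_add (ℓ n) x y
      map_smul' := fun c x => by ext n; simp }
    (Real.sqrt (∑' n, a n ^ 2)) fun x => by
      refine (norm_le_of_forall_abs_le (hs x) (hb x)).trans_eq ?_
      simp only [mul_pow]
      rw [tsum_mul_right, Real.sqrt_mul' _ (sq_nonneg _), Real.sqrt_sq (norm_nonneg _)]

@[simp]
theorem ofFunctionals_apply (ℓ : ℕ → X →L[ℝ] ℝ) (hℓ : ∀ n, ‖ℓ n‖ ≤ a n) (x : X) (n : ℕ) :
    ofFunctionals ha ℓ hℓ x n = ℓ n x := rfl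

/-- The finite-rank truncations `T N` converge in operator norm, with error the square root of the
tail of `∑ a n ^ 2`. -/
theorem isCompactOperator_ofFunctionals (ℓ : ℕ → X →L[ℝ] ℝ) (hℓ : ∀ n, ‖ℓ n‖ ≤ a n) :
    IsCompactOperator (ofFunctionals ha ℓ hℓ) := by
  let T : ℕ → X →L[ℝ] EllTwo := fun N =>
    ∑ n ∈ Finset.range N, (ℓ n).smulRight (lp.single 2 n (1 : ℝ) : EllTwo)
  have hT : ∀ N x n, T N x n = if n < N then ℓ n x else 0 := by
    intro N x n
    simp only [T, sum_apply, lp.coeFn_sum, Finset.sum_apply]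
    simp [Pi.single_apply]
  have hTc : ∀ N, IsCompactOperator (T N) := by
    intro N
    have : T N ∈ compactOperator (RingHom.id ℝ) X EllTwo := by
      refine Submodule.sum_mem _ fun n _ => ?_
      exact ((isCompactOperator_id (E := ℝ)).clm_comp
        (ContinuousLinearMap.toSpanSingleton ℝ (lp.single 2 n (1 : ℝ) : EllTwo))).comp_clm (ℓ n)
    exact this
  refine isCompactOperator_of_tendsto (l := Filter.atTop) (F := T) ?_
    (Filter.Eventually.of_forall hTc)
  rw [tendsto_iff_norm_sub_tendsto_zero]
  have hb : ∀ N, ‖T N - ofFunctionals ha ℓ hℓ‖ ≤ Real.sqrt (∑' n, a (n + N) ^ 2) := by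
    intro N
    refine ContinuousLinearMap.opNorm_le_bound _ (Real.sqrt_nonneg _) fun x => ?_
    have hs : Summable fun n => (if n < N then 0 else a n * ‖x‖) ^ 2 := by
      refine summable_sq_of_abs_le (b := fun n => |a n| * ‖x‖) ?_ fun n => ?_
      · simpa only [mul_pow, sq_abs] using ha.mul_right (‖x‖ ^ 2)
      · split_ifs
        · simp only [abs_zero]; positivity
        · rw [abs_mul, abs_norm]
    refine (norm_le_of_forall_abs_le hs fun n => ?_).trans_eq ?_
    · have : (T N - ofFunctionals ha ℓ hℓ) x n = T N x n - ℓ n x := rfl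
      rw [this, hT]
      split_ifs
      · simp
      · rw [zero_sub, abs_neg]
        exact ((ℓ n).le_opNorm x).trans (by gcongr; exact hℓ n)
    · rw [← hs.sum_add_tsum_nat_add N, Finset.sum_eq_zero, zero_add]
      · simp only [not_lt.2 (Nat.le_add_left N _), if_false, mul_pow]
        rw [tsum_mul_right, Real.sqrt_mul' _ (sq_nonneg _), Real.sqrt_sq (norm_nonneg _)]
      · intro n hn
        simp [Finset.mem_range.1 hn]
  refine squeeze_zero (fun _ => norm_nonneg _) hb ?_
  have := tendsto_sum_nat_add fun n => a n ^ 2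
  have h2 := (Real.continuous_sqrt.tendsto 0).comp this
  simpa [Function.comp_def] using h2

/-- The operator `w ↦ ∑ n, w n • φ n` for square summable `‖φ n‖`. -/
def synthesis [CompleteSpace X] (φ : ℕ → X) (hφ : ∀ n, ‖φ n‖ ≤ a n) : EllTwo →L[ℝ] X :=
  have hn : ∀ (w : EllTwo) n, ‖w n • φ n‖ ≤ |w n * a n| := fun w n => by
    rw [norm_smul, abs_mul, Real.norm_eq_abs]
    gcongr
    exact (hφ n).trans (le_abs_self _)
  have hs : ∀ w : EllTwo, Summable fun n => w n • φ n := fun w =>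
    Summable.of_norm_bounded (summable_abs_mul w ha) (hn w)
  LinearMap.mkContinuous
    { toFun := fun w => ∑' n, w n • φ n
      map_add' := fun v w => by
        simp only [lp.coeFn_add, Pi.add_apply, add_smul]
        exact (hs v).tsum_add (hs w)
      map_smul' := fun c w => by
        simp only [lp.coeFn_smul, Pi.smul_apply, smul_assoc, RingHom.id_apply]
        exact (hs w).tsum_const_smul c }
    (Real.sqrt (∑' n, a n ^ 2)) fun w => by
      refine (tsum_of_norm_bounded (summable_abs_mul w ha).hasSum (hn w)).trans ?_
      rw [mul_comm]
      exact tsum_abs_mul_le w ha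

theorem hasSum_synthesis [CompleteSpace X] (φ : ℕ → X) (hφ : ∀ n, ‖φ n‖ ≤ a n) (w : EllTwo) :
    HasSum (fun n => w n • φ n) (synthesis ha φ hφ w) := by
  refine Summable.hasSum (Summable.of_norm_bounded (summable_abs_mul w ha) fun n => ?_)
  rw [norm_smul, abs_mul, Real.norm_eq_abs]
  gcongr
  exact (hφ n).trans (le_abs_self _)

end Operators

/-- The sequences vanishing beyond `d`. -/
def firstModes (d : ℕ) : Submodule ℝ EllTwo where
  carrier := {w | ∀ n, d < n → w n = 0}
  zero_mem' := fun n _ => rfl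
  add_mem' := fun {v w} hv hw n hn => by simp [hv n hn, hw n hn]
  smul_mem' := fun c w hw n hn => by simp [hw n hn]

instance finiteDimensional_firstModes (d : ℕ) : FiniteDimensional ℝ (firstModes d) := by
  let f : firstModes d →ₗ[ℝ] (Fin (d + 1) → ℝ) :=
    { toFun := fun w i => (w : EllTwo) i
      map_add' := fun v w => rfl
      map_smul' := fun c w => rfl }
  refine FiniteDimensional.of_injective f ?_
  rw [← LinearMap.ker_eq_bot, LinearMap.ker_eq_bot']
  intro w hw
  refine Subtype.ext (lp.ext (funext fun n => ?_))
  by_cases hn : d < n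
  · exact w.2 n hn
  · exact congrFun hw ⟨n, by omega⟩

theorem monotone_firstModes : Monotone firstModes := fun _ _ h _ hw n hn =>
  hw n (lt_of_le_of_lt h hn)

theorem single_mem_firstModes {n d : ℕ} (h : n ≤ d) (c : ℝ) :
    (lp.single 2 n c : EllTwo) ∈ firstModes d := fun k hk => by
  rw [lp.single_apply_ne]
  omega

theorem dense_firstModes : ⊤ ≤ (⨆ d, firstModes d).topologicalClosure := by
  intro w _
  have h := lp.hasSum_single (p := 2) (by simp) w
  have h2 := h.tendsto_sum_nat
  refine mem_closure_of_tendsto h2 (Filter.Eventually.of_forall fun N => ?_)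
  refine Submodule.sum_mem _ fun n _ => ?_
  exact Submodule.mem_iSup_of_mem n (single_mem_firstModes le_rfl _)

theorem inner_single_left (n : ℕ) (c : ℝ) (f : EllTwo) :
    inner ℝ (lp.single 2 n c : EllTwo) f = c * f n := by
  rw [lp.inner_single_left]
  simp [mul_comm]

end EllTwo

/-! ### Superposition operators and integration on bounded continuous functions -/

section Nemytskii

open BoundedContinuousFunction

/-- Composition with a continuous function, as a map on bounded continuous functions. -/
def nemytskii (g : ℝ → ℝ) (hg : Continuous g) (u : ℝ →ᵇ ℝ) : ℝ →ᵇ ℝ :=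
  BoundedContinuousFunction.ofNormedAddCommGroup (fun x => g (u x)) (hg.comp u.continuous)
    ((isCompact_closedBall (0 : ℝ) ‖u‖).exists_bound_of_continuousOn hg.continuousOn).choose
    fun x => ((isCompact_closedBall (0 : ℝ) ‖u‖).exists_bound_of_continuousOn
      hg.continuousOn).choose_spec _ (by simpa using u.norm_coe_le_norm x)

@[simp]
theorem nemytskii_apply {g : ℝ → ℝ} (hg : Continuous g) (u : ℝ →ᵇ ℝ) (x : ℝ) :
    nemytskii g hg u x = g (u x) := rfl

theorem exists_forall_norm_nemytskii_le {g : ℝ → ℝ} (hg : Continuous g) (R : ℝ) :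
    ∃ C, ∀ u : ℝ →ᵇ ℝ, ‖u‖ ≤ R → ‖nemytskii g hg u‖ ≤ C := by
  obtain ⟨C, hC⟩ := (isCompact_closedBall (0 : ℝ) R).exists_bound_of_continuousOn hg.continuousOn
  refine ⟨C, fun u hu => ?_⟩
  rw [norm_le_of_nonempty]
  exact fun x => hC _ (by simpa using (u.norm_coe_le_norm x).trans hu)

theorem continuous_nemytskii {g : ℝ → ℝ} (hg : Continuous g) : Continuous (nemytskii g hg) := by
  rw [Metric.continuous_iff]
  intro u ε hε
  have huc := (isCompact_closedBall (0 : ℝ) (‖u‖ + 1)).uniformContinuousOn_of_continuous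
    hg.continuousOn
  rw [Metric.uniformContinuousOn_iff] at huc
  obtain ⟨δ, hδ, h⟩ := huc (ε / 2) (half_pos hε)
  refine ⟨min δ 1, by positivity, fun v hv => ?_⟩
  have hv1 : dist v u < δ := hv.trans_le (min_le_left _ _)
  have hv2 : dist v u < 1 := hv.trans_le (min_le_right _ _)
  refine lt_of_le_of_lt ((dist_le (half_pos hε).le).2 fun x => ?_) (half_lt_self hε)
  have h1 : ‖v‖ ≤ ‖u‖ + 1 := by
    rw [dist_eq_norm] at hv2
    have := norm_sub_norm_le v u
    linarith
  refine (h (v x) ?_ (u x) ?_ ((dist_coe_le_dist x).trans_lt hv1)).le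
  · simpa using (v.norm_coe_le_norm x).trans h1
  · simpa using (u.norm_coe_le_norm x).trans (by linarith)

/-- Uniform continuity of `g'` on the ball of radius `‖u‖ + 1` yields one `δ` for all `x`, and the
mean value inequality for `s ↦ g s - g'(u x) s` does the rest. In the sup norm no growth condition
on `g` is involved. -/
theorem hasStrictFDerivAt_nemytskii {g : ℝ → ℝ} (hg : ContDiff ℝ 1 g) (u : ℝ →ᵇ ℝ) :
    HasStrictFDerivAt (nemytskii g hg.continuous)
      (ContinuousLinearMap.mul ℝ (ℝ →ᵇ ℝ) (nemytskii (deriv g) (hg.continuous_deriv le_rfl) u))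
      u := by
  rw [hasStrictFDerivAt_iff_isLittleO, Asymptotics.isLittleO_iff]
  intro ε hε
  have huc := (isCompact_closedBall (0 : ℝ) (‖u‖ + 1)).uniformContinuousOn_of_continuous
    (hg.continuous_deriv le_rfl).continuousOn
  rw [Metric.uniformContinuousOn_iff] at huc
  obtain ⟨δ, hδ, h⟩ := huc ε hε
  have hmem : Metric.ball u (min δ 1) ×ˢ Metric.ball u (min δ 1) ∈ nhds (u, u) :=
    prod_mem_nhds (Metric.ball_mem_nhds _ (by positivity)) (Metric.ball_mem_nhds _ (by positivity))
  filter_upwards [hmem] with p hp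
  have hclose : ∀ v ∈ Metric.ball u (min δ 1), ∀ x, |v x - u x| < min δ 1 := fun v hv x => by
    rw [← Real.dist_eq]
    exact (dist_coe_le_dist x).trans_lt hv
  rw [norm_le (by positivity)]
  intro x
  have hball : ∀ s ∈ Metric.ball (u x) (min δ 1), ‖deriv g s - deriv g (u x)‖ ≤ ε := by
    intro s hs
    rw [Metric.mem_ball] at hs
    rw [← dist_eq_norm]
    have hux := u.norm_coe_le_norm x
    refine (h s ?_ (u x) ?_ (hs.trans_le (min_le_left _ _))).le
    · have h1 : dist s (u x) < 1 := hs.trans_le (min_le_right _ _)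
      rw [dist_eq_norm] at h1
      have := norm_sub_norm_le s (u x)
      rw [mem_closedBall_zero_iff]
      linarith
    · rw [mem_closedBall_zero_iff]
      linarith
  have hmv := (convex_ball (u x) (min δ 1)).norm_image_sub_le_of_norm_hasDerivWithin_le
    (f := fun s => g s - deriv g (u x) * s) (f' := fun s => deriv g s - deriv g (u x)) (C := ε)
    (x := p.2 x) (y := p.1 x)
    (fun s _ => by
      have h1 := ((hg.differentiable one_ne_zero) s).hasDerivAt
      have h2 : HasDerivAt (fun s => deriv g (u x) * s) (deriv g (u x)) s := by
        simpa using (hasDerivAt_id s).const_mul (deriv g (u x))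
      exact (h1.sub h2).hasDerivWithinAt)
    hball (by rw [Metric.mem_ball, Real.dist_eq]; exact hclose _ hp.2 x)
    (by rw [Metric.mem_ball, Real.dist_eq]; exact hclose _ hp.1 x)
  calc _ = ‖g (p.1 x) - deriv g (u x) * p.1 x - (g (p.2 x) - deriv g (u x) * p.2 x)‖ := by
        congr 1
        simp [ContinuousLinearMap.mul_apply']
        ring
    _ ≤ ε * ‖p.1 x - p.2 x‖ := hmv
    _ ≤ ε * ‖p.1 - p.2‖ := by
        gcongr
        exact (p.1 - p.2).norm_coe_le_norm x

end Nemytskii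

section IntegralFunctional

open BoundedContinuousFunction MeasureTheory

/-- Integration over `[0, L]`, as a functional on bounded continuous functions. -/
def integralFunctional (L : ℝ) : (ℝ →ᵇ ℝ) →L[ℝ] ℝ :=
  LinearMap.mkContinuous
    { toFun := fun u => ∫ x in (0 : ℝ)..L, u x
      map_add' := fun u v => intervalIntegral.integral_add
        (u.continuous.intervalIntegrable _ _) (v.continuous.intervalIntegrable _ _)
      map_smul' := fun c u => intervalIntegral.integral_const_mul c _ }
    |L| fun u => by
      have := intervalIntegral.norm_integral_le_of_norm_le_const (a := 0) (b := L)
        (f := u) (C := ‖u‖) fun x _ => u.norm_coe_le_norm x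
      rwa [sub_zero, mul_comm] at this

@[simp]
theorem integralFunctional_apply (L : ℝ) (u : ℝ →ᵇ ℝ) :
    integralFunctional L u = ∫ x in (0 : ℝ)..L, u x := rfl

theorem norm_integralFunctional_le (L : ℝ) : ‖integralFunctional L‖ ≤ |L| :=
  LinearMap.mkContinuous_norm_le _ (abs_nonneg L) _

end IntegralFunctional

/-! ### The Neumann problem in orthonormal `H¹` coordinates -/

open Real in
theorem integral_cos_int_mul_pi_div {L : ℝ} (hL : 0 < L) (k : ℤ) :
    ∫ x in (0 : ℝ)..L, cos (k * π * x / L) = if k = 0 then L else 0 := by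
  split_ifs with hk
  · simp [hk]
  · have hc : (k * π / L : ℝ) ≠ 0 := by
      have : (k : ℝ) ≠ 0 := Int.cast_ne_zero.2 hk
      positivity
    have h1 : ∀ x : ℝ, cos (k * π * x / L) = cos (k * π / L * x) := fun x => by
      congr 1; ring
    simp only [h1]
    rw [intervalIntegral.integral_comp_mul_left _ hc, integral_cos, mul_zero, sin_zero, sub_zero,
      div_mul_cancel₀ _ hL.ne', sin_int_mul_pi, smul_zero]

namespace Neumann

open Real BoundedContinuousFunction

/-- The multiplicity of `|k| = n`, `k : ℤ`. -/
def mult (n : ℕ) : ℝ := if n = 0 then 1 else 2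

theorem mult_pos (n : ℕ) : 0 < mult n := by
  unfold mult; split_ifs <;> norm_num

theorem mult_le_two (n : ℕ) : mult n ≤ 2 := by
  unfold mult; split_ifs <;> norm_num

/-- The eigenvalues of `-d²/dx²` with Neumann boundary conditions. -/
def lam (L : ℝ) (n : ℕ) : ℝ := (π * n) ^ 2 / L ^ 2

theorem lam_nonneg (L : ℝ) (n : ℕ) : 0 ≤ lam L n := by unfold lam; positivity

theorem one_add_lam_pos (L : ℝ) (n : ℕ) : 0 < 1 + lam L n := by
  linarith [lam_nonneg L n]

/-- The factor between orthonormal coordinates for the `H¹` norm and Fourier coefficients. -/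
def coef (L : ℝ) (n : ℕ) : ℝ := (√(mult n * (1 + lam L n)))⁻¹

theorem coef_pos (L : ℝ) (n : ℕ) : 0 < coef L n := by
  have := mult_pos n
  have := one_add_lam_pos L n
  unfold coef; positivity

theorem coef_sq (L : ℝ) (n : ℕ) : coef L n ^ 2 = (mult n * (1 + lam L n))⁻¹ := by
  have := mult_pos n
  have := one_add_lam_pos L n
  rw [coef, inv_pow, sq_sqrt (by positivity)]

theorem mult_mul_coef_sq (L : ℝ) (n : ℕ) : mult n * coef L n ^ 2 = (1 + lam L n)⁻¹ := by
  rw [coef_sq, mul_inv, mul_inv_cancel_left₀ (mult_pos n).ne']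

variable {L : ℝ}

theorem summable_inv_one_add_lam (hL : 0 < L) : Summable fun n => (1 + lam L n)⁻¹ := by
  rw [← summable_nat_add_iff 1]
  have h := ((summable_nat_add_iff 1).2 (summable_nat_pow_inv.2 one_lt_two)).mul_left
    ((π ^ 2 / L ^ 2)⁻¹)
  refine Summable.of_nonneg_of_le (fun n => (inv_pos.2 (one_add_lam_pos L _)).le) (fun n => ?_) h
  rw [← mul_inv]
  refine inv_anti₀ (by positivity) ?_
  unfold lam
  rw [mul_pow, mul_div_right_comm]
  linarith

/-- The sup norm of the `n`-th mode. -/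
def amp (L : ℝ) (n : ℕ) : ℝ := mult n * coef L n / √L

theorem amp_pos (hL : 0 < L) (n : ℕ) : 0 < amp L n := by
  have := mult_pos n
  have := coef_pos L n
  unfold amp; positivity

theorem amp_sq (hL : 0 < L) (n : ℕ) : amp L n ^ 2 = mult n / L * (1 + lam L n)⁻¹ := by
  rw [amp, div_pow, mul_pow, sq_sqrt hL.le, ← mult_mul_coef_sq]
  ring

theorem summable_amp_sq (hL : 0 < L) : Summable fun n => amp L n ^ 2 := by
  refine Summable.of_nonneg_of_le (fun n => sq_nonneg _) (fun n => ?_)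
    ((summable_inv_one_add_lam hL).mul_left (2 / L))
  rw [amp_sq hL]
  have := inv_pos.2 (one_add_lam_pos L n)
  gcongr
  exact mult_le_two n

/-- The cosine modes, normalized in `H¹`. -/
def mode (L : ℝ) (n : ℕ) : ℝ →ᵇ ℝ :=
  BoundedContinuousFunction.ofNormedAddCommGroup (fun x => amp L n * cos (n * π * x / L))
    (by fun_prop) |amp L n| fun x => by
      rw [norm_mul, Real.norm_eq_abs, Real.norm_eq_abs]
      exact mul_le_of_le_one_right (abs_nonneg _) (abs_cos_le_one _)

theorem mode_apply (n : ℕ) (x : ℝ) : mode L n x = amp L n * cos (n * π * x / L) := rfl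

theorem norm_mode_le (hL : 0 < L) (n : ℕ) : ‖mode L n‖ ≤ amp L n := by
  rw [norm_le_of_nonempty]
  intro x
  rw [mode_apply, norm_mul, Real.norm_eq_abs, Real.norm_eq_abs, abs_of_pos (amp_pos hL n)]
  exact mul_le_of_le_one_right (amp_pos hL n).le (abs_cos_le_one _)

/-- Cosines are orthogonal in `L²`; since the modes are normalized in `H¹`, their squared `L²` norm
is `(1 + lam L n)⁻¹`. -/
theorem integral_mode_mul_mode (hL : 0 < L) (m n : ℕ) :
    integralFunctional L (mode L m * mode L n) = if m = n then (1 + lam L n)⁻¹ else 0 := by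
  have h1 : ∀ x : ℝ, (mode L m * mode L n) x = amp L m * amp L n / 2 *
      (cos (((m - n : ℤ) : ℝ) * π * x / L) + cos (((m + n : ℤ) : ℝ) * π * x / L)) := by
    intro x
    rw [BoundedContinuousFunction.mul_apply, mode_apply, mode_apply]
    have h2 : ((m - n : ℤ) : ℝ) * π * x / L = m * π * x / L - n * π * x / L := by push_cast; ring
    have h3 : ((m + n : ℤ) : ℝ) * π * x / L = m * π * x / L + n * π * x / L := by push_cast; ring
    rw [h2, h3, cos_sub, cos_add]
    ring
  rw [integralFunctional_apply]
  simp only [h1]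
  rw [intervalIntegral.integral_const_mul, intervalIntegral.integral_add
    (Continuous.intervalIntegrable (by fun_prop) _ _)
    (Continuous.intervalIntegrable (by fun_prop) _ _), integral_cos_int_mul_pi_div hL,
    integral_cos_int_mul_pi_div hL]
  by_cases hmn : m = n
  · subst hmn
    simp only [sub_self, if_true]
    rw [← sq, amp_sq hL]
    by_cases hm : m = 0
    · simp [hm, mult]
      field_simp
      norm_num
    · have : ¬ ((m : ℤ) + m = 0) := by omega
      simp [hm, mult, this]
      field_simp
  · have h2 : ¬ ((m : ℤ) - n = 0) := by omega
    have h3 : ¬ ((m : ℤ) + n = 0) := by omega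
    rw [if_neg h2, if_neg h3, if_neg hmn]
    ring

/-- The function with orthonormal `H¹` coordinates `w`. -/
def synth (hL : 0 < L) : EllTwo →L[ℝ] (ℝ →ᵇ ℝ) :=
  EllTwo.synthesis (summable_amp_sq hL) (mode L) (norm_mode_le hL)

theorem hasSum_synth (hL : 0 < L) (w : EllTwo) :
    HasSum (fun n => w n • mode L n) (synth hL w) :=
  EllTwo.hasSum_synthesis (summable_amp_sq hL) (mode L) (norm_mode_le hL) w

/-- The functional `g ↦ ∫ mode n * g`. -/
def modeFunctional (L : ℝ) (n : ℕ) : (ℝ →ᵇ ℝ) →L[ℝ] ℝ :=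
  integralFunctional L ∘L ContinuousLinearMap.mul ℝ (ℝ →ᵇ ℝ) (mode L n)

theorem modeFunctional_apply (n : ℕ) (g : ℝ →ᵇ ℝ) :
    modeFunctional L n g = integralFunctional L (mode L n * g) := rfl

theorem norm_modeFunctional_le (hL : 0 < L) (n : ℕ) : ‖modeFunctional L n‖ ≤ L * amp L n := by
  refine (ContinuousLinearMap.opNorm_comp_le _ _).trans ?_
  have h1 := norm_integralFunctional_le L
  rw [abs_of_pos hL] at h1
  have h2 := (ContinuousLinearMap.opNorm_mul_apply_le ℝ (ℝ →ᵇ ℝ) (mode L n)).trans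
    (norm_mode_le hL n)
  gcongr

theorem summable_mul_amp_sq (hL : 0 < L) : Summable fun n => (L * amp L n) ^ 2 := by
  simpa only [mul_pow] using (summable_amp_sq hL).mul_left (L ^ 2)

/-- The adjoint of `synth` with respect to integration over `[0, L]`. -/
def analysis (hL : 0 < L) : (ℝ →ᵇ ℝ) →L[ℝ] EllTwo :=
  EllTwo.ofFunctionals (summable_mul_amp_sq hL) (modeFunctional L) (norm_modeFunctional_le hL)

theorem analysis_apply (hL : 0 < L) (g : ℝ →ᵇ ℝ) (n : ℕ) :
    analysis hL g n = integralFunctional L (mode L n * g) := rfl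

theorem isCompactOperator_analysis (hL : 0 < L) : IsCompactOperator (analysis hL) :=
  EllTwo.isCompactOperator_ofFunctionals _ _ _

theorem inner_analysis (hL : 0 < L) (g : ℝ →ᵇ ℝ) (w : EllTwo) :
    inner ℝ (analysis hL g) w = integralFunctional L (g * synth hL w) := by
  have h1 : HasSum (fun n => integralFunctional L (g * (w n • mode L n)))
      (integralFunctional L (g * synth hL w)) := (hasSum_synth hL w).mapL
    (integralFunctional L ∘L ContinuousLinearMap.mul ℝ (ℝ →ᵇ ℝ) g)
  rw [EllTwo.inner_eq]
  refine HasSum.tsum_eq ?_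
  convert h1 using 2 with n
  rw [analysis_apply, mul_smul_comm, map_smul, smul_eq_mul, mul_comm, mul_comm g]

/-- Coordinates as continuous functionals. -/
def coord (n : ℕ) : EllTwo →L[ℝ] ℝ := innerSL ℝ (lp.single 2 n (1 : ℝ) : EllTwo)

theorem coord_apply (n : ℕ) (w : EllTwo) : coord n w = w n := by
  simp [coord, EllTwo.inner_single_left]

theorem norm_coord_le (n : ℕ) : ‖coord n‖ ≤ 1 := by
  refine ContinuousLinearMap.opNorm_le_bound _ zero_le_one fun w => ?_
  rw [coord_apply, one_mul]
  exact EllTwo.abs_apply_le w n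

/-- The embedding of `H¹` into `L²` in orthonormal coordinates. -/
def embed (hL : 0 < L) : EllTwo →L[ℝ] EllTwo :=
  EllTwo.ofFunctionals (a := fun n => √((1 + lam L n)⁻¹))
    (by simpa only [sq_sqrt (inv_pos.2 (one_add_lam_pos L _)).le] using summable_inv_one_add_lam hL)
    (fun n => √((1 + lam L n)⁻¹) • coord n) (fun n => by
      rw [norm_smul, Real.norm_eq_abs, abs_of_nonneg (sqrt_nonneg _)]
      exact mul_le_of_le_one_right (sqrt_nonneg _) (norm_coord_le n))

theorem embed_apply (hL : 0 < L) (w : EllTwo) (n : ℕ) :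
    embed hL w n = √((1 + lam L n)⁻¹) * w n := by
  change √((1 + lam L n)⁻¹) * coord n w = _
  rw [coord_apply]

theorem isCompactOperator_embed (hL : 0 < L) : IsCompactOperator (embed hL) :=
  EllTwo.isCompactOperator_ofFunctionals _ _ _

theorem embed_injective (hL : 0 < L) : Function.Injective (embed hL) := by
  intro v w h
  refine lp.ext (funext fun n => ?_)
  have h1 : embed hL v n = embed hL w n := by rw [h]
  rw [embed_apply, embed_apply] at h1
  have := inv_pos.2 (one_add_lam_pos L n)
  exact mul_left_cancel₀ (by positivity) h1

theorem inner_embed (hL : 0 < L) (v w : EllTwo) :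
    inner ℝ (embed hL v) (embed hL w) = ∑' n, (1 + lam L n)⁻¹ * (v n * w n) := by
  rw [EllTwo.inner_eq]
  refine tsum_congr fun n => ?_
  rw [embed_apply, embed_apply]
  have := mul_self_sqrt (inv_pos.2 (one_add_lam_pos L n)).le
  linear_combination v n * w n * this

theorem analysis_synth_apply (hL : 0 < L) (v : EllTwo) (n : ℕ) :
    analysis hL (synth hL v) n = (1 + lam L n)⁻¹ * v n := by
  have h1 : HasSum (fun k => modeFunctional L n (v k • mode L k)) (analysis hL (synth hL v) n) :=
    (hasSum_synth hL v).mapL (modeFunctional L n)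
  have h2 : HasSum (fun k => v k * modeFunctional L n (mode L k)) (analysis hL (synth hL v) n) := by
    convert h1 using 2
    rw [map_smul, smul_eq_mul]
  refine h2.unique ?_
  have h3 : ∀ k, v k * modeFunctional L n (mode L k) =
      if k = n then (1 + lam L n)⁻¹ * v n else 0 := by
    intro k
    rw [modeFunctional_apply, integral_mode_mul_mode hL]
    by_cases h : n = k
    · subst h
      simp [mul_comm]
    · rw [if_neg h, if_neg (Ne.symm h), mul_zero]
  simp only [h3]
  exact hasSum_ite_eq n _

theorem integral_synth_mul_synth (hL : 0 < L) (v w : EllTwo) :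
    integralFunctional L (synth hL v * synth hL w) = inner ℝ (embed hL v) (embed hL w) := by
  rw [← inner_analysis, inner_embed, EllTwo.inner_eq]
  refine tsum_congr fun n => ?_
  rw [analysis_synth_apply]
  ring

/-- The map `w ↦ S† (G (S w))`; its fixed points are the solutions of the stationary equation
for `G u = u - U' u`. -/
def fixMap (hL : 0 < L) (G : ℝ → ℝ) (hG : Continuous G) (w : EllTwo) : EllTwo :=
  analysis hL (nemytskii G hG (synth hL w))

/-- The derivative of `fixMap`. -/
def fixDeriv (hL : 0 < L) (G : ℝ → ℝ) (hG : Continuous (deriv G)) (w : EllTwo) :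
    EllTwo →L[ℝ] EllTwo :=
  analysis hL ∘L ContinuousLinearMap.mul ℝ (ℝ →ᵇ ℝ) (nemytskii (deriv G) hG (synth hL w)) ∘L
    synth hL

theorem inner_fixMap (hL : 0 < L) {G : ℝ → ℝ} (hG : Continuous G) (w h : EllTwo) :
    inner ℝ (fixMap hL G hG w) h = integralFunctional L (nemytskii G hG (synth hL w) * synth hL h) :=
  inner_analysis hL _ h

theorem inner_fixDeriv (hL : 0 < L) {G : ℝ → ℝ} (hG : Continuous (deriv G)) (w v h : EllTwo) :
    inner ℝ (fixDeriv hL G hG w v) h =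
      integralFunctional L (nemytskii (deriv G) hG (synth hL w) * synth hL v * synth hL h) :=
  inner_analysis hL _ h

theorem hasStrictFDerivAt_fixMap (hL : 0 < L) {G : ℝ → ℝ} (hG : ContDiff ℝ 1 G) (w : EllTwo) :
    HasStrictFDerivAt (fixMap hL G hG.continuous)
      (fixDeriv hL G (hG.continuous_deriv le_rfl) w) w :=
  (analysis hL).hasStrictFDerivAt.comp w
    ((hasStrictFDerivAt_nemytskii hG _).comp w (synth hL).hasStrictFDerivAt)

theorem continuous_fixDeriv (hL : 0 < L) {G : ℝ → ℝ} (hG : Continuous (deriv G)) :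
    Continuous (fixDeriv hL G hG) := by
  have h1 := (ContinuousLinearMap.mul ℝ (ℝ →ᵇ ℝ)).continuous.comp
    ((continuous_nemytskii hG).comp (synth hL).continuous)
  exact continuous_const.clm_comp (h1.clm_comp continuous_const)

theorem isCompactOperator_fixDeriv (hL : 0 < L) {G : ℝ → ℝ} (hG : Continuous (deriv G))
    (w : EllTwo) : IsCompactOperator (fixDeriv hL G hG w) :=
  (isCompactOperator_analysis hL).comp_clm _

theorem fixDeriv_isSymmetric (hL : 0 < L) {G : ℝ → ℝ} (hG : Continuous (deriv G))
    (w : EllTwo) : (fixDeriv hL G hG w).IsSymmetric := by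
  intro v h
  change inner ℝ (fixDeriv hL G hG w v) h = inner ℝ v (fixDeriv hL G hG w h)
  rw [real_inner_comm, real_inner_comm, inner_fixDeriv, real_inner_comm, inner_fixDeriv,
    mul_right_comm]

/-- The constant is the sup norm of `G'(u)`. Control by the `L²` norm alone is what the index
argument needs in order to shift `1 - K` to a coercive operator. -/
theorem exists_inner_fixDeriv_le (hL : 0 < L) {G : ℝ → ℝ} (hG : Continuous (deriv G))
    (w : EllTwo) :
    ∃ M : ℝ, ∀ v, inner ℝ (fixDeriv hL G hG w v) v ≤ M * ‖embed hL v‖ ^ 2 := by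
  refine ⟨‖nemytskii (deriv G) hG (synth hL w)‖, fun v => ?_⟩
  rw [inner_fixDeriv, ← real_inner_self_eq_norm_sq, ← integral_synth_mul_synth,
    integralFunctional_apply, integralFunctional_apply, ← intervalIntegral.integral_const_mul]
  refine intervalIntegral.integral_mono_on hL.le
    ((nemytskii (deriv G) hG (synth hL w) * synth hL v * synth hL v).continuous.intervalIntegrable
      _ _)
    ((continuous_const.mul (synth hL v * synth hL v).continuous).intervalIntegrable _ _)
    fun x _ => ?_
  simp only [BoundedContinuousFunction.mul_apply]
  have h1 := (le_abs_self _).trans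
    ((nemytskii (deriv G) hG (synth hL w)).norm_coe_le_norm x)
  nlinarith [mul_self_nonneg (synth hL v x)]

theorem exists_isCompact_fixMap_mem (hL : 0 < L) {G : ℝ → ℝ} (hG : Continuous G) (R : ℝ) :
    ∃ C : Set EllTwo, IsCompact C ∧ ∀ w, ‖w‖ ≤ R → fixMap hL G hG w ∈ C := by
  obtain ⟨B, hB⟩ := exists_forall_norm_nemytskii_le hG (‖synth hL‖ * R)
  obtain ⟨C, hC, hC'⟩ := (isCompactOperator_analysis hL).image_closedBall_subset_compact
    (f := (analysis hL : (ℝ →ᵇ ℝ) →ₗ[ℝ] EllTwo)) B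
  refine ⟨C, hC, fun w hw => hC' ⟨_, ?_, rfl⟩⟩
  rw [mem_closedBall_zero_iff]
  exact hB _ (((synth hL).le_opNorm w).trans (by gcongr))

end Neumann

/-! ### First and second variation of the energy in Fourier variables -/

theorem hasDerivAt_integral_comp_add_mul {g : ℝ → ℝ} (hg : ContDiff ℝ 1 g) {u v m : ℝ → ℝ}
    (hu : Continuous u) (hv : Continuous v) (hm : Continuous m) (L : ℝ) :
    HasDerivAt (fun t : ℝ => ∫ x in (0 : ℝ)..L, g (u x + t * v x) * m x)
      (∫ x in (0 : ℝ)..L, deriv g (u x) * v x * m x) 0 := by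
  have hg' := hg.continuous_deriv le_rfl
  have hgc := hg.continuous
  have hF' : Continuous fun p : ℝ × ℝ => deriv g (u p.2 + p.1 * v p.2) * v p.2 * m p.2 := by
    fun_prop
  obtain ⟨C, hC⟩ := ((isCompact_closedBall (0 : ℝ) 1).prod
    (isCompact_uIcc (a := (0 : ℝ)) (b := L))).exists_bound_of_continuousOn hF'.continuousOn
  have := (intervalIntegral.hasDerivAt_integral_of_dominated_loc_of_deriv_le
    (μ := MeasureTheory.volume) (a := 0) (b := L) (x₀ := (0 : ℝ)) (s := Metric.ball 0 1)
    (F := fun t x => g (u x + t * v x) * m x)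
    (F' := fun t x => deriv g (u x + t * v x) * v x * m x) (bound := fun _ => C)
    (Metric.ball_mem_nhds _ one_pos)
    (Filter.Eventually.of_forall fun t => Continuous.aestronglyMeasurable (by fun_prop))
    (Continuous.intervalIntegrable (by fun_prop) _ _)
    (Continuous.aestronglyMeasurable (by fun_prop))
    (Filter.Eventually.of_forall fun x hx t ht => hC (t, x)
      ⟨Metric.ball_subset_closedBall ht, Set.uIoc_subset_uIcc hx⟩)
    (continuous_const.intervalIntegrable _ _)
    (Filter.Eventually.of_forall fun x _ t _ => by
      have h1 := ((hg.differentiable one_ne_zero) (u x + t * v x)).hasDerivAt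
      have h2 : HasDerivAt (fun t => u x + t * v x) (v x) t := by
        simpa using ((hasDerivAt_id t).mul_const (v x)).const_add (u x)
      exact (h1.comp t h2).mul_const (m x))).2
  simpa using this

section Energy

variable {bc : BoundaryCondition}

/-- Termwise `t ≤ c⁻¹ + c t²` with `c = 1 + k²`. This makes the Fourier series converge uniformly,
so functions in `H¹` are continuous. -/
theorem summable_norm_of_mem_sobolevSpace {z : ℤ → ℂ} (hz : z ∈ sobolevSpace bc) :
    Summable fun k => ‖z k‖ := by
  have h1 : Summable fun k : ℤ => ((1 : ℝ) + (k : ℝ) ^ 2)⁻¹ := by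
    have h2 : Summable fun k : ℤ => (2 : ℝ) * (1 / (k : ℝ) ^ 2) :=
      (Real.summable_one_div_int_pow.2 one_lt_two).mul_left 2
    have h3 : Summable fun k : ℤ => (if k = 0 then (1 : ℝ) else 0) :=
      (hasSum_ite_eq (0 : ℤ) (1 : ℝ)).summable
    refine Summable.of_nonneg_of_le (fun k => by positivity) (fun k => ?_) (h2.add h3)
    rcases eq_or_ne k 0 with rfl | hk
    · simp
    · have : (0 : ℝ) < (k : ℝ) ^ 2 := by
        have : (k : ℝ) ≠ 0 := Int.cast_ne_zero.2 hk
        positivity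
      rw [if_neg hk, add_zero, ← one_div]
      rw [mul_one_div, div_le_div_iff₀ (by positivity) this]
      nlinarith
  refine Summable.of_nonneg_of_le (fun k => norm_nonneg _) (fun k => ?_) (h1.add hz.2.2)
  have h4 : (0 : ℝ) < 1 + (k : ℝ) ^ 2 := by positivity
  set c := (1 : ℝ) + (k : ℝ) ^ 2
  have h5 : c⁻¹ + c * ‖z k‖ ^ 2 - ‖z k‖ = c⁻¹ * ((c * ‖z k‖ - 1 / 2) ^ 2 + 3 / 4) := by
    field_simp
    ring
  have h6 : 0 ≤ c⁻¹ * ((c * ‖z k‖ - 1 / 2) ^ 2 + 3 / 4) := by positivity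
  linarith

/-- The terms of the Fourier series. -/
def fourierTerm (bc : BoundaryCondition) (L : ℝ) (z : ℤ → ℂ) (x : ℝ) (k : ℤ) : ℂ :=
  z k * (Complex.exp (Complex.I * (bc.factor * k * Real.pi * x / L : ℝ)) / (Real.sqrt L : ℝ))

theorem fourierSum_eq (L : ℝ) (z : ℤ → ℂ) (x : ℝ) :
    fourierSum bc L z x = (∑' k, fourierTerm bc L z x k).re := rfl

theorem norm_fourierTerm_le (L : ℝ) (z : ℤ → ℂ) (x : ℝ) (k : ℤ) :
    ‖fourierTerm bc L z x k‖ ≤ ‖z k‖ * (Real.sqrt L)⁻¹ := by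
  rw [fourierTerm, norm_mul, norm_div, mul_comm Complex.I, Complex.norm_exp_ofReal_mul_I,
    Complex.norm_real, Real.norm_eq_abs, abs_of_nonneg (Real.sqrt_nonneg L), one_div]

theorem summable_fourierTerm (L : ℝ) {z : ℤ → ℂ} (hz : z ∈ sobolevSpace bc) (x : ℝ) :
    Summable (fourierTerm bc L z x) :=
  Summable.of_norm_bounded ((summable_norm_of_mem_sobolevSpace hz).mul_right _)
    (norm_fourierTerm_le L z x)

theorem continuous_fourierSum (L : ℝ) {z : ℤ → ℂ} (hz : z ∈ sobolevSpace bc) :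
    Continuous (fourierSum bc L z) := by
  refine Complex.continuous_re.comp ?_
  refine continuous_tsum (fun k => ?_) ((summable_norm_of_mem_sobolevSpace hz).mul_right _)
    fun k x => norm_fourierTerm_le L z x k
  fun_prop

theorem fourierSum_add_smul (L : ℝ) {z h : ℤ → ℂ} (hz : z ∈ sobolevSpace bc)
    (hh : h ∈ sobolevSpace bc) (t x : ℝ) :
    fourierSum bc L (z + t • h) x = fourierSum bc L z x + t * fourierSum bc L h x := by
  have h1 : ∀ k, fourierTerm bc L (z + t • h) x k =
      fourierTerm bc L z x k + t • fourierTerm bc L h x k := fun k => by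
    simp [fourierTerm, add_mul, mul_assoc]
  rw [fourierSum_eq, fourierSum_eq, fourierSum_eq, tsum_congr h1,
    (summable_fourierTerm L hz x).tsum_add ((summable_fourierTerm L hh x).const_smul t),
    (summable_fourierTerm L hh x).tsum_const_smul]
  simp

/-- The squared wave numbers. -/
def waveSq (bc : BoundaryCondition) (L : ℝ) (k : ℤ) : ℝ := (bc.factor * Real.pi * k) ^ 2 / L ^ 2

/-- The bilinear form `∫ u' v'` in Fourier variables. -/
def gradForm (bc : BoundaryCondition) (L : ℝ) (z w : ℤ → ℂ) : ℝ :=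
  ∑' k : ℤ, waveSq bc L k * (z k * starRingEnd ℂ (w k)).re

theorem waveSq_nonneg (L : ℝ) (k : ℤ) : 0 ≤ waveSq bc L k := by unfold waveSq; positivity

theorem summable_gradForm (L : ℝ) {z w : ℤ → ℂ} (hz : z ∈ sobolevSpace bc)
    (hw : w ∈ sobolevSpace bc) :
    Summable fun k : ℤ => waveSq bc L k * (z k * starRingEnd ℂ (w k)).re := by
  refine Summable.of_norm_bounded
    ((hz.2.2.add hw.2.2).mul_left ((bc.factor * Real.pi) ^ 2 / L ^ 2)) fun k => ?_
  have h1 : ‖(z k * starRingEnd ℂ (w k)).re‖ ≤ ‖z k‖ ^ 2 + ‖w k‖ ^ 2 := by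
    refine (Complex.abs_re_le_norm _).trans ?_
    rw [norm_mul, Complex.norm_conj]
    nlinarith [sq_nonneg (‖z k‖ - ‖w k‖), norm_nonneg (z k), norm_nonneg (w k)]
  rw [norm_mul, Real.norm_eq_abs, abs_of_nonneg (waveSq_nonneg L k), ← mul_add]
  have h2 : waveSq bc L k ≤ (bc.factor * Real.pi) ^ 2 / L ^ 2 * (1 + (k : ℝ) ^ 2) := by
    unfold waveSq
    rw [mul_pow _ (k : ℝ), mul_div_right_comm]
    gcongr
    linarith
  calc _ ≤ (bc.factor * Real.pi) ^ 2 / L ^ 2 * (1 + (k : ℝ) ^ 2) * (‖z k‖ ^ 2 + ‖w k‖ ^ 2) :=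
        mul_le_mul h2 h1 (norm_nonneg _) (by positivity)
    _ = _ := by ring

theorem gradForm_comm (L : ℝ) (z w : ℤ → ℂ) : gradForm bc L z w = gradForm bc L w z := by
  refine tsum_congr fun k => ?_
  congr 1
  simp only [Complex.mul_re, Complex.conj_re, Complex.conj_im]
  ring

theorem gradForm_add_smul_left (L : ℝ) {z w h : ℤ → ℂ} (hz : z ∈ sobolevSpace bc)
    (hw : w ∈ sobolevSpace bc) (hh : h ∈ sobolevSpace bc) (t : ℝ) :
    gradForm bc L (z + t • h) w = gradForm bc L z w + t * gradForm bc L h w := by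
  unfold gradForm
  rw [← tsum_mul_left, ← (summable_gradForm L hz hw).tsum_add
    ((summable_gradForm L hh hw).mul_left t)]
  refine tsum_congr fun k => ?_
  simp
  ring

theorem potentialEnergy_eq (U : ℝ → ℝ) (L : ℝ) (z : ℤ → ℂ) :
    potentialEnergy U L bc z =
      1 / 2 * gradForm bc L z z + ∫ x in (0 : ℝ)..L, U (fourierSum bc L z x) := by
  unfold potentialEnergy gradForm
  congr 2
  refine tsum_congr fun k => ?_
  rw [Complex.mul_conj, Complex.ofReal_re, Complex.normSq_eq_norm_sq, waveSq]

variable {W : Submodule ℝ (ℤ → ℂ)}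

/-- Along `z + t h` the gradient part is a quadratic polynomial in `t`, and the rest is
differentiated under the integral. Working on any `W ≤ sobolevSpace bc` covers the full and the
truncated potential together. -/
theorem hasLineDerivAt_potentialEnergy {U : ℝ → ℝ} (hU : ContDiff ℝ 1 U) (L : ℝ)
    (hW : W ≤ sobolevSpace bc) (z h : W) :
    HasLineDerivAt ℝ (fun y : W => potentialEnergy U L bc y)
      (gradForm bc L z h + ∫ x in (0 : ℝ)..L, deriv U (fourierSum bc L z x) *
        fourierSum bc L h x) z h := by
  have hz := hW z.2
  have hh := hW h.2
  unfold HasLineDerivAt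
  have h1 : ∀ t : ℝ, potentialEnergy U L bc ((z + t • h : W) : ℤ → ℂ) =
      1 / 2 * (gradForm bc L z z + 2 * t * gradForm bc L z h + t ^ 2 * gradForm bc L h h) +
      ∫ x in (0 : ℝ)..L, U (fourierSum bc L z x + t * fourierSum bc L h x) * 1 := by
    intro t
    have hzt : ((z + t • h : W) : ℤ → ℂ) = (z : ℤ → ℂ) + t • (h : ℤ → ℂ) := rfl
    have hmem : (z : ℤ → ℂ) + t • (h : ℤ → ℂ) ∈ sobolevSpace bc :=
      Submodule.add_mem _ hz (Submodule.smul_mem _ t hh)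
    rw [hzt, potentialEnergy_eq, gradForm_add_smul_left L hz hmem hh, gradForm_comm,
      gradForm_add_smul_left L hz hz hh, gradForm_comm L (h : ℤ → ℂ) ((z : ℤ → ℂ) + t • (h : ℤ → ℂ)),
      gradForm_add_smul_left L hz hh hh, gradForm_comm L (h : ℤ → ℂ) z]
    simp only [fourierSum_add_smul L hz hh, mul_one]
    ring
  simp only [h1]
  have h2 := hasDerivAt_integral_comp_add_mul hU (continuous_fourierSum L hz)
    (continuous_fourierSum L hh) (continuous_const (y := (1 : ℝ))) L
  have h3 : HasDerivAt (fun t : ℝ => 1 / 2 * (gradForm bc L z z + 2 * t * gradForm bc L z h +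
      t ^ 2 * gradForm bc L h h)) (gradForm bc L z h) 0 := by
    have h4 := ((((hasDerivAt_id (0 : ℝ)).const_mul 2).mul_const (gradForm bc L z h)).const_add
      (gradForm bc L z z)).add ((hasDerivAt_pow 2 (0 : ℝ)).mul_const (gradForm bc L h h))
    have h5 := h4.const_mul (1 / 2)
    simpa using h5
  simp only [mul_one] at h2 ⊢
  exact h3.add h2

theorem isCriticalPoint_potentialEnergy_iff {U : ℝ → ℝ} (hU : ContDiff ℝ 1 U) (L : ℝ)
    (hW : W ≤ sobolevSpace bc) (z : W) :
    IsCriticalPoint (fun y : W => potentialEnergy U L bc y) z ↔ ∀ h : W,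
      gradForm bc L z h + ∫ x in (0 : ℝ)..L, deriv U (fourierSum bc L z x) *
        fourierSum bc L h x = 0 := by
  refine forall_congr' fun h => ?_
  have h1 := hasLineDerivAt_potentialEnergy hU L hW z h
  exact ⟨fun h2 => h1.unique h2, fun h2 => h2 ▸ h1⟩

theorem hessianForm_potentialEnergy {U : ℝ → ℝ} (hU : ContDiff ℝ 2 U) (L : ℝ)
    (hW : W ≤ sobolevSpace bc) (z v h : W) :
    hessianForm (fun y : W => potentialEnergy U L bc y) z v h =
      gradForm bc L v h + ∫ x in (0 : ℝ)..L, deriv (deriv U) (fourierSum bc L z x) *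
        fourierSum bc L v x * fourierSum bc L h x := by
  have hz := hW z.2
  have hh := hW h.2
  have hv := hW v.2
  have hU1 : ContDiff ℝ 1 U := hU.of_le one_le_two
  have hU' : ContDiff ℝ 1 (deriv U) := by
    have : ContDiff ℝ (1 + 1) U := by simpa [one_add_one_eq_two] using hU
    exact ((contDiff_succ_iff_deriv).1 this).2.2
  have h1 : (fun y : W => lineDeriv ℝ (fun y : W => potentialEnergy U L bc y) y v) =
      fun y : W => gradForm bc L y v + ∫ x in (0 : ℝ)..L, deriv U (fourierSum bc L y x) *
        fourierSum bc L v x :=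
    funext fun y => (hasLineDerivAt_potentialEnergy hU1 L hW y v).lineDeriv
  unfold hessianForm
  rw [h1]
  refine HasLineDerivAt.lineDeriv ?_
  unfold HasLineDerivAt
  have h2 : ∀ t : ℝ, gradForm bc L ((z + t • h : W) : ℤ → ℂ) v +
      ∫ x in (0 : ℝ)..L, deriv U (fourierSum bc L ((z + t • h : W) : ℤ → ℂ) x) *
        fourierSum bc L v x = gradForm bc L z v + t * gradForm bc L h v +
      ∫ x in (0 : ℝ)..L, deriv U (fourierSum bc L z x + t * fourierSum bc L h x) *
        fourierSum bc L v x := by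
    intro t
    have hzt : ((z + t • h : W) : ℤ → ℂ) = (z : ℤ → ℂ) + t • (h : ℤ → ℂ) := rfl
    rw [hzt, gradForm_add_smul_left L hz hv hh]
    simp only [fourierSum_add_smul L hz hh]
  simp only [h2]
  have h3 := hasDerivAt_integral_comp_add_mul hU' (continuous_fourierSum L hz)
    (continuous_fourierSum L hh) (continuous_fourierSum L hv) L
  have h4 : HasDerivAt (fun t : ℝ => gradForm bc L z v + t * gradForm bc L h v)
      (gradForm bc L v h) 0 := by
    rw [gradForm_comm L (v : ℤ → ℂ)]
    simpa using ((hasDerivAt_id (0 : ℝ)).mul_const (gradForm bc L h v)).const_add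
      (gradForm bc L z v)
  have h5 := h4.add h3
  simp only [mul_right_comm _ (fourierSum bc L h _)] at h5
  exact h5

end Energy

/-! ### Passage between Fourier coefficients and orthonormal coordinates -/

namespace Neumann

open Real BoundedContinuousFunction

/-- Splitting `ℤ` into `k ≥ 0` and `k ≤ -1` counts every `n ≠ 0` twice, which is the weight `mult`.
-/
theorem hasSum_natAbs {f : ℕ → ℝ} (hf : Summable f) :
    HasSum (fun k : ℤ => f k.natAbs) (∑' n, mult n * f n) := by
  have h1 : Summable fun n => f (n + 1) := (summable_nat_add_iff 1).2 hf
  have h2 : HasSum (fun n : ℕ => f (((n : ℕ) : ℤ)).natAbs) (∑' n, f n) := by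
    simpa using hf.hasSum
  have h3 : HasSum (fun n : ℕ => f (-((n : ℤ) + 1)).natAbs) (∑' n, f (n + 1)) := by
    have : ∀ n : ℕ, (-((n : ℤ) + 1)).natAbs = n + 1 := fun n => by omega
    simpa only [this] using h1.hasSum
  have h4 := HasSum.of_nat_of_neg_add_one (f := fun k : ℤ => f k.natAbs) h2 h3
  have h5 : Summable fun n => mult n * f n := by
    rw [← summable_nat_add_iff 1]
    simpa [mult] using h1.mul_left 2
  have h6 : ∑' n, mult n * f n = ∑' n, f n + ∑' n, f (n + 1) := by
    rw [h5.tsum_eq_zero_add, hf.tsum_eq_zero_add]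
    simp [mult, tsum_mul_left]
    ring
  rwa [h6]

variable {L : ℝ}

/-- The Fourier coefficients with orthonormal `H¹` coordinates `w`. -/
def toCoeff (L : ℝ) (w : EllTwo) (k : ℤ) : ℂ := ((coef L k.natAbs * w k.natAbs : ℝ) : ℂ)

theorem waveSq_neumann (L : ℝ) (k : ℤ) : waveSq .neumann L k = lam L k.natAbs := by
  unfold waveSq lam BoundaryCondition.factor
  rw [mul_pow, mul_pow, mul_pow, Nat.cast_natAbs, Int.cast_abs, sq_abs]
  ring

theorem re_toCoeff_mul_conj (v w : EllTwo) (k : ℤ) :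
    (toCoeff L v k * starRingEnd ℂ (toCoeff L w k)).re =
      coef L k.natAbs ^ 2 * (v k.natAbs * w k.natAbs) := by
  rw [toCoeff, toCoeff, Complex.conj_ofReal, ← Complex.ofReal_mul, Complex.ofReal_re]
  ring

theorem summable_mul_apply_mul (v w : EllTwo) {b : ℕ → ℝ} {C : ℝ} (hb : ∀ n, |b n| ≤ C) :
    Summable fun n => b n * (v n * w n) := by
  have h1 := (EllTwo.summable_abs_mul v (EllTwo.summable_sq w)).mul_left C
  refine Summable.of_norm_bounded h1 fun n => ?_
  rw [norm_mul, Real.norm_eq_abs, Real.norm_eq_abs]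
  gcongr
  exact hb n

theorem coef_sq_le (n : ℕ) : |coef L n ^ 2| ≤ 1 := by
  have h1 : 1 ≤ mult n := by unfold mult; split_ifs <;> norm_num
  have h2 := lam_nonneg L n
  rw [abs_of_nonneg (sq_nonneg _), coef_sq]
  exact inv_le_one_of_one_le₀ (by nlinarith)

theorem ellTwoInner_toCoeff (hL : 0 < L) (v w : EllTwo) :
    ellTwoInner (toCoeff L v) (toCoeff L w) = inner ℝ (embed hL v) (embed hL w) := by
  unfold ellTwoInner
  simp only [re_toCoeff_mul_conj]
  rw [(hasSum_natAbs (summable_mul_apply_mul v w coef_sq_le)).tsum_eq, inner_embed]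
  refine tsum_congr fun n => ?_
  rw [← mult_mul_coef_sq]
  ring

/-- The `H¹` inner product minus its `L²` part; on each mode, `lam / (1 + lam) = 1 - 1 / (1 + lam)`.
-/
theorem gradForm_toCoeff (hL : 0 < L) (v w : EllTwo) :
    gradForm .neumann L (toCoeff L v) (toCoeff L w) =
      inner ℝ v w - inner ℝ (embed hL v) (embed hL w) := by
  unfold gradForm
  simp only [re_toCoeff_mul_conj, waveSq_neumann, ← mul_assoc]
  have hb : ∀ n, |lam L n * coef L n ^ 2| ≤ 1 := by
    intro n
    have h1 : 1 ≤ mult n := by unfold mult; split_ifs <;> norm_num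
    have h2 := lam_nonneg L n
    rw [abs_of_nonneg (by positivity), coef_sq, ← div_eq_mul_inv]
    exact div_le_one_of_le₀ (by nlinarith) (by nlinarith)
  have h1 := hasSum_natAbs (summable_mul_apply_mul v w hb)
  simp only [← mul_assoc] at h1
  rw [h1.tsum_eq, inner_embed, EllTwo.inner_eq, ← Summable.tsum_sub]
  · refine tsum_congr fun n => ?_
    have h2 := mult_mul_coef_sq L n
    have h3 := mul_inv_cancel₀ (one_add_lam_pos L n).ne'
    rw [← h2] at h3
    rw [← h2]
    linear_combination (v n * w n) * h3
  · simpa using summable_mul_apply_mul v w (b := fun _ => 1) (C := 1) (by simp)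
  · refine summable_mul_apply_mul v w (C := 1) fun n => ?_
    have := one_add_lam_pos L n
    rw [abs_of_nonneg (by positivity)]
    exact inv_le_one_of_one_le₀ (by linarith [lam_nonneg L n])

theorem fourierSum_toCoeff (hL : 0 < L) (w : EllTwo) (hw : toCoeff L w ∈ sobolevSpace .neumann)
    (x : ℝ) : fourierSum .neumann L (toCoeff L w) x = synth hL w x := by
  have h1 : ∀ k : ℤ, (fourierTerm .neumann L (toCoeff L w) x k).re =
      coef L k.natAbs * w k.natAbs * cos (k.natAbs * π * x / L) / √L := by
    intro k
    have hcos : cos ((BoundaryCondition.neumann.factor * k * π * x / L : ℝ)) =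
        cos (k.natAbs * π * x / L) := by
      obtain ⟨n, rfl | rfl⟩ := k.eq_nat_or_neg
      · simp [BoundaryCondition.factor]
      · rw [← cos_neg]
        congr 1
        simp [BoundaryCondition.factor]
        ring
    rw [fourierTerm, toCoeff, Complex.re_ofReal_mul, Complex.div_ofReal_re, mul_comm Complex.I,
      Complex.exp_ofReal_mul_I_re, hcos, mul_div_assoc']
  have h2 := (BoundedContinuousFunction.evalCLM ℝ x).hasSum (hasSum_synth hL w)
  have h3 : Summable fun n : ℕ => coef L n * w n * cos (n * π * x / L) / √L := by
    have h4 := (EllTwo.summable_abs_mul w (summable_amp_sq hL))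
    refine Summable.of_norm_bounded h4 fun n => ?_
    have h5 := abs_cos_le_one (n * π * x / L)
    have h6 : 1 ≤ mult n := by unfold mult; split_ifs <;> norm_num
    have h7 := coef_pos L n
    rw [amp, norm_div, norm_mul, norm_mul, abs_mul, abs_div, abs_mul, Real.norm_eq_abs,
      Real.norm_eq_abs, Real.norm_eq_abs, Real.norm_eq_abs, mul_div_assoc', abs_of_pos h7,
      abs_of_pos (mult_pos n)]
    refine div_le_div_of_nonneg_right ?_ (abs_nonneg _)
    calc coef L n * |w n| * |cos (n * π * x / L)| ≤ coef L n * |w n| * mult n :=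
          mul_le_mul_of_nonneg_left (h5.trans h6) (by positivity)
      _ = |w n| * (mult n * coef L n) := by ring
  rw [fourierSum_eq, Complex.re_tsum (summable_fourierTerm L hw x), tsum_congr h1,
    (hasSum_natAbs h3).tsum_eq]
  have h8 : synth hL w x = ∑' n, w n * (amp L n * cos (n * π * x / L)) := by
    refine (HasSum.tsum_eq ?_).symm
    simpa [mode_apply] using h2
  rw [h8]
  refine tsum_congr fun n => ?_
  rw [amp]
  ring

end Neumann

theorem truncatedSpace_le (bc : BoundaryCondition) (d : ℕ) :
    truncatedSpace bc d ≤ sobolevSpace bc := fun _ hz => hz.1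

namespace Neumann

open Real BoundedContinuousFunction

variable {L : ℝ}

theorem toCoeff_mem (hL : 0 < L) (w : EllTwo) : toCoeff L w ∈ sobolevSpace .neumann := by
  refine ⟨fun k => ?_, fun _ k => ?_, ?_⟩
  · rw [toCoeff, toCoeff, Int.natAbs_neg, Complex.conj_ofReal]
  · rw [toCoeff, toCoeff, Int.natAbs_neg]
  · have hb : ∀ n : ℕ, |(1 + (n : ℝ) ^ 2) * coef L n ^ 2| ≤ 1 + L ^ 2 / π ^ 2 := by
      intro n
      have h1 : 1 ≤ mult n := by unfold mult; split_ifs <;> norm_num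
      have h2 := lam_nonneg L n
      rw [abs_of_nonneg (by positivity), coef_sq, ← div_eq_mul_inv, div_le_iff₀ (by positivity)]
      have h3 : (n : ℝ) ^ 2 = L ^ 2 / π ^ 2 * lam L n := by
        unfold lam; field_simp
      have h4 : 0 ≤ L ^ 2 / π ^ 2 := by positivity
      calc 1 + (n : ℝ) ^ 2 = 1 + L ^ 2 / π ^ 2 * lam L n := by rw [h3]
        _ ≤ (1 + L ^ 2 / π ^ 2) * (1 * (1 + lam L n)) := by nlinarith
        _ ≤ _ := by gcongr
    have h1 := (hasSum_natAbs (summable_mul_apply_mul w w hb)).summable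
    refine h1.congr fun k => ?_
    rw [toCoeff, Complex.norm_real, Real.norm_eq_abs, sq_abs, Nat.cast_natAbs, Int.cast_abs, sq_abs]
    ring

theorem memℓp_coordinates {z : ℤ → ℂ} (hz : z ∈ sobolevSpace .neumann) :
    Memℓp (fun n : ℕ => (z n).re / coef L n) 2 := by
  refine EllTwo.memℓp_of_summable_sq ?_
  have h1 := hz.2.2.comp_injective Nat.cast_injective
  refine Summable.of_nonneg_of_le (fun n => sq_nonneg _) (fun n => ?_)
    (h1.mul_left (2 * (1 + π ^ 2 / L ^ 2)))
  have h2 := mult_le_two n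
  have h3 := mult_pos n
  have h4 : |(z n).re| ≤ ‖z n‖ := Complex.abs_re_le_norm _
  have h5 : (z n).re ^ 2 ≤ ‖z n‖ ^ 2 := by
    rw [← sq_abs]; exact pow_le_pow_left₀ (abs_nonneg _) h4 2
  have h6 : lam L n = π ^ 2 / L ^ 2 * (n : ℝ) ^ 2 := by unfold lam; ring
  have h7 : mult n * (1 + lam L n) ≤ 2 * (1 + π ^ 2 / L ^ 2) * (1 + (n : ℝ) ^ 2) := by
    have h8 : 0 ≤ π ^ 2 / L ^ 2 := by positivity
    calc mult n * (1 + lam L n) ≤ 2 * (1 + lam L n) := by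
          have := lam_nonneg L n
          gcongr
      _ ≤ _ := by rw [h6]; nlinarith [sq_nonneg (n : ℝ)]
  rw [div_pow, coef_sq, div_inv_eq_mul, mul_comm]
  calc mult n * (1 + lam L n) * (z n).re ^ 2
      ≤ 2 * (1 + π ^ 2 / L ^ 2) * (1 + (n : ℝ) ^ 2) * ‖z n‖ ^ 2 := by gcongr
    _ = _ := by simp [mul_assoc]

theorem im_eq_zero_of_mem {z : ℤ → ℂ} (hz : z ∈ sobolevSpace .neumann) (k : ℤ) :
    (z k).im = 0 := by
  rw [← Complex.conj_eq_iff_im, ← hz.1, hz.2.1 rfl]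

/-- Orthonormal coordinates of the Sobolev space with Neumann boundary conditions. -/
def sobolevEquiv (hL : 0 < L) : EllTwo ≃ₗ[ℝ] sobolevSpace .neumann where
  toFun w := ⟨toCoeff L w, toCoeff_mem hL w⟩
  map_add' v w := by
    refine Subtype.ext (funext fun k => ?_)
    simp [toCoeff, mul_add]
  map_smul' c w := by
    refine Subtype.ext (funext fun k => ?_)
    simp [toCoeff, mul_left_comm]
  invFun z := ⟨fun n => ((z : ℤ → ℂ) n).re / coef L n, memℓp_coordinates z.2⟩
  left_inv w := by
    refine lp.ext (funext fun n => ?_)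
    change (toCoeff L w n).re / coef L n = w n
    rw [toCoeff, Complex.ofReal_re, Int.natAbs_natCast, mul_div_cancel_left₀ _ (coef_pos L n).ne']
  right_inv z := by
    refine Subtype.ext (funext fun k => ?_)
    change ((coef L k.natAbs * (((z : ℤ → ℂ) k.natAbs).re / coef L k.natAbs) : ℝ) : ℂ) = _
    rw [mul_div_cancel₀ _ (coef_pos L _).ne']
    have h1 : (z : ℤ → ℂ) k.natAbs = (z : ℤ → ℂ) k := by
      rcases Int.natAbs_eq k with h | h
      · rw [← h]
      · nth_rewrite 2 [h]
        rw [z.2.2.1 rfl]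
    rw [h1]
    apply Complex.ext
    · simp
    · simp [im_eq_zero_of_mem z.2 k]

theorem sobolevEquiv_apply (hL : 0 < L) (w : EllTwo) :
    (sobolevEquiv hL w : ℤ → ℂ) = toCoeff L w := rfl

/-- Orthonormal coordinates of the truncated space with Neumann boundary conditions. -/
def truncatedEquiv (hL : 0 < L) (d : ℕ) : EllTwo.firstModes d ≃ₗ[ℝ] truncatedSpace .neumann d where
  toFun w := ⟨toCoeff L w, toCoeff_mem hL w, fun k hk => by
    have : (w : EllTwo) k.natAbs = 0 := w.2 _ (by have := Int.natCast_natAbs k; omega)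
    simp [toCoeff, this]⟩
  map_add' v w := by
    refine Subtype.ext (funext fun k => ?_)
    simp [toCoeff, mul_add]
  map_smul' c w := by
    refine Subtype.ext (funext fun k => ?_)
    simp [toCoeff, mul_left_comm]
  invFun z := ⟨(sobolevEquiv hL).symm ⟨z, z.2.1⟩, fun n hn => by
    change ((z : ℤ → ℂ) n).re / coef L n = 0
    rw [z.2.2 n (by simpa using hn)]
    simp⟩
  left_inv w := Subtype.ext ((sobolevEquiv hL).symm_apply_apply w)
  right_inv z := by
    have h : (sobolevEquiv hL ((sobolevEquiv hL).symm ⟨z, z.2.1⟩) : ℤ → ℂ) = z := by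
      rw [LinearEquiv.apply_symm_apply]
    exact Subtype.ext h

theorem truncatedEquiv_apply (hL : 0 < L) (d : ℕ) (w : EllTwo.firstModes d) :
    (truncatedEquiv hL d w : ℤ → ℂ) = toCoeff L w := rfl

section Transfer

variable {U : ℝ → ℝ} (hU : ContDiff ℝ 2 U) (hL : 0 < L)
include hU

theorem contDiff_deriv : ContDiff ℝ 1 (deriv U) := by
  have : ContDiff ℝ (1 + 1) U := by simpa [one_add_one_eq_two] using hU
  exact ((contDiff_succ_iff_deriv).1 this).2.2

theorem contDiff_sub_deriv : ContDiff ℝ 1 fun u => u - deriv U u :=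
  contDiff_id.sub (contDiff_deriv hU)

theorem deriv_sub_deriv : deriv (fun u => u - deriv U u) = fun u => 1 - deriv (deriv U) u := by
  funext u
  exact ((hasDerivAt_id u).sub
    (((contDiff_deriv hU).differentiable one_ne_zero) u).hasDerivAt).deriv

/-- The summand `u` of `G u = u - U' u` cancels the `L²` part of the `H¹` inner product and leaves
the first variation of the energy. -/
theorem inner_sub_fixMap (w h : EllTwo) :
    inner ℝ (w - fixMap hL (fun u => u - deriv U u) (contDiff_sub_deriv hU).continuous w) h =
      gradForm .neumann L (toCoeff L w) (toCoeff L h) + ∫ x in (0 : ℝ)..L,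
        deriv U (fourierSum .neumann L (toCoeff L w) x) *
          fourierSum .neumann L (toCoeff L h) x := by
  have hc : Continuous (deriv U) := (contDiff_deriv hU).continuous
  simp only [fourierSum_toCoeff hL _ (toCoeff_mem hL _)]
  rw [inner_sub_left, inner_fixMap, gradForm_toCoeff hL, ← integral_synth_mul_synth,
    integralFunctional_apply, integralFunctional_apply]
  have h1 : ∀ x, (nemytskii (fun u => u - deriv U u) (contDiff_sub_deriv hU).continuous
      (synth hL w) * synth hL h) x = (synth hL w * synth hL h) x -
      deriv U (synth hL w x) * synth hL h x := fun x => by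
    simp [sub_mul]
  simp only [h1]
  rw [intervalIntegral.integral_sub]
  · ring
  · exact (synth hL w * synth hL h).continuous.intervalIntegrable _ _
  · exact ((hc.comp (synth hL w).continuous).mul (synth hL h).continuous).intervalIntegrable _ _

theorem inner_sub_fixDeriv (w v h : EllTwo) :
    inner ℝ (v - fixDeriv hL (fun u => u - deriv U u)
      ((contDiff_sub_deriv hU).continuous_deriv le_rfl) w v) h =
      gradForm .neumann L (toCoeff L v) (toCoeff L h) + ∫ x in (0 : ℝ)..L,
        deriv (deriv U) (fourierSum .neumann L (toCoeff L w) x) *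
          fourierSum .neumann L (toCoeff L v) x * fourierSum .neumann L (toCoeff L h) x := by
  have hc : Continuous (deriv (deriv U)) := (contDiff_deriv hU).continuous_deriv le_rfl
  simp only [fourierSum_toCoeff hL _ (toCoeff_mem hL _)]
  rw [inner_sub_left, inner_fixDeriv, gradForm_toCoeff hL, ← integral_synth_mul_synth,
    integralFunctional_apply, integralFunctional_apply]
  have h1 : ∀ x, (nemytskii (deriv fun u => u - deriv U u)
      ((contDiff_sub_deriv hU).continuous_deriv le_rfl)
      (synth hL w) * synth hL v * synth hL h) x = (synth hL v * synth hL h) x -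
      deriv (deriv U) (synth hL w x) * synth hL v x * synth hL h x := fun x => by
    simp only [BoundedContinuousFunction.mul_apply, nemytskii_apply, deriv_sub_deriv hU]
    ring
  simp only [h1]
  rw [intervalIntegral.integral_sub]
  · ring
  · exact (synth hL v * synth hL h).continuous.intervalIntegrable _ _
  · exact (((hc.comp (synth hL w).continuous).mul (synth hL v).continuous).mul
      (synth hL h).continuous).intervalIntegrable _ _

variable {X : Type} [AddCommGroup X] [Module ℝ X] {W : Submodule ℝ (ℤ → ℂ)}
  (hW : W ≤ sobolevSpace .neumann) (ι : X → EllTwo) (e : X ≃ₗ[ℝ] W)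
  (he : ∀ x, (e x : ℤ → ℂ) = toCoeff L (ι x))
include hW he

/-- The abstract `X`, `ι`, `e` stand for `EllTwo` with the identity in the full case, and for
`EllTwo.firstModes d` with the inclusion in the truncated case. -/
theorem isCriticalPoint_iff_fixMap (x : X) :
    IsCriticalPoint (fun y : W => potentialEnergy U L .neumann y) (e x) ↔ ∀ h : X,
      inner ℝ (ι x - fixMap hL (fun u => u - deriv U u) (contDiff_sub_deriv hU).continuous (ι x))
        (ι h) = 0 := by
  rw [isCriticalPoint_potentialEnergy_iff (hU.of_le one_le_two) L hW, e.surjective.forall]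
  refine forall_congr' fun h => ?_
  rw [inner_sub_fixMap hU hL, he, he]

theorem isHessianEigen_iff_fixDeriv (x v : X) (μ : ℝ) :
    IsHessianEigen (fun y : W => potentialEnergy U L .neumann y) (e x) μ (e v) ↔ ∀ h : X,
      inner ℝ (ι v - fixDeriv hL (fun u => u - deriv U u)
        ((contDiff_sub_deriv hU).continuous_deriv le_rfl) (ι x) (ι v)) (ι h) =
        μ * inner ℝ (embed hL (ι v)) (embed hL (ι h)) := by
  unfold IsHessianEigen
  rw [e.surjective.forall]
  refine forall_congr' fun h => ?_
  rw [hessianForm_potentialEnergy hU L hW, inner_sub_fixDeriv hU hL, he, he, he,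
    ellTwoInner_toCoeff hL]

theorem isNondegenerate_iff_fixDeriv (x : X) :
    IsNondegenerate (fun y : W => potentialEnergy U L .neumann y) (e x) ↔ ∀ v : X, (∀ h : X,
      inner ℝ (ι v - fixDeriv hL (fun u => u - deriv U u)
        ((contDiff_sub_deriv hU).continuous_deriv le_rfl) (ι x) (ι v)) (ι h) = 0) → v = 0 := by
  unfold IsNondegenerate
  rw [e.surjective.forall]
  refine forall_congr' fun v => ?_
  rw [isHessianEigen_iff_fixDeriv hU hL hW ι e he, e.map_eq_zero_iff]
  simp only [zero_mul]

end Transfer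

end Neumann

theorem LinearEquiv.rank_span_eq_of_mem_iff {X Y : Type} [AddCommGroup X] [Module ℝ X]
    [AddCommGroup Y] [Module ℝ Y] (e : X ≃ₗ[ℝ] Y) {A : Set X} {B : Set Y}
    (h : ∀ x, x ∈ A ↔ e x ∈ B) :
    Module.rank ℝ (Submodule.span ℝ B) = Module.rank ℝ (Submodule.span ℝ A) := by
  have hB : B = e '' A := by
    ext y
    constructor
    · intro hy
      exact ⟨e.symm y, (h _).2 (by simpa using hy), e.apply_symm_apply y⟩
    · rintro ⟨x, hx, rfl⟩
      exact (h x).1 hx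
  rw [hB]
  have h2 := (e.submoduleMap (Submodule.span ℝ A)).rank_eq
  rw [h2, Submodule.map_span]
  rfl

/-! ### The Galerkin theorem for the Neumann potential -/

namespace Neumann

open Real BoundedContinuousFunction

variable {L : ℝ} {U : ℝ → ℝ} (hU : ContDiff ℝ 2 U) (hL : 0 < L)

/-- The map whose fixed points are the stationary points of the potential energy. -/
def statMap : EllTwo → EllTwo :=
  fixMap hL (fun u => u - deriv U u) (contDiff_sub_deriv hU).continuous

/-- The derivative of `statMap`. -/
def statDeriv : EllTwo → EllTwo →L[ℝ] EllTwo :=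
  fixDeriv hL (fun u => u - deriv U u) ((contDiff_sub_deriv hU).continuous_deriv le_rfl)

theorem mem_nondegenerateCriticalPoints_full_iff (w : EllTwo) :
    sobolevEquiv hL w ∈ nondegenerateCriticalPoints (fullPotential U L .neumann) ↔
      IsGalerkinSolution (statMap hU hL) ⊤ w ∧ IsGalerkinNondegenerate (statDeriv hU hL w) ⊤ := by
  refine and_congr ?_ ?_
  · refine (isCriticalPoint_iff_fixMap hU hL le_rfl id (sobolevEquiv hL)
      (fun x => sobolevEquiv_apply hL x) w).trans ?_
    simp [IsGalerkinSolution, statMap]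
  · refine (isNondegenerate_iff_fixDeriv hU hL le_rfl id (sobolevEquiv hL)
      (fun x => sobolevEquiv_apply hL x) w).trans ?_
    simp [IsGalerkinNondegenerate, statDeriv]

theorem mem_nondegenerateCriticalPoints_truncated_iff (d : ℕ) (w : EllTwo.firstModes d) :
    truncatedEquiv hL d w ∈ nondegenerateCriticalPoints (truncatedPotential U L .neumann d) ↔
      IsGalerkinSolution (statMap hU hL) (EllTwo.firstModes d) w ∧
        IsGalerkinNondegenerate (statDeriv hU hL w) (EllTwo.firstModes d) := by
  refine and_congr ?_ ?_
  · refine (isCriticalPoint_iff_fixMap hU hL (truncatedSpace_le _ d) Subtype.val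
      (truncatedEquiv hL d) (fun x => truncatedEquiv_apply hL d x) w).trans ?_
    simp [IsGalerkinSolution, statMap]
  · refine (isNondegenerate_iff_fixDeriv hU hL (truncatedSpace_le _ d) Subtype.val
      (truncatedEquiv hL d) (fun x => truncatedEquiv_apply hL d x) w).trans ?_
    simp [IsGalerkinNondegenerate, statDeriv]

theorem negativeEigenvalueCount_full (w : EllTwo) :
    negativeEigenvalueCount (fullPotential U L .neumann) (sobolevEquiv hL w) =
      Cardinal.toENat (Module.rank ℝ (negSpace (statDeriv hU hL w) (embed hL))) := by
  unfold negativeEigenvalueCount negSpace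
  rw [(sobolevEquiv hL).rank_span_eq_of_mem_iff]
  intro v
  refine exists_congr fun μ => and_congr_right fun _ => ?_
  exact (isHessianEigen_iff_fixDeriv hU hL le_rfl id (sobolevEquiv hL)
    (fun x => sobolevEquiv_apply hL x) w v μ).symm

theorem negativeEigenvalueCount_truncated (d : ℕ) (w : EllTwo.firstModes d) :
    negativeEigenvalueCount (truncatedPotential U L .neumann d) (truncatedEquiv hL d w) =
      Cardinal.toENat (Module.rank ℝ (negSpace (compress (statDeriv hU hL w) (EllTwo.firstModes d))
        (embed hL ∘L (EllTwo.firstModes d).subtypeL))) := by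
  unfold negativeEigenvalueCount negSpace
  rw [(truncatedEquiv hL d).rank_span_eq_of_mem_iff]
  intro v
  refine exists_congr fun μ => and_congr_right fun _ => ?_
  refine Iff.trans ?_ (isHessianEigen_iff_fixDeriv hU hL (truncatedSpace_le _ d) Subtype.val
    (truncatedEquiv hL d) (fun x => truncatedEquiv_apply hL d x) w v μ).symm
  refine forall_congr' fun h => ?_
  rw [inner_sub_left, inner_sub_left, inner_compress]
  rfl

/-- Testing the equation with `w` itself gives `‖w‖² = ∫ (u² - U'(u) u)`. The test is admissible for
fixed points and for Galerkin solutions of every `d`, so the bound is uniform. -/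
theorem norm_sq_le_of_inner_eq_zero {C : ℝ} (hC : ∀ s, s ^ 2 - deriv U s * s ≤ C) {w : EllTwo}
    (hw : inner ℝ (w - statMap hU hL w) w = 0) : ‖w‖ ^ 2 ≤ C * L := by
  rw [inner_sub_left, real_inner_self_eq_norm_sq, sub_eq_zero, statMap, inner_fixMap] at hw
  rw [hw, integralFunctional_apply]
  have h1 : C * L = ∫ _ in (0 : ℝ)..L, C := by simp [mul_comm]
  rw [h1]
  refine intervalIntegral.integral_mono_on hL.le
    ((nemytskii _ (contDiff_sub_deriv hU).continuous (synth hL w) *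
      synth hL w).continuous.intervalIntegrable _ _)
    (continuous_const.intervalIntegrable _ _) fun x _ => ?_
  refine le_trans (le_of_eq ?_) (hC (synth hL w x))
  rw [BoundedContinuousFunction.mul_apply, nemytskii_apply]
  ring

/-- The abstract Galerkin theorem read through `sobolevEquiv` and `truncatedEquiv`. Coercivity
provides the compact set containing all images `Φ w`; only the degenerate fixed points remain as a
hypothesis. -/
theorem exists_equiv_of_isolated (hcoer : ∃ C, ∀ s, s ^ 2 - deriv U s * s ≤ C)
    (hdeg : ∀ w, statMap hU hL w = w → ¬ IsGalerkinNondegenerate (statDeriv hU hL w) ⊤ →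
      ∃ r > 0, (∀ x ∈ Metric.closedBall w r, statMap hU hL x = x → x = w) ∧
        ∃ d₀, ∀ d ≥ d₀, ∀ x ∈ Metric.closedBall w r,
          IsGalerkinSolution (statMap hU hL) (EllTwo.firstModes d) x →
          ¬ IsGalerkinNondegenerate (statDeriv hU hL x) (EllTwo.firstModes d)) :
    ∃ d₀ : ℕ, ∀ d : ℕ, d₀ ≤ d →
      (nondegenerateCriticalPoints (fullPotential U L .neumann)).Finite ∧
      (nondegenerateCriticalPoints (truncatedPotential U L .neumann d)).Finite ∧
      ∃ e : nondegenerateCriticalPoints (fullPotential U L .neumann) ≃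
          nondegenerateCriticalPoints (truncatedPotential U L .neumann d),
        ∀ z : nondegenerateCriticalPoints (fullPotential U L .neumann),
          negativeEigenvalueCount (truncatedPotential U L .neumann d) (e z) =
            negativeEigenvalueCount (fullPotential U L .neumann) z := by
  obtain ⟨C, hC⟩ := hcoer
  obtain ⟨S, hS, hSmem⟩ := exists_isCompact_fixMap_mem hL (contDiff_sub_deriv hU).continuous
    (√(C * L))
  have hbdd : ∀ w, inner ℝ (w - statMap hU hL w) w = 0 → statMap hU hL w ∈ S := fun w hw =>
    hSmem w (Real.le_sqrt_of_sq_le (norm_sq_le_of_inner_eq_zero hU hL hC hw))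
  obtain ⟨d₀, hd₀⟩ := exists_galerkin_equiv EllTwo.monotone_firstModes EllTwo.dense_firstModes
    (embed_injective hL) (isCompactOperator_embed hL) (Φ := statMap hU hL) (K := statDeriv hU hL)
    (hasStrictFDerivAt_fixMap hL (contDiff_sub_deriv hU)) (continuous_fixDeriv hL _)
    (isCompactOperator_fixDeriv hL _) (fixDeriv_isSymmetric hL _) (exists_inner_fixDeriv_le hL _)
    hS (fun d w hw => hbdd w (hw.2 w hw.1))
    (fun w hw => hw ▸ hbdd w (by rw [hw, sub_self, inner_zero_left])) hdeg
  refine ⟨d₀, fun d hd => ?_⟩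
  obtain ⟨hfin, e, he⟩ := hd₀ d hd
  let e₁ : {w | IsGalerkinSolution (statMap hU hL) ⊤ w ∧
      IsGalerkinNondegenerate (statDeriv hU hL w) ⊤} ≃
      nondegenerateCriticalPoints (fullPotential U L .neumann) :=
    (sobolevEquiv hL).toEquiv.subtypeEquiv fun w =>
      (mem_nondegenerateCriticalPoints_full_iff hU hL w).symm
  let e₂ : {w | IsGalerkinSolution (statMap hU hL) (EllTwo.firstModes d) w ∧
      IsGalerkinNondegenerate (statDeriv hU hL w) (EllTwo.firstModes d)} ≃
      nondegenerateCriticalPoints (truncatedPotential U L .neumann d) :=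
    { toFun := fun w => ⟨truncatedEquiv hL d ⟨w, w.2.1.1⟩,
        (mem_nondegenerateCriticalPoints_truncated_iff hU hL d _).2 w.2⟩
      invFun := fun z => ⟨(truncatedEquiv hL d).symm z,
        (mem_nondegenerateCriticalPoints_truncated_iff hU hL d _).1 (by simp)⟩
      left_inv := fun w => by simp
      right_inv := fun z => by simp }
  have hfin' := hfin.to_subtype
  have := Finite.of_equiv _ e
  refine ⟨Set.finite_coe_iff.1 (Finite.of_equiv _ e₁), Set.finite_coe_iff.1 (Finite.of_equiv _ e₂),
    e₁.symm.trans (e.trans e₂), fun z => ?_⟩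
  obtain ⟨w, rfl⟩ := e₁.surjective z
  have h1 := negativeEigenvalueCount_full hU hL w
  have h2 := negativeEigenvalueCount_truncated hU hL d ⟨e w, (e w).2.1.1⟩
  rw [he w, ← h1] at h2
  have h3 : (e₁.symm.trans (e.trans e₂)) (e₁ w) = e₂ (e w) := by simp
  rw [h3]
  exact h2

end Neumann

/-! ### Consequences of the double-well assumptions -/

section DoubleWell

/-- Without zeros beyond `c` the derivative keeps its sign there. Were it negative, `V` would be
nonincreasing on a half-line, against the quadratic lower bound. -/
theorem deriv_pos_of_quadratic_lower {V : ℝ → ℝ} (hV : ContDiff ℝ 1 V) {α β c : ℝ} (hβ : 0 < β)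
    (hc : 0 < c) (hlow : ∀ u, β * u ^ 2 - α ≤ V u) (hne : ∀ u, c < u → deriv V u ≠ 0) {s : ℝ}
    (hs : c < s) : 0 < deriv V s := by
  by_contra hneg
  have hneg' : deriv V s < 0 := lt_of_le_of_ne (not_lt.1 hneg) (hne s hs)
  have hcont := hV.continuous_deriv le_rfl
  have hall : ∀ x, s ≤ x → deriv V x ≤ 0 := by
    intro x hx
    by_contra hpos
    push Not at hpos
    obtain ⟨y, hy, hy0⟩ := intermediate_value_Icc hx hcont.continuousOn ⟨hneg'.le, hpos.le⟩
    exact hne y (hs.trans_le hy.1) hy0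
  have hanti : AntitoneOn V (Set.Ici s) := by
    refine antitoneOn_of_deriv_nonpos (convex_Ici s) hV.continuous.continuousOn
      ((hV.differentiable one_ne_zero).differentiableOn) fun x hx => ?_
    rw [interior_Ici] at hx
    exact hall x (le_of_lt hx)
  -- Then `β x = β (s + 1) + |V s| + |α|` exceeds `V s + α`, and `x ≥ 1` gives `β x² ≥ β x`.
  set x := s + 1 + (|V s| + |α|) / β with hx
  have h0 : 0 ≤ (|V s| + |α|) / β := by positivity
  have hsx : s ≤ x := by linarith
  have h1 := hanti (Set.mem_Ici.2 le_rfl) (Set.mem_Ici.2 hsx) hsx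
  have h2 := hlow x
  have hx1 : 1 ≤ x := by linarith
  have h3 : β * x ≤ β * x ^ 2 := by
    have : x ≤ x ^ 2 := by nlinarith
    gcongr
  have h4 : β * x = β * (s + 1) + (|V s| + |α|) := by
    rw [hx]; field_simp
  have h5 : 0 < β * (s + 1) := by
    have : 0 < s + 1 := by linarith
    positivity
  linarith [le_abs_self (V s), le_abs_self α]

variable {U : ℝ → ℝ}

theorem iteratedDeriv_two_eq (U : ℝ → ℝ) : iteratedDeriv 2 U = deriv (deriv U) := by
  rw [iteratedDeriv_succ, iteratedDeriv_one]

namespace IsDoubleWell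

/-- Such a `c` is a local minimum with `U'' ≠ 0`. If `U''` were negative there, the point would also
be a local maximum, `U` would be locally constant, and `U''` would vanish. -/
theorem deriv_deriv_pos (hU : IsDoubleWell U) {c : ℝ} (hc : deriv U c = 0) (hc0 : c ≠ 0) :
    0 < deriv (deriv U) c := by
  obtain ⟨um, up, -, -, hstat, hm, hp, -, hm2, hp2, -⟩ := hU.stationary
  rw [iteratedDeriv_two_eq] at hm2 hp2
  have key : ∀ x, deriv U x = 0 → IsLocalMin U x → deriv (deriv U) x ≠ 0 →
      0 < deriv (deriv U) x := by
    intro x hx hmin hne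
    by_contra hneg
    have hneg' : deriv (deriv U) x < 0 := lt_of_le_of_ne (not_lt.1 hneg) hne
    have hmax := isLocalMax_of_deriv_deriv_neg hneg' hx hU.contDiff.continuous.continuousAt
    have hconst : U =ᶠ[nhds x] fun _ => U x := by
      filter_upwards [hmin, hmax] with y h1 h2 using le_antisymm h2 h1
    have h1 : deriv U =ᶠ[nhds x] fun _ => 0 := by
      have := hconst.deriv
      simpa using this
    have h2 := h1.deriv_eq
    rw [deriv_const] at h2
    exact hne h2
  rcases (hstat c).1 hc with rfl | rfl | rfl
  · exact key _ hc hm hm2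
  · exact absurd rfl hc0
  · exact key _ hc hp hp2

theorem deriv_zero (hU : IsDoubleWell U) : deriv U 0 = 0 := by
  obtain ⟨um, up, -, -, hstat, -⟩ := hU.stationary
  exact (hstat 0).2 (Or.inr (Or.inl rfl))

theorem deriv_deriv_zero (hU : IsDoubleWell U) : deriv (deriv U) 0 = -1 := by
  obtain ⟨um, up, -, -, -, -, -, -, -, -, h⟩ := hU.stationary
  rwa [iteratedDeriv_two_eq] at h

/-- Outside the interval between the wells `U'(s) s ≥ 0`, and `U'(s)² ≥ s² - M` (the case `γ = 1`)
gives `(U'(s) s)² ≥ (s² - |M|)²` once `s² > |M|`, so `U'(s) s ≥ s² - |M|`. Between the wells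
continuity suffices. -/
theorem exists_sq_sub_deriv_mul_le (hU : IsDoubleWell U) :
    ∃ C, ∀ s, s ^ 2 - deriv U s * s ≤ C := by
  obtain ⟨um, up, hum, hup, hstat, -⟩ := hU.stationary
  obtain ⟨α, β, hβ, hlow⟩ := hU.quadratic_lower
  obtain ⟨M, hM⟩ := hU.deriv_sq_lower 1 one_pos
  have hU1 : ContDiff ℝ 1 U := hU.contDiff.of_le (by norm_num)
  have hright : ∀ s, up < s → 0 < deriv U s := fun s hs =>
    deriv_pos_of_quadratic_lower hU1 hβ hup hlow (fun u hu h => by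
      rcases (hstat u).1 h with h | h | h <;> linarith) hs
  have hleft : ∀ s, s < um → deriv U s < 0 := by
    intro s hs
    have h1 := deriv_pos_of_quadratic_lower (V := fun x => U (-x)) (hU1.comp contDiff_neg) hβ
      (neg_pos.2 hum) (α := α) (fun u => by simpa using hlow (-u)) (fun u hu h => by
        rw [deriv_comp_neg, neg_eq_zero] at h
        rcases (hstat (-u)).1 h with h | h | h <;> linarith) (neg_lt_neg hs)
    rw [deriv_comp_neg, neg_neg] at h1
    linarith
  have hcont : Continuous fun s => s ^ 2 - deriv U s * s := by
    have := hU1.continuous_deriv le_rfl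
    fun_prop
  obtain ⟨C, hC⟩ := (isCompact_Icc (a := um) (b := up)).exists_bound_of_continuousOn
    hcont.continuousOn
  have hout : ∀ s, 0 ≤ deriv U s * s → s ^ 2 - deriv U s * s ≤ |M| := by
    intro s hs
    have h1 := hM s
    have h2 := le_abs_self M
    rcases le_or_gt (s ^ 2) |M| with h3 | h3
    · linarith
    · have h4 : (s ^ 2 - |M|) ^ 2 ≤ (deriv U s * s) ^ 2 := by
        rw [mul_pow, sq (s ^ 2 - |M|)]
        have h5 : 0 ≤ |M| := abs_nonneg M
        refine mul_le_mul ?_ ?_ (by linarith) (sq_nonneg _) <;> linarith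
      have h5 := abs_le_of_sq_le_sq h4 hs
      linarith [le_abs_self (s ^ 2 - |M|), h5]
  refine ⟨max C |M|, fun s => ?_⟩
  rcases lt_or_ge s um with h1 | h1
  · exact (hout s (by nlinarith [hleft s h1])).trans (le_max_right _ _)
  · rcases lt_or_ge up s with h2 | h2
    · exact (hout s (by nlinarith [hright s h2])).trans (le_max_right _ _)
    · exact ((le_abs_self _).trans (hC s ⟨h1, h2⟩)).trans (le_max_left _ _)

end IsDoubleWell

end DoubleWell

/-! ### The reduced bifurcation equation at the degenerate zero -/

open BoundedContinuousFunction

section Taylor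

variable {U : ℝ → ℝ}

/-- Peano's form of the third-order Taylor expansion of `U'` at `0`, with `U'(0) = 0` and `U''(0) =
-1`. -/
theorem exists_forall_abs_deriv_sub_taylor_le (hU : IsDoubleWell U) (hU4 : ContDiff ℝ 4 U) {ε : ℝ}
    (hε : 0 < ε) : ∃ δ > 0, ∀ s, |s| ≤ δ →
      |deriv U s + s - iteratedDeriv 3 U 0 / 2 * s ^ 2 - iteratedDeriv 4 U 0 / 6 * s ^ 3| ≤
        ε * |s| ^ 3 := by
  have hU' : ContDiff ℝ 3 (deriv U) := by
    have : ContDiff ℝ (3 + 1) U := hU4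
    exact ((contDiff_succ_iff_deriv).1 this).2.2
  have h1 := taylor_isLittleO_univ (n := 3) (x₀ := (0 : ℝ)) (f := deriv U) (by exact_mod_cast hU')
  rw [Asymptotics.isLittleO_iff] at h1
  obtain ⟨δ, hδ, h2⟩ := Metric.nhds_basis_closedBall.eventually_iff.1 (h1 hε)
  refine ⟨δ, hδ, fun s hs => ?_⟩
  have h3 := h2 (show s ∈ Metric.closedBall 0 δ by simpa using hs)
  have h4 : ∀ k, iteratedDeriv k (deriv U) = iteratedDeriv (k + 1) U := fun k =>
    (iteratedDeriv_succ').symm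
  have h5 : iteratedDeriv 2 U 0 = -1 := by rw [iteratedDeriv_two_eq, hU.deriv_deriv_zero]
  have h6 : taylorWithinEval (deriv U) 3 Set.univ 0 s =
      - s + iteratedDeriv 3 U 0 / 2 * s ^ 2 + iteratedDeriv 4 U 0 / 6 * s ^ 3 := by
    rw [taylor_within_apply]
    simp only [iteratedDerivWithin_univ, h4, Finset.sum_range_succ, Finset.sum_range_zero, sub_zero,
      zero_add, one_add_one_eq_two, h5, iteratedDeriv_one, hU.deriv_zero, Nat.factorial]
    norm_num
    ring
  rw [h6, Real.norm_eq_abs, sub_zero, norm_pow, Real.norm_eq_abs] at h3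
  refine le_trans (le_of_eq ?_) h3
  congr 1
  ring

end Taylor

set_option maxHeartbeats 1000000 in
/-- The pointwise expansion behind the reduced bifurcation equation. -/
theorem abs_bifurcation_remainder_le {a b B ε r c c2 u v R : ℝ} (hB : 0 ≤ B) (hε0 : 0 ≤ ε)
    (hε : ε ≤ 1) (hr : |r| ≤ 1) (hc : |c| ≤ 1) (hc2 : |c2| ≤ 1) (hu : u = r * c + v)
    (hv : |v| ≤ B * r ^ 2) (hur : |u| ≤ 2 * |r|)
    (hR : |R - a / 2 * u ^ 2 - b / 6 * u ^ 3| ≤ ε * |u| ^ 3) :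
    |c * R - a * r * (c ^ 2 * v) + a * r / 2 * ((1 - c2 / 3) * R) -
        r ^ 3 * (a / 2 * r⁻¹ * c ^ 3 + b / 6 * c ^ 4 + a ^ 2 / 4 * (c ^ 2 * (1 - c2 / 3)))| ≤
      ((|a| * B ^ 2 + 2 * |b| * B + |a| * (8 + |a| * (B + B ^ 2) + 2 * |b|)) * |r| + 8 * ε) *
        |r| ^ 3 := by
  rcases eq_or_ne r 0 with rfl | hr0
  · have hu0 : u = 0 := by simpa using hur
    have hv0 : v = 0 := by simpa using hv
    subst hu0
    have hR0 : R = 0 := by simpa using hR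
    simp [hR0]
  set e := R - a / 2 * u ^ 2 - b / 6 * u ^ 3 with he
  set ρ := |r| with hρ
  have hρ0 : 0 ≤ ρ := abs_nonneg r
  have hr2 : r ^ 2 = ρ ^ 2 := (sq_abs r).symm
  rw [hr2] at hv
  have heb : |e| ≤ 8 * ε * ρ ^ 3 := by
    refine hR.trans ?_
    have : |u| ^ 3 ≤ (2 * ρ) ^ 3 := pow_le_pow_left₀ (abs_nonneg u) hur 3
    calc ε * |u| ^ 3 ≤ ε * (2 * ρ) ^ 3 := by gcongr
      _ = _ := by ring
  -- The combination is chosen to cancel `a r c² v`, the only third-order term containing `v`. What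
  -- remains is of order `r⁴` or carries the Taylor error `e`.
  have hdec : c * R - a * r * (c ^ 2 * v) + a * r / 2 * ((1 - c2 / 3) * R) -
        r ^ 3 * (a / 2 * r⁻¹ * c ^ 3 + b / 6 * c ^ 4 + a ^ 2 / 4 * (c ^ 2 * (1 - c2 / 3))) =
      c * e + a / 2 * (c * v ^ 2) + b / 6 * (c * (v * (u ^ 2 + u * (r * c) + (r * c) ^ 2))) +
      a * r / 2 * ((1 - c2 / 3) * (e + a / 2 * (2 * (r * c) * v + v ^ 2) + b / 6 * u ^ 3)) := by
    have hRe : R = e + a / 2 * u ^ 2 + b / 6 * u ^ 3 := by rw [he]; ring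
    rw [hRe, hu]
    field_simp
    ring
  have hrc : |r * c| ≤ ρ := by
    rw [abs_mul]; exact mul_le_of_le_one_right hρ0 hc
  have t1 : |c * e| ≤ 8 * ε * ρ ^ 3 := by
    rw [abs_mul]
    calc |c| * |e| ≤ 1 * |e| := by gcongr
      _ ≤ _ := by rw [one_mul]; exact heb
  have hv2 : |v| ^ 2 ≤ (B * ρ ^ 2) ^ 2 := pow_le_pow_left₀ (abs_nonneg v) hv 2
  have hρ4 : ρ ^ 4 ≤ ρ ^ 3 := pow_le_pow_of_le_one hρ0 hr (by norm_num)
  have t2 : |a / 2 * (c * v ^ 2)| ≤ |a| * B ^ 2 * ρ ^ 4 := by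
    rw [abs_mul, abs_mul, abs_div, abs_two, abs_pow]
    calc |a| / 2 * (|c| * |v| ^ 2) ≤ |a| / 2 * (1 * (B * ρ ^ 2) ^ 2) := by gcongr
      _ ≤ _ := by
        have : 0 ≤ |a| * B ^ 2 * ρ ^ 4 := by positivity
        nlinarith
  have hq : |u ^ 2 + u * (r * c) + (r * c) ^ 2| ≤ 7 * ρ ^ 2 := by
    calc |u ^ 2 + u * (r * c) + (r * c) ^ 2| ≤ |u| ^ 2 + |u| * |r * c| + |r * c| ^ 2 := by
          refine (abs_add_le _ _).trans (add_le_add ((abs_add_le _ _).trans (le_of_eq ?_))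
            (le_of_eq (abs_pow _ _)))
          rw [abs_pow, abs_mul]
      _ ≤ (2 * ρ) ^ 2 + (2 * ρ) * ρ + ρ ^ 2 := by gcongr
      _ = _ := by ring
  have t3 : |b / 6 * (c * (v * (u ^ 2 + u * (r * c) + (r * c) ^ 2)))| ≤
      2 * |b| * B * ρ ^ 4 := by
    rw [abs_mul, abs_mul, abs_mul, abs_div]
    have h6 : |(6 : ℝ)| = 6 := by norm_num
    rw [h6]
    calc _ ≤ |b| / 6 * (1 * ((B * ρ ^ 2) * (7 * ρ ^ 2))) := by gcongr
      _ ≤ _ := by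
        have : 0 ≤ |b| * B * ρ ^ 4 := by positivity
        nlinarith
  have hlast : |e + a / 2 * (2 * (r * c) * v + v ^ 2) + b / 6 * u ^ 3| ≤
      (8 + |a| * (B + B ^ 2) + 2 * |b|) * ρ ^ 3 := by
    have s1 : |e| ≤ 8 * ρ ^ 3 := heb.trans (by
      have : 0 ≤ ρ ^ 3 := by positivity
      nlinarith)
    have s2 : |a / 2 * (2 * (r * c) * v + v ^ 2)| ≤ |a| * (B + B ^ 2) * ρ ^ 3 := by
      rw [abs_mul, abs_div, abs_two]
      have s3 : |2 * (r * c) * v + v ^ 2| ≤ 2 * ρ * (B * ρ ^ 2) + (B * ρ ^ 2) ^ 2 := by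
        refine (abs_add_le _ _).trans ?_
        rw [abs_mul, abs_mul, abs_two, abs_pow]
        gcongr
      calc |a| / 2 * |2 * (r * c) * v + v ^ 2|
          ≤ |a| / 2 * (2 * ρ * (B * ρ ^ 2) + (B * ρ ^ 2) ^ 2) := by gcongr
        _ = |a| * B * ρ ^ 3 + |a| / 2 * B ^ 2 * ρ ^ 4 := by ring
        _ ≤ |a| * B * ρ ^ 3 + |a| * B ^ 2 * ρ ^ 3 := by
          gcongr
          linarith [abs_nonneg a]
        _ = _ := by ring
    have s4 : |b / 6 * u ^ 3| ≤ 2 * |b| * ρ ^ 3 := by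
      rw [abs_mul, abs_div, abs_pow]
      have h6 : |(6 : ℝ)| = 6 := by norm_num
      rw [h6]
      calc |b| / 6 * |u| ^ 3 ≤ |b| / 6 * (2 * ρ) ^ 3 := by gcongr
        _ ≤ _ := by
          have : 0 ≤ |b| * ρ ^ 3 := by positivity
          nlinarith
    calc _ ≤ _ := (abs_add_le _ _).trans (add_le_add (abs_add_le _ _) le_rfl)
      _ ≤ 8 * ρ ^ 3 + |a| * (B + B ^ 2) * ρ ^ 3 + 2 * |b| * ρ ^ 3 := by gcongr
      _ = _ := by ring
  have hc23 : |1 - c2 / 3| ≤ 2 := by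
    rw [abs_le] at hc2 ⊢
    constructor <;> linarith [hc2.1, hc2.2]
  have t4 : |a * r / 2 * ((1 - c2 / 3) *
      (e + a / 2 * (2 * (r * c) * v + v ^ 2) + b / 6 * u ^ 3))| ≤
      |a| * (8 + |a| * (B + B ^ 2) + 2 * |b|) * ρ ^ 4 := by
    rw [abs_mul, abs_mul, abs_div, abs_two, abs_mul]
    calc _ ≤ |a| * ρ / 2 * (2 * ((8 + |a| * (B + B ^ 2) + 2 * |b|) * ρ ^ 3)) := by gcongr
      _ = _ := by ring
  rw [hdec]
  calc _ ≤ 8 * ε * ρ ^ 3 + |a| * B ^ 2 * ρ ^ 4 + 2 * |b| * B * ρ ^ 4 +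
        |a| * (8 + |a| * (B + B ^ 2) + 2 * |b|) * ρ ^ 4 :=
        (abs_add_le _ _).trans (add_le_add ((abs_add_le _ _).trans (add_le_add
          ((abs_add_le _ _).trans (add_le_add t1 t2)) t3)) t4)
    _ = _ := by ring

/-- The functions `cos (j x)`. -/
def cosFun (j : ℕ) : ℝ →ᵇ ℝ :=
  BoundedContinuousFunction.ofNormedAddCommGroup (fun x => Real.cos (j * x)) (by fun_prop) 1
    fun x => Real.abs_cos_le_one _

@[simp]
theorem cosFun_apply (j : ℕ) (x : ℝ) : cosFun j x = Real.cos (j * x) := rfl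

theorem cosFun_zero : cosFun 0 = 1 := by
  ext x; simp

theorem integralFunctional_cosFun {n : ℕ} (hn : n ≠ 0) (j : ℕ) :
    integralFunctional (n * Real.pi) (cosFun j) = if j = 0 then n * Real.pi else 0 := by
  have hn' : (0 : ℝ) < n := by positivity
  have h := integral_cos_int_mul_pi_div (L := n * Real.pi) (by positivity) (j * n : ℤ)
  have h1 : ∀ x : ℝ, Real.cos (((j * n : ℤ) : ℝ) * Real.pi * x / (n * Real.pi)) = cosFun j x := by
    intro x
    rw [cosFun_apply]
    congr 1
    push_cast
    field_simp
  simp only [h1] at h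
  rw [integralFunctional_apply, h]
  simp [hn]

/-- If a small `u = r cos + v` solves the modes `0`, `1`, `2` of `u'' + u = R`, where `R` is close to
`a u² / 2 + b u³ / 6`, then the bifurcation coefficient `b + 5 a² / 3` is small. -/
theorem abs_bifurcation_coefficient_le {n : ℕ} (hn : n ≠ 0) {a b B ε r : ℝ} {u v R : ℝ →ᵇ ℝ}
    (hB : 0 ≤ B) (hε0 : 0 ≤ ε) (hε : ε ≤ 1) (hr0 : r ≠ 0) (hr : |r| ≤ 1)
    (hu : u = r • cosFun 1 + v) (hv : ∀ x, |v x| ≤ B * r ^ 2) (hur : ∀ x, |u x| ≤ 2 * |r|)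
    (hR : ∀ x, |R x - a / 2 * u x ^ 2 - b / 6 * u x ^ 3| ≤ ε * |u x| ^ 3)
    (h0 : integralFunctional (n * Real.pi) u = integralFunctional (n * Real.pi) R)
    (h1 : integralFunctional (n * Real.pi) (cosFun 1 * R) = 0)
    (h2 : 3 * integralFunctional (n * Real.pi) (cosFun 2 * u) =
      - integralFunctional (n * Real.pi) (cosFun 2 * R)) :
    |b + 5 / 3 * a ^ 2| / 16 ≤
      (|a| * B ^ 2 + 2 * |b| * B + |a| * (8 + |a| * (B + B ^ 2) + 2 * |b|)) * |r| + 8 * ε := by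
  set I := integralFunctional (n * Real.pi) with hI
  set K := (|a| * B ^ 2 + 2 * |b| * B + |a| * (8 + |a| * (B + B ^ 2) + 2 * |b|)) * |r| + 8 * ε
    with hK
  have hn' : (0 : ℝ) < n := by positivity
  have hcos : ∀ j, j ≠ 0 → I (cosFun j) = 0 := fun j hj => by
    rw [hI, integralFunctional_cosFun hn, if_neg hj]
  have hcos0 : I (cosFun 0) = n * Real.pi := by
    rw [hI, integralFunctional_cosFun hn, if_pos rfl]
  have hv0 : I v = I u := by
    rw [hu, map_add, map_smul, hcos 1 one_ne_zero, smul_zero, zero_add]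
  have hprod : cosFun 2 * cosFun 1 = (1 / 2 : ℝ) • (cosFun 3 + cosFun 1) := by
    ext x
    simp only [BoundedContinuousFunction.mul_apply, BoundedContinuousFunction.smul_apply,
      BoundedContinuousFunction.add_apply, cosFun_apply, smul_eq_mul]
    push_cast
    rw [one_mul, Real.cos_three_mul, Real.cos_two_mul]
    ring
  have hv2 : I (cosFun 2 * v) = I (cosFun 2 * u) := by
    rw [hu, mul_add, mul_smul_comm, hprod, map_add, map_smul, map_smul, map_add, hcos 3 (by simp),
      hcos 1 one_ne_zero]
    simp
  -- Since `2 cos² = 1 + cos 2x`, the subtracted term is `a r cos² v`. The equations for the modes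
  -- `0` and `2` express its integral through `R`, and with mode `1` the integral of `Fn` vanishes.
  let Fn : ℝ →ᵇ ℝ := cosFun 1 * R - (a * r / 2) • (v + cosFun 2 * v) +
    (a * r / 2) • (R - (1 / 3 : ℝ) • (cosFun 2 * R))
  -- The third-order main part expanded in `cos (j x)`. Only the constant term survives integration;
  -- it is `(b / 6) (3 / 8) + (a² / 4) (5 / 12) = (b + 5 a² / 3) / 16`.
  let Mn : ℝ →ᵇ ℝ := r ^ 3 • ((b / 16 + 5 / 48 * a ^ 2) • cosFun 0 +
    (3 / 8 * a * r⁻¹) • cosFun 1 + (b / 12 + a ^ 2 / 12) • cosFun 2 + (a / 8 * r⁻¹) • cosFun 3 +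
    (b / 48 - a ^ 2 / 48) • cosFun 4)
  have hF : I Fn = 0 := by
    simp only [Fn, map_add, map_sub, map_smul, smul_eq_mul, hv0, hv2]
    linear_combination h1 - a * r / 2 * h0 - a * r / 6 * h2
  have hM : I Mn = r ^ 3 * (b / 16 + 5 / 48 * a ^ 2) * (n * Real.pi) := by
    simp only [Mn, map_add, map_smul, smul_eq_mul, hcos0, hcos 1 one_ne_zero, hcos 2 two_ne_zero,
      hcos 3 (by simp), hcos 4 (by simp)]
    ring
  have hdiff : ‖Fn - Mn‖ ≤ K * |r| ^ 3 := by
    rw [norm_le_of_nonempty]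
    intro x
    have hux : u x = r * Real.cos x + v x := by
      rw [hu]; simp
    have h3 := abs_bifurcation_remainder_le (a := a) (b := b) (c := Real.cos x)
      (c2 := Real.cos (2 * x)) hB hε0 hε hr (Real.abs_cos_le_one _) (Real.abs_cos_le_one _) hux
      (hv x) (hur x) (hR x)
    refine le_trans (le_of_eq ?_) h3
    rw [Real.norm_eq_abs]
    congr 1
    have h4 : Real.cos (4 * x) = 2 * Real.cos (2 * x) ^ 2 - 1 := by
      rw [← Real.cos_two_mul]; ring_nf
    simp only [Fn, Mn, BoundedContinuousFunction.mul_apply, BoundedContinuousFunction.smul_apply,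
      BoundedContinuousFunction.add_apply, BoundedContinuousFunction.sub_apply, cosFun_apply,
      smul_eq_mul]
    push_cast
    rw [one_mul, zero_mul, Real.cos_zero, Real.cos_three_mul, h4, Real.cos_two_mul]
    ring
  have hle : |I (Fn - Mn)| ≤ (n * Real.pi) * (K * |r| ^ 3) := by
    refine (I.le_opNorm _).trans ?_
    have h5 := norm_integralFunctional_le (n * Real.pi)
    rw [abs_of_pos (by positivity)] at h5
    gcongr
  rw [map_sub, hF, hM, zero_sub, abs_neg, abs_mul, abs_mul, abs_pow,
    abs_of_pos (show 0 < n * Real.pi by positivity)] at hle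
  have hr3 : 0 < |r| ^ 3 := by positivity
  have hL : 0 < n * Real.pi := by positivity
  have h6 : |b / 16 + 5 / 48 * a ^ 2| ≤ K := by
    have h7 : (|r| ^ 3 * (n * Real.pi)) * |b / 16 + 5 / 48 * a ^ 2| ≤
        (|r| ^ 3 * (n * Real.pi)) * K := by linarith
    exact le_of_mul_le_mul_left h7 (by positivity)
  have h8 : b / 16 + 5 / 48 * a ^ 2 = (b + 5 / 3 * a ^ 2) / 16 := by ring
  rw [h8, abs_div] at h6
  have h9 : |(16 : ℝ)| = 16 := by norm_num
  rwa [h9] at h6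

namespace Neumann

open Real BoundedContinuousFunction

variable {L : ℝ} {U : ℝ → ℝ} (hU : ContDiff ℝ 2 U) (hL : 0 < L)

/-- The nonlinearity `U' u + u`, which is quadratic at zero. -/
def quadPart (w : EllTwo) : ℝ →ᵇ ℝ :=
  nemytskii (fun s => deriv U s + s) ((contDiff_deriv hU).continuous.add continuous_id)
    (synth hL w)

theorem quadPart_apply (w : EllTwo) (x : ℝ) :
    quadPart hU hL w x = deriv U (synth hL w x) + synth hL w x := rfl

theorem statMap_apply_eq (w : EllTwo) (k : ℕ) :
    statMap hU hL w k = 2 * ((1 + lam L k)⁻¹ * w k) -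
      integralFunctional L (mode L k * quadPart hU hL w) := by
  have h1 : nemytskii (fun u => u - deriv U u) (contDiff_sub_deriv hU).continuous (synth hL w) =
      (2 : ℝ) • synth hL w - quadPart hU hL w := by
    ext x
    simp only [nemytskii_apply, BoundedContinuousFunction.sub_apply,
      BoundedContinuousFunction.smul_apply, quadPart_apply, smul_eq_mul]
    ring
  rw [← analysis_synth_apply hL, statMap, fixMap, h1, analysis_apply, analysis_apply, mul_sub,
    map_sub, mul_smul_comm, map_smul, smul_eq_mul]

/-- Mode `k` of `u'' + u = U'(u) + u`. The factor `lam L k - 1` vanishes exactly at the resonant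
mode. -/
theorem lam_sub_one_mul_integral {w : EllTwo} {k : ℕ} (hk : w k = statMap hU hL w k) :
    (lam L k - 1) * integralFunctional L (mode L k * synth hL w) =
      - integralFunctional L (mode L k * quadPart hU hL w) := by
  rw [statMap_apply_eq] at hk
  rw [← analysis_apply hL, analysis_synth_apply]
  have := one_add_lam_pos L k
  field_simp at hk ⊢
  linarith

variable {n : ℕ} (hLn : L = n * π)
include hLn

theorem lam_eq_sq_div (hn : n ≠ 0) (k : ℕ) : lam L k = (k : ℝ) ^ 2 / (n : ℝ) ^ 2 := by
  have hn' : (0 : ℝ) < n := by positivity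
  rw [lam, hLn]
  field_simp

theorem mode_mul_eq_smul_cosFun (hn : n ≠ 0) (j : ℕ) :
    mode L (j * n) = amp L (j * n) • cosFun j := by
  have hn' : (0 : ℝ) < n := by positivity
  ext x
  rw [mode_apply, BoundedContinuousFunction.smul_apply, cosFun_apply, smul_eq_mul]
  congr 2
  rw [hLn]
  push_cast
  field_simp

theorem sq_sub_one_mul_integral_cosFun (hn : n ≠ 0) {w : EllTwo} {j : ℕ}
    (hj : w (j * n) = statMap hU hL w (j * n)) :
    ((j : ℝ) ^ 2 - 1) * integralFunctional L (cosFun j * synth hL w) =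
      - integralFunctional L (cosFun j * quadPart hU hL w) := by
  have hn' : (0 : ℝ) < n := by positivity
  have h1 := lam_sub_one_mul_integral hU hL hj
  have h2 : lam L (j * n) = (j : ℝ) ^ 2 := by
    rw [lam_eq_sq_div hLn hn]
    push_cast
    field_simp
  rw [mode_mul_eq_smul_cosFun hLn hn, h2, smul_mul_assoc, smul_mul_assoc, map_smul, map_smul,
    smul_eq_mul, smul_eq_mul] at h1
  have h3 := amp_pos hL (j * n)
  refine mul_left_cancel₀ h3.ne' ?_
  linarith

/-- Off resonance `(1 + lam) / |lam - 1| = (k² + n²) / |k² - n²| ≤ 3 n` uniformly in `k`: the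
divisors `|k² - n²|` of integers stay away from zero. -/
theorem abs_apply_le_of_ne (hn : n ≠ 0) {w : EllTwo} {k : ℕ} (hkn : k ≠ n)
    (hk : w k = 0 ∨ w k = statMap hU hL w k) :
    |w k| ≤ 3 * n * L * ‖quadPart hU hL w‖ * amp L k := by
  have hamp := amp_pos hL k
  rcases hk with hk | hk
  · rw [hk, abs_zero]; positivity
  rw [statMap_apply_eq] at hk
  have hI : |integralFunctional L (mode L k * quadPart hU hL w)| ≤
      L * (amp L k * ‖quadPart hU hL w‖) := by
    refine ((integralFunctional L).le_opNorm _).trans ?_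
    have h1 := norm_integralFunctional_le L
    rw [abs_of_pos hL] at h1
    have h2 : ‖mode L k * quadPart hU hL w‖ ≤ amp L k * ‖quadPart hU hL w‖ :=
      (norm_mul_le _ _).trans (by gcongr; exact norm_mode_le hL k)
    gcongr
  have hn' : (0 : ℝ) < n := by positivity
  have hlam := lam_eq_sq_div hLn hn k
  have hpos := one_add_lam_pos L k
  have hkey : (k : ℝ) ^ 2 + (n : ℝ) ^ 2 ≤ 3 * n * |(k : ℝ) ^ 2 - (n : ℝ) ^ 2| := by
    have hn1 : (1 : ℝ) ≤ n := by exact_mod_cast Nat.one_le_iff_ne_zero.2 hn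
    have hk0 : (0 : ℝ) ≤ k := Nat.cast_nonneg k
    rcases lt_or_gt_of_ne hkn with h | h
    · have h' : (k : ℝ) + 1 ≤ n := by exact_mod_cast h
      rw [abs_sub_comm, abs_of_nonneg (by nlinarith)]
      have h1 : (n : ℝ) + k ≤ (n : ℝ) ^ 2 - (k : ℝ) ^ 2 := by nlinarith
      nlinarith [mul_le_mul_of_nonneg_left h1 (by positivity : (0 : ℝ) ≤ 3 * n)]
    · have h' : (n : ℝ) + 1 ≤ k := by exact_mod_cast h
      rw [abs_of_nonneg (by nlinarith)]
      obtain ⟨m, hm⟩ : ∃ m : ℝ, (k : ℝ) = n + m := ⟨k - n, by ring⟩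
      have hm1 : 1 ≤ m := by linarith
      rw [hm]
      have h1 : (n : ℝ) ^ 2 ≤ (n : ℝ) ^ 2 * m := by nlinarith [sq_nonneg (n : ℝ)]
      have h2 : m ^ 2 ≤ n * m ^ 2 := by nlinarith [sq_nonneg m]
      have h3 : (n : ℝ) * m ≤ (n : ℝ) ^ 2 * m := by
        have : (n : ℝ) ≤ (n : ℝ) ^ 2 := by nlinarith
        nlinarith
      have h4 : 0 ≤ (n : ℝ) ^ 2 * m := by positivity
      have h5 : 0 ≤ (n : ℝ) * m ^ 2 := by positivity
      nlinarith
  have hw : (lam L k - 1) * w k =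
      - ((1 + lam L k) * integralFunctional L (mode L k * quadPart hU hL w)) := by
    field_simp at hk
    linarith
  have hw2 : |lam L k - 1| * |w k| =
      (1 + lam L k) * |integralFunctional L (mode L k * quadPart hU hL w)| := by
    rw [← abs_mul, hw, abs_neg, abs_mul, abs_of_pos hpos]
  have hratio : 1 + lam L k ≤ 3 * n * |lam L k - 1| := by
    have h1 : lam L k - 1 = ((k : ℝ) ^ 2 - (n : ℝ) ^ 2) / (n : ℝ) ^ 2 := by
      rw [hlam]; field_simp
    have h2 : 1 + lam L k = ((k : ℝ) ^ 2 + (n : ℝ) ^ 2) / (n : ℝ) ^ 2 := by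
      rw [hlam]; field_simp; ring
    rw [h1, h2, abs_div, abs_of_nonneg (sq_nonneg (n : ℝ)), ← mul_div_assoc]
    gcongr
  have hne : 0 < |lam L k - 1| := by
    by_contra h
    have : |lam L k - 1| = 0 := le_antisymm (not_lt.1 h) (abs_nonneg _)
    rw [this, mul_zero] at hratio
    linarith
  refine le_of_mul_le_mul_left ?_ hne
  rw [hw2]
  calc _ ≤ (3 * n * |lam L k - 1|) * (L * (amp L k * ‖quadPart hU hL w‖)) := by gcongr
    _ = _ := by ring

/-- The part of `u` off the resonant mode is bounded by the quadratic part of the equation. One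
factor `amp L k` comes from the coordinate and one from the mode, so the series converges. The
alternative `w k = 0` admits Galerkin solutions, with a constant independent of `d`. -/
theorem norm_synth_sub_le (hn : n ≠ 0) {w : EllTwo}
    (hw : ∀ k, w k = 0 ∨ w k = statMap hU hL w k) :
    ‖synth hL w - w n • mode L n‖ ≤
      3 * n * L * (∑' k, amp L k ^ 2) * ‖quadPart hU hL w‖ := by
  have h1 := hasSum_ite_sub_hasSum (hasSum_synth hL w) n
  have h2 := (summable_amp_sq hL).hasSum.mul_left (3 * n * L * ‖quadPart hU hL w‖)
  refine (h1.norm_le_of_bounded h2 fun k => ?_).trans_eq (by ring)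
  have hamp := amp_pos hL k
  split_ifs with hk
  · rw [norm_zero]; positivity
  · rw [norm_smul, sq, ← mul_assoc, Real.norm_eq_abs]
    have h3 := abs_apply_le_of_ne hU hL hLn hn hk (hw k)
    have h4 := norm_mode_le hL k
    gcongr

end Neumann

theorem IsDoubleWell.contDiff_two {U : ℝ → ℝ} (hU : IsDoubleWell U) : ContDiff ℝ 2 U :=
  hU.contDiff.of_le (by norm_num)

namespace Neumann

open Real BoundedContinuousFunction

variable {L : ℝ} {U : ℝ → ℝ} (hU : IsDoubleWell U) (hL : 0 < L)

theorem eq_zero_of_synth_eq_zero {w : EllTwo} (h : synth hL w = 0) : w = 0 := by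
  refine embed_injective hL ?_
  rw [map_zero, ← norm_eq_zero, ← sq_eq_zero_iff, ← real_inner_self_eq_norm_sq,
    ← integral_synth_mul_synth, h, zero_mul, map_zero]

variable {n : ℕ} (hLn : L = n * π)
include hLn

set_option maxHeartbeats 1000000 in
/-- Near a degenerate zero, the stationary equation for the modes `0`, `n`, `2 n` and for all other
modes that are present has only the zero solution. -/
theorem exists_forall_eq_zero_of_bifurcation (hU4 : ContDiff ℝ 4 U)
    (hne : iteratedDeriv 4 U 0 ≠ -(5 / 3) * (iteratedDeriv 3 U 0) ^ 2) (hn : n ≠ 0) :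
    ∃ ρ > 0, ∀ w : EllTwo, ‖w‖ ≤ ρ →
      (∀ k, w k = 0 ∨ w k = statMap hU.contDiff_two hL w k) →
      (∀ j ≤ 2, w (j * n) = statMap hU.contDiff_two hL w (j * n)) → w = 0 := by
  set a := iteratedDeriv 3 U 0 with ha
  set b := iteratedDeriv 4 U 0 with hb
  set q := |b + 5 / 3 * a ^ 2| with hq
  have hq0 : 0 < q := by
    rw [hq, abs_pos]
    intro h
    exact hne (by linarith)
  -- This gives `8 ε ≤ q / 32`. Together with `K |r| ≤ q / 64`, arranged by `τ`, the error stays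
  -- below the `q / 16` forced by a solution with `r ≠ 0`.
  set ε := min 1 (q / 256) with hε
  have hε0 : 0 < ε := by positivity
  obtain ⟨δ, hδ, hT⟩ := exists_forall_abs_deriv_sub_taylor_le hU hU4 hε0
  set A := |a| + |b| + 1 with hA
  have hA0 : 0 < A := by positivity
  set C := 3 * n * L * (∑' k, amp L k ^ 2) with hC
  have hC0 : 0 ≤ C := by
    have : 0 ≤ ∑' k, amp L k ^ 2 := tsum_nonneg fun k => sq_nonneg _
    positivity
  -- From `‖v‖ ≤ C A ‖u‖²` and `‖u‖ ≤ 2 |r|`.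
  set B := 4 * (C * A) with hB
  have hB0 : 0 ≤ B := by positivity
  set K := |a| * B ^ 2 + 2 * |b| * B + |a| * (8 + |a| * (B + B ^ 2) + 2 * |b|) with hK
  have hK0 : 0 ≤ K := by positivity
  have hamp := amp_pos hL n
  -- The last bound makes `C A ‖u‖ ≤ 1 / 2`, so the quadratic term is absorbed in `‖u‖ ≤ |r| + C A
  -- ‖u‖²`.
  set σ := min (min δ 1) (2 * (C * A + 1))⁻¹ with hσ
  have hσ0 : 0 < σ := by positivity
  set τ := min 1 (q / (64 * (K + 1))) with hτ
  have hτ0 : 0 < τ := by positivity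
  refine ⟨min (σ / (‖synth hL‖ + 1)) (τ / amp L n), by positivity, fun w hw hall hres => ?_⟩
  set u := synth hL w with hu
  set R := quadPart hU.contDiff_two hL w with hR
  set r := w n * amp L n with hr
  have huσ : ‖u‖ ≤ σ := by
    calc ‖u‖ ≤ ‖synth hL‖ * ‖w‖ := (synth hL).le_opNorm w
      _ ≤ (‖synth hL‖ + 1) * (σ / (‖synth hL‖ + 1)) := by
        have := hw.trans (min_le_left _ _)
        gcongr
        linarith
      _ = σ := by field_simp
  have hrτ : |r| ≤ τ := by
    rw [hr, abs_mul, abs_of_pos hamp]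
    calc |w n| * amp L n ≤ τ / amp L n * amp L n := by
          have := (EllTwo.abs_apply_le w n).trans (hw.trans (min_le_right _ _))
          gcongr
      _ = τ := by field_simp
  have hux : ∀ x, |u x| ≤ ‖u‖ := fun x => u.norm_coe_le_norm x
  have hu1 : ‖u‖ ≤ 1 := huσ.trans ((min_le_left _ _).trans (min_le_right _ _))
  have huδ : ‖u‖ ≤ δ := huσ.trans ((min_le_left _ _).trans (min_le_left _ _))
  have hRx : ∀ x, |R x - a / 2 * u x ^ 2 - b / 6 * u x ^ 3| ≤ ε * |u x| ^ 3 := fun x =>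
    hT (u x) ((hux x).trans huδ)
  have hRA : ‖R‖ ≤ A * ‖u‖ ^ 2 := by
    rw [norm_le_of_nonempty]
    intro x
    have h1 := hRx x
    have h2 : |u x| ≤ 1 := (hux x).trans hu1
    have h3 : |u x| ^ 3 ≤ |u x| ^ 2 := pow_le_pow_of_le_one (abs_nonneg _) h2 (by norm_num)
    have h4 : |u x| ^ 2 ≤ ‖u‖ ^ 2 := pow_le_pow_left₀ (abs_nonneg _) (hux x) 2
    have h5 : |a / 2 * u x ^ 2| ≤ |a| * |u x| ^ 2 := by
      rw [abs_mul, abs_div, abs_two, abs_pow]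
      gcongr
      linarith [abs_nonneg a]
    have h6 : |b / 6 * u x ^ 3| ≤ |b| * |u x| ^ 2 := by
      rw [abs_mul, abs_div, abs_pow, show |(6 : ℝ)| = 6 by norm_num]
      gcongr
      linarith [abs_nonneg b]
    have h7 : ε * |u x| ^ 3 ≤ 1 * |u x| ^ 2 := by
      gcongr
      exact min_le_left _ _
    have h8 : R x = (R x - a / 2 * u x ^ 2 - b / 6 * u x ^ 3) + a / 2 * u x ^ 2 +
      b / 6 * u x ^ 3 := by ring
    rw [h8, Real.norm_eq_abs]
    calc _ ≤ 1 * |u x| ^ 2 + |a| * |u x| ^ 2 + |b| * |u x| ^ 2 :=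
          (abs_add_le _ _).trans (add_le_add ((abs_add_le _ _).trans
            (add_le_add (h1.trans h7) h5)) h6)
      _ = A * |u x| ^ 2 := by rw [hA]; ring
      _ ≤ _ := by gcongr
  have hmode : w n • mode L n = r • cosFun 1 := by
    have := mode_mul_eq_smul_cosFun hLn hn 1
    rw [one_mul] at this
    rw [this, smul_smul]
  set v := u - r • cosFun 1 with hv
  have huv : u = r • cosFun 1 + v := by rw [hv]; abel
  have hvC : ‖v‖ ≤ C * A * ‖u‖ ^ 2 := by
    have h1 := norm_synth_sub_le hU.contDiff_two hL hLn hn hall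
    rw [hmode] at h1
    calc ‖v‖ ≤ C * ‖R‖ := h1
      _ ≤ C * (A * ‖u‖ ^ 2) := by gcongr
      _ = _ := by ring
  have hcos1 : ‖cosFun 1‖ ≤ 1 := by
    rw [norm_le_of_nonempty]
    exact fun x => abs_cos_le_one _
  have hur : ‖u‖ ≤ 2 * |r| := by
    have h1 : ‖u‖ ≤ |r| + C * A * ‖u‖ ^ 2 := by
      nth_rewrite 1 [huv]
      refine (norm_add_le _ _).trans (add_le_add ?_ hvC)
      rw [norm_smul, Real.norm_eq_abs]
      exact mul_le_of_le_one_right (abs_nonneg _) hcos1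
    have h2 : C * A * ‖u‖ ≤ 1 / 2 := by
      have h3 : ‖u‖ ≤ (2 * (C * A + 1))⁻¹ := huσ.trans (min_le_right _ _)
      calc C * A * ‖u‖ ≤ (C * A + 1) * (2 * (C * A + 1))⁻¹ := by
            gcongr
            linarith
        _ = 1 / 2 := by field_simp
    nlinarith [norm_nonneg u]
  by_cases hr0 : r = 0
  · refine eq_zero_of_synth_eq_zero hL (norm_eq_zero.1 (le_antisymm ?_ (norm_nonneg _)))
    simpa [hr0] using hur
  exfalso
  have hvB : ∀ x, |v x| ≤ B * r ^ 2 := fun x => by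
    refine (v.norm_coe_le_norm x).trans (hvC.trans ?_)
    calc C * A * ‖u‖ ^ 2 ≤ C * A * (2 * |r|) ^ 2 := by gcongr
      _ = B * r ^ 2 := by rw [mul_pow, sq_abs, hB]; ring
  have hj : ∀ j : ℕ, j ≤ 2 → ((j : ℝ) ^ 2 - 1) * integralFunctional (n * π) (cosFun j * u) =
      - integralFunctional (n * π) (cosFun j * R) := fun j hj => by
    have := sq_sub_one_mul_integral_cosFun hU.contDiff_two hL hLn hn (hres j hj)
    have hI : integralFunctional (n * π) = integralFunctional L := by rw [hLn]
    rwa [hI]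
  have hj0 := hj 0 (by norm_num)
  have hj1 := hj 1 (by norm_num)
  have hj2 := hj 2 le_rfl
  rw [cosFun_zero, one_mul, one_mul] at hj0
  push_cast at hj0 hj1 hj2
  have hfin := abs_bifurcation_coefficient_le hn hB0 hε0.le (min_le_left _ _) hr0
    (hrτ.trans (min_le_left _ _)) huv hvB (fun x => (hux x).trans hur) hRx (by linarith)
    (by linarith) (by linarith)
  have h1 : K * |r| ≤ q / 64 := by
    calc K * |r| ≤ (K + 1) * (q / (64 * (K + 1))) := by
          have := hrτ.trans (min_le_right _ _)
          gcongr
          linarith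
      _ = q / 64 := by field_simp
  have h2 : 8 * ε ≤ q / 32 := by
    have := min_le_right 1 (q / 256)
    linarith
  have h3 : q / 16 ≤ K * |r| + 8 * ε := hfin
  linarith

end Neumann

/-! ### Degenerate critical points of the Neumann problem -/

namespace Neumann

open Real BoundedContinuousFunction

variable {L : ℝ} {U : ℝ → ℝ} (hU : IsDoubleWell U) (hL : 0 < L)

theorem synth_single (hL : 0 < L) (n : ℕ) (c : ℝ) :
    synth hL (lp.single 2 n c) = c • mode L n := by
  refine (hasSum_synth hL _).unique ?_
  convert hasSum_single n fun k hk => ?_ using 1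
  · simp
  · rw [lp.single_apply_ne _ _ _ hk, zero_smul]

theorem eq_single_zero_of_forall {w : EllTwo} (h : ∀ k, k ≠ 0 → w k = 0) :
    w = lp.single 2 0 (w 0) := by
  refine lp.ext (funext fun k => ?_)
  by_cases hk : k = 0
  · subst hk; simp
  · rw [h k hk, lp.single_apply_ne _ _ _ hk]

theorem mode_zero_apply (x : ℝ) : mode L 0 x = amp L 0 := by
  simp [mode_apply]

theorem synth_apply_of_forall {w : EllTwo} (h : ∀ k, k ≠ 0 → w k = 0) (x : ℝ) :
    synth hL w x = w 0 * amp L 0 := by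
  rw [eq_single_zero_of_forall h, synth_single, BoundedContinuousFunction.smul_apply,
    mode_zero_apply]
  simp

theorem statDeriv_apply_of_forall (hU : ContDiff ℝ 2 U) {w : EllTwo} {c : ℝ}
    (h : ∀ x, synth hL w x = c) (v : EllTwo) (k : ℕ) :
    statDeriv hU hL w v k = (1 - deriv (deriv U) c) * ((1 + lam L k)⁻¹ * v k) := by
  have h1 : ContinuousLinearMap.mul ℝ (ℝ →ᵇ ℝ) (nemytskii (deriv fun u => u - deriv U u)
      ((contDiff_sub_deriv hU).continuous_deriv le_rfl) (synth hL w)) (synth hL v) =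
      (1 - deriv (deriv U) c) • synth hL v := by
    ext x
    simp only [ContinuousLinearMap.mul_apply', BoundedContinuousFunction.mul_apply,
      nemytskii_apply, BoundedContinuousFunction.smul_apply, smul_eq_mul, deriv_sub_deriv hU, h x]
  change analysis hL (ContinuousLinearMap.mul ℝ (ℝ →ᵇ ℝ) _ (synth hL v)) k = _
  rw [h1, map_smul, ← analysis_synth_apply hL]
  rfl

theorem deriv_eq_zero_of_statMap_eq (hU : ContDiff ℝ 2 U) {w : EllTwo}
    (h : ∀ k, k ≠ 0 → w k = 0) (hw : statMap hU hL w = w) :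
    deriv U (w 0 * amp L 0) = 0 := by
  set c := w 0 * amp L 0 with hc
  have hamp := amp_pos hL 0
  have h1 : mode L 0 * nemytskii (fun u => u - deriv U u) (contDiff_sub_deriv hU).continuous
      (synth hL w) = (c - deriv U c) • cosFun 0 * mode L 0 := by
    ext x
    simp only [BoundedContinuousFunction.mul_apply, nemytskii_apply, synth_apply_of_forall hL h,
      ← hc, cosFun_zero, BoundedContinuousFunction.smul_apply, smul_eq_mul]
    simp [mul_comm]
  have h2 : integralFunctional L (mode L 0 * nemytskii (fun u => u - deriv U u)
      (contDiff_sub_deriv hU).continuous (synth hL w)) = w 0 := by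
    have : statMap hU hL w 0 = w 0 := by rw [hw]
    exact this
  have h3 : amp L 0 ^ 2 = 1 / L := by
    rw [amp_sq hL]; simp [mult, lam]
  rw [h1, integralFunctional_apply] at h2
  simp only [BoundedContinuousFunction.mul_apply, mode_zero_apply, cosFun_apply,
    BoundedContinuousFunction.smul_apply, smul_eq_mul, Nat.cast_zero, zero_mul, cos_zero,
    mul_one, intervalIntegral.integral_const, sub_zero] at h2
  have h4 : L * amp L 0 ^ 2 * (c - deriv U c) = c := by
    linear_combination amp L 0 * h2 - hc
  rw [h3, mul_one_div_cancel hL.ne', one_mul] at h4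
  linarith

include hU in
-- The point is constant by `hnonconst`, and a kernel vector with a nonzero mode `n` forces `U''(c)
-- = -lam L n ≤ 0`. Positivity of `U''` at the wells leaves `c = 0`, hence `lam L n = 1` and `L = n
-- π`. The bifurcation estimate then isolates `0` among fixed points and Galerkin solutions alike.
theorem exists_isolating_radius
    (hnonconst : ∀ z : sobolevSpace .neumann,
      IsCriticalPoint (fullPotential U L .neumann) z → (∃ k : ℤ, k ≠ 0 ∧ (z : ℤ → ℂ) k ≠ 0) →
      IsNondegenerate (fullPotential U L .neumann) z)
    (hbif : (∃ n : ℕ, L = n * Real.pi) →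
      ContDiff ℝ 4 U ∧ iteratedDeriv 4 U 0 ≠ -(5 / 3) * (iteratedDeriv 3 U 0) ^ 2)
    (w : EllTwo) (hw : statMap hU.contDiff_two hL w = w)
    (hdeg : ¬ IsGalerkinNondegenerate (statDeriv hU.contDiff_two hL w) ⊤) :
    ∃ r > 0, (∀ x ∈ Metric.closedBall w r, statMap hU.contDiff_two hL x = x → x = w) ∧
      ∃ d₀, ∀ d ≥ d₀, ∀ x ∈ Metric.closedBall w r,
        IsGalerkinSolution (statMap hU.contDiff_two hL) (EllTwo.firstModes d) x →
        ¬ IsGalerkinNondegenerate (statDeriv hU.contDiff_two hL x) (EllTwo.firstModes d) := by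
  have hconst : ∀ k, k ≠ 0 → w k = 0 := by
    intro k hk
    by_contra hne
    have hcrit : IsCriticalPoint (fullPotential U L .neumann) (sobolevEquiv hL w) :=
      (isCriticalPoint_iff_fixMap hU.contDiff_two hL le_rfl id (sobolevEquiv hL)
        (fun x => sobolevEquiv_apply hL x) w).2 fun h => by
          change inner ℝ (w - statMap hU.contDiff_two hL w) h = 0
          rw [hw, sub_self, inner_zero_left]
    have hnd := hnonconst _ hcrit ⟨k, by exact_mod_cast hk, by
      rw [sobolevEquiv_apply, toCoeff, Int.natAbs_natCast]
      exact_mod_cast mul_ne_zero (coef_pos L k).ne' hne⟩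
    have hnd' := (isNondegenerate_iff_fixDeriv hU.contDiff_two hL le_rfl id (sobolevEquiv hL)
      (fun x => sobolevEquiv_apply hL x) w).1 hnd
    exact hdeg fun v _ hv => hnd' v fun h => hv h trivial
  set c := w 0 * amp L 0 with hc
  have hUc := deriv_eq_zero_of_statMap_eq hL hU.contDiff_two hconst hw
  obtain ⟨v, hv, hv0⟩ : ∃ v, statDeriv hU.contDiff_two hL w v = v ∧ v ≠ 0 := by
    by_contra! h
    exact hdeg (isGalerkinNondegenerate_top_iff.2 h)
  obtain ⟨n, hn⟩ : ∃ n, v n ≠ 0 := by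
    by_contra! h
    exact hv0 (lp.ext (funext h))
  have h1 := statDeriv_apply_of_forall hL hU.contDiff_two (synth_apply_of_forall hL hconst) v n
  rw [hv, ← hc] at h1
  have hlam := one_add_lam_pos L n
  have h2 : deriv (deriv U) c = - lam L n := by
    field_simp at h1
    linarith
  have hc0 : c = 0 := by
    by_contra hc0
    have := hU.deriv_deriv_pos hUc hc0
    linarith [lam_nonneg L n]
  have hw0 : w = 0 := by
    refine lp.ext (funext fun k => ?_)
    by_cases hk : k = 0
    · subst hk
      exact (mul_eq_zero.1 hc0).resolve_right (amp_pos hL 0).ne'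
    · exact hconst k hk
  rw [hc0, hU.deriv_deriv_zero] at h2
  have hlam1 : lam L n = 1 := by linarith
  have hLn : L = n * π := by
    rw [lam, div_eq_one_iff_eq (by positivity)] at hlam1
    have := (pow_left_inj₀ (by positivity) hL.le two_ne_zero).1 hlam1
    rw [← this, mul_comm]
  have hn0 : n ≠ 0 := by
    rintro rfl
    simp at hLn
    exact hL.ne' hLn
  obtain ⟨hU4, hne⟩ := hbif ⟨n, hLn⟩
  obtain ⟨ρ, hρ, hiso⟩ := exists_forall_eq_zero_of_bifurcation hU hL hLn hU4 hne hn0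
  subst hw0
  -- From `d = 2 * n` on, the truncated equations include the modes `0`, `n` and `2 n` used by the
  -- estimate.
  refine ⟨ρ, hρ, fun x hx hxs => ?_, 2 * n, fun d hd x hx hxs hnd => ?_⟩
  · rw [mem_closedBall_zero_iff] at hx
    exact hiso x hx (fun k => Or.inr (by rw [hxs])) fun j _ => by rw [hxs]
  · rw [mem_closedBall_zero_iff] at hx
    have hcoord : ∀ k ≤ d, x k = statMap hU.contDiff_two hL x k := fun k hk => by
      have := hxs.2 _ (EllTwo.single_mem_firstModes hk 1)
      rw [real_inner_comm, EllTwo.inner_single_left, one_mul] at this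
      exact sub_eq_zero.1 this
    have hx0 : x = 0 := by
      refine hiso x hx (fun k => ?_) fun j hj => hcoord _ ?_
      · rcases le_or_gt k d with hk | hk
        · exact Or.inr (hcoord k hk)
        · exact Or.inl (hxs.1 k hk)
      · calc j * n ≤ 2 * n := Nat.mul_le_mul_right n hj
          _ ≤ d := hd
    subst hx0
    -- The resonant mode belongs to the truncated space and lies in the kernel, so `0` is degenerate
    -- there as well.
    have hker : statDeriv hU.contDiff_two hL 0 (lp.single 2 n (1 : ℝ) : EllTwo) =
        lp.single 2 n (1 : ℝ) := by
      refine lp.ext (funext fun k => ?_)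
      rw [statDeriv_apply_of_forall hL hU.contDiff_two (c := 0) (fun x => by simp),
        hU.deriv_deriv_zero]
      by_cases hk : k = n
      · subst hk
        rw [hlam1]
        norm_num
      · rw [lp.single_apply_ne _ _ _ hk, mul_zero, mul_zero]
    have h3 := hnd _ (EllTwo.single_mem_firstModes (by omega : n ≤ d) 1) fun h _ => by
      rw [hker, sub_self, inner_zero_left]
    have h4 : (lp.single 2 n (1 : ℝ) : EllTwo) n = (0 : EllTwo) n := by rw [h3]
    simp at h4

end Neumann

/-! ### Fourier series on the circle -/

namespace Periodic

open Real

/-- The Fourier modes on the circle of length `L`. -/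
def mode (L : ℝ) (k : ℤ) (x : ℝ) : ℂ :=
  Complex.exp (Complex.I * (2 * k * π * x / L : ℝ)) / (√L : ℝ)

variable {L : ℝ}

theorem fourierTerm_eq (z : ℤ → ℂ) (x : ℝ) (k : ℤ) :
    fourierTerm .periodic L z x k = z k * mode L k x := rfl

theorem continuous_mode (k : ℤ) : Continuous (mode L k) := by
  unfold mode; fun_prop

theorem norm_mode (k : ℤ) (x : ℝ) : ‖mode L k x‖ = (√L)⁻¹ := by
  rw [mode, norm_div, mul_comm Complex.I, Complex.norm_exp_ofReal_mul_I,
    Complex.norm_real, Real.norm_eq_abs, abs_of_nonneg (Real.sqrt_nonneg L), one_div]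

theorem conj_mode (k : ℤ) (x : ℝ) : starRingEnd ℂ (mode L k x) = mode L (-k) x := by
  rw [mode, mode, map_div₀, ← Complex.exp_conj, map_mul, Complex.conj_I, Complex.conj_ofReal,
    Complex.conj_ofReal]
  congr 2
  push_cast
  ring

theorem mode_zero (x : ℝ) : mode L 0 x = ((√L)⁻¹ : ℝ) := by
  simp [mode]

theorem mode_apply_length (hL : 0 < L) (k : ℤ) : mode L k L = mode L k 0 := by
  have h : Complex.I * ((2 * k * π * L / L : ℝ) : ℂ) = k * (2 * π * Complex.I) := by
    rw [mul_div_cancel_right₀ _ hL.ne']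
    push_cast
    ring
  rw [mode, mode, h, Complex.exp_int_mul_two_pi_mul_I]
  simp

/-- The frequency of the `k`-th mode. -/
def freq (L : ℝ) (k : ℤ) : ℝ := 2 * k * π / L

theorem hasDerivAt_mode (k : ℤ) (x : ℝ) :
    HasDerivAt (mode L k) (Complex.I * freq L k * mode L k x) x := by
  have h1 : HasDerivAt (fun x : ℝ => Complex.I * ((2 * k * π * x / L : ℝ) : ℂ))
      (Complex.I * freq L k) x := by
    have h2 : HasDerivAt (fun x : ℝ => 2 * k * π * x / L) (freq L k) x := by
      simpa [freq] using ((hasDerivAt_id x).const_mul (2 * k * π)).div_const L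
    exact (h2.ofReal_comp).const_mul Complex.I
  refine (h1.cexp.div_const _).congr_deriv ?_
  rw [mode]
  ring

theorem waveSq_eq (k : ℤ) : waveSq .periodic L k = freq L k ^ 2 := by
  unfold waveSq freq BoundaryCondition.factor
  ring

theorem integral_mode_mul_mode (hL : 0 < L) (j k : ℤ) :
    ∫ x in (0 : ℝ)..L, mode L j x * mode L (-k) x = if j = k then 1 else 0 := by
  have hL' : (L : ℂ) ≠ 0 := by exact_mod_cast hL.ne'
  have hs : ((√L : ℝ) : ℂ) * ((√L : ℝ) : ℂ) = L := by
    rw [← Complex.ofReal_mul, mul_self_sqrt hL.le]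
  have h1 : ∀ x : ℝ, mode L j x * mode L (-k) x =
      (L : ℂ)⁻¹ * Complex.exp ((2 * ((j - k : ℤ) : ℂ) * π * Complex.I / L) * x) := by
    intro x
    rw [mode, mode, div_mul_div_comm, ← Complex.exp_add, hs, div_eq_inv_mul]
    congr 2
    push_cast
    field_simp
    ring
  simp only [h1]
  rw [intervalIntegral.integral_const_mul]
  split_ifs with hjk
  · subst hjk
    simp [hL']
  · have hc : (2 * ((j - k : ℤ) : ℂ) * π * Complex.I / L) ≠ 0 := by
      have h2 : ((j - k : ℤ) : ℂ) ≠ 0 := Int.cast_ne_zero.2 (sub_ne_zero.2 hjk)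
      have h3 : (π : ℂ) ≠ 0 := by exact_mod_cast pi_ne_zero
      exact div_ne_zero (mul_ne_zero (mul_ne_zero (mul_ne_zero two_ne_zero h2) h3)
        Complex.I_ne_zero) hL'
    rw [integral_exp_mul_complex hc]
    have h2 : (2 * ((j - k : ℤ) : ℂ) * π * Complex.I / L) * (L : ℝ) =
        ((j - k : ℤ) : ℂ) * (2 * π * Complex.I) := by
      field_simp
    rw [h2, Complex.exp_int_mul_two_pi_mul_I]
    simp

variable {z : ℤ → ℂ}

theorem ofReal_fourierSum (hz : z ∈ sobolevSpace .periodic) (x : ℝ) :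
    (fourierSum .periodic L z x : ℂ) = ∑' k, z k * mode L k x := by
  rw [fourierSum_eq]
  change ((∑' k, z k * mode L k x).re : ℂ) = _
  rw [← Complex.conj_eq_iff_re, Complex.conj_tsum, ← (Equiv.neg ℤ).tsum_eq]
  refine tsum_congr fun k => ?_
  rw [Equiv.neg_apply, hz.1, map_mul, Complex.conj_conj, conj_mode, neg_neg]

theorem hasSum_integral_mul_fourierSum (hz : z ∈ sobolevSpace .periodic) {g : ℝ → ℂ}
    (hg : Continuous g) :
    HasSum (fun k => ∫ x in (0 : ℝ)..L, g x * (z k * mode L k x))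
      (∫ x in (0 : ℝ)..L, g x * (fourierSum .periodic L z x : ℂ)) := by
  obtain ⟨C, hC⟩ := (isCompact_uIcc (a := (0 : ℝ)) (b := L)).exists_bound_of_continuousOn
    hg.continuousOn
  have hs : Summable fun k => C * (‖z k‖ * (√L)⁻¹) :=
    ((summable_norm_of_mem_sobolevSpace hz).mul_right _).mul_left C
  refine intervalIntegral.hasSum_integral_of_dominated_convergence
    (fun k _ => C * (‖z k‖ * (√L)⁻¹)) (fun k => ?_) (fun k => ?_) ?_ ?_ ?_
  · exact (hg.mul (continuous_const.mul (continuous_mode k))).aestronglyMeasurable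
  · refine Filter.Eventually.of_forall fun x hx => ?_
    rw [norm_mul, norm_mul, norm_mode]
    have := hC x (Set.uIoc_subset_uIcc hx)
    gcongr
  · exact Filter.Eventually.of_forall fun x _ => hs
  · exact continuous_const.intervalIntegrable _ _
  · refine Filter.Eventually.of_forall fun x _ => ?_
    rw [ofReal_fourierSum hz]
    exact (summable_fourierTerm L hz x).hasSum.mul_left _

/-- The Fourier coefficients of a function. -/
def coefficient (L : ℝ) (g : ℝ → ℝ) (k : ℤ) : ℂ :=
  ∫ x in (0 : ℝ)..L, (g x : ℂ) * mode L (-k) x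

theorem coefficient_neg (g : ℝ → ℝ) (k : ℤ) :
    coefficient L g (-k) = starRingEnd ℂ (coefficient L g k) := by
  unfold coefficient
  rw [← intervalIntegral.intervalIntegral_conj]
  simp only [map_mul, Complex.conj_ofReal, conj_mode]

theorem coefficient_mul_fourierSum (hL : 0 < L) (hz : z ∈ sobolevSpace .periodic) (c : ℝ) (k : ℤ) :
    coefficient L (fun x => c * fourierSum .periodic L z x) k = c * z k := by
  have h1 := hasSum_integral_mul_fourierSum (L := L) hz (g := fun x => c * mode L (-k) x)
    (continuous_const.mul (continuous_mode _))
  have h2 : coefficient L (fun x => c * fourierSum .periodic L z x) k =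
      ∫ x in (0 : ℝ)..L, c * mode L (-k) x * (fourierSum .periodic L z x : ℂ) := by
    unfold coefficient
    congr 1
    funext x
    push_cast
    ring
  rw [h2]
  refine h1.unique ?_
  have h3 : ∀ j, ∫ x in (0 : ℝ)..L, c * mode L (-k) x * (z j * mode L j x) =
      if j = k then c * z k else 0 := by
    intro j
    have h4 : ∀ x, c * mode L (-k) x * (z j * mode L j x) =
        (c * z j) * (mode L j x * mode L (-k) x) := fun x => by ring
    simp only [h4]
    rw [intervalIntegral.integral_const_mul, integral_mode_mul_mode hL]
    split_ifs with h
    · rw [h, mul_one]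
    · rw [mul_zero]
  simp only [h3]
  exact hasSum_ite_eq k _

theorem hasSum_coefficient_mul_conj (hz : z ∈ sobolevSpace .periodic) {g : ℝ → ℝ}
    (hg : Continuous g) :
    HasSum (fun k => (coefficient L g k * starRingEnd ℂ (z k)).re)
      (∫ x in (0 : ℝ)..L, g x * fourierSum .periodic L z x) := by
  have h1 := Complex.hasSum_re
    (hasSum_integral_mul_fourierSum (L := L) hz (Complex.continuous_ofReal.comp hg))
  have h2 : (∫ x in (0 : ℝ)..L, ((fun x : ℝ => (x : ℂ)) ∘ g) x *
      (fourierSum .periodic L z x : ℂ)).re =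
      ∫ x in (0 : ℝ)..L, g x * fourierSum .periodic L z x := by
    simp only [Function.comp_apply, ← Complex.ofReal_mul]
    rw [intervalIntegral.integral_ofReal, Complex.ofReal_re]
  rw [h2] at h1
  refine h1.congr_fun ?_
  intro k
  have h3 : ∫ x in (0 : ℝ)..L, ((fun x : ℝ => (x : ℂ)) ∘ g) x * (z k * mode L k x) =
      starRingEnd ℂ (coefficient L g k * starRingEnd ℂ (z k)) := by
    rw [map_mul, Complex.conj_conj, ← coefficient_neg, coefficient, neg_neg, mul_comm,
      ← intervalIntegral.integral_const_mul]
    congr 1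
    funext x
    simp only [Function.comp_apply]
    ring
  rw [h3, Complex.conj_re]

/-- Parseval's identity: up to the factor `√L` these are the coefficients `fourierCoeffOn`. -/
theorem summable_norm_sq_coefficient (hL : 0 < L) {g : ℝ → ℝ} (hg : Continuous g) :
    Summable fun k => ‖coefficient L g k‖ ^ 2 := by
  have hmem : MeasureTheory.MemLp (fun x => (g x : ℂ)) 2
      (MeasureTheory.volume.restrict (Set.Ioc 0 L)) := by
    obtain ⟨C, hC⟩ := (isCompact_Icc (a := (0 : ℝ)) (b := L)).exists_bound_of_continuousOn
      hg.continuousOn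
    refine MeasureTheory.MemLp.of_bound
      (Complex.continuous_ofReal.comp hg).aestronglyMeasurable C ?_
    refine (MeasureTheory.ae_restrict_iff' measurableSet_Ioc).2
      (Filter.Eventually.of_forall fun x hx => ?_)
    rw [Complex.norm_real]
    exact hC x (Set.Ioc_subset_Icc_self hx)
  have h1 := ((hasSum_sq_fourierCoeffOn hL hmem).mul_left L).summable
  refine h1.congr fun k => ?_
  have h2 : coefficient L g k = (√L : ℝ) * fourierCoeffOn hL (fun x => (g x : ℂ)) k := by
    rw [fourierCoeffOn_eq_integral, coefficient]
    have h3 : ∀ x : ℝ, (g x : ℂ) * mode L (-k) x =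
        ((√L : ℝ) : ℂ)⁻¹ * (fourier (-k) (x : AddCircle (L - 0)) • (g x : ℂ)) := by
      intro x
      rw [fourier_coe_apply, mode, smul_eq_mul, div_eq_inv_mul]
      have : Complex.I * ((2 * ((-k : ℤ) : ℝ) * π * x / L : ℝ) : ℂ) =
          2 * π * Complex.I * ((-k : ℤ) : ℂ) * x / ((L - 0 : ℝ) : ℂ) := by
        push_cast
        rw [sub_zero]
        ring
      rw [this]
      ring
    simp only [h3]
    rw [intervalIntegral.integral_const_mul]
    rw [Complex.real_smul, ← mul_assoc]
    congr 1
    rw [← Complex.ofReal_inv, ← Complex.ofReal_mul]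
    congr 1
    rw [sub_zero, mul_one_div, sqrt_div_self', one_div]
  rw [h2, norm_mul, mul_pow, Complex.norm_real, Real.norm_eq_abs, sq_abs, sq_sqrt hL.le]

end Periodic

/-! ### Critical points mode by mode, and translation invariance -/

namespace Periodic

open Real

/-- `W` consists of the periodic functions with modes in the symmetric set `S ∋ 0`. -/
structure IsModeSpace (W : Submodule ℝ (ℤ → ℂ)) (S : Set ℤ) : Prop where
  mem_iff : ∀ z, z ∈ W ↔ z ∈ sobolevSpace .periodic ∧ ∀ k ∉ S, z k = 0
  zero_mem : 0 ∈ S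
  neg_mem : ∀ k ∈ S, -k ∈ S

theorem isModeSpace_sobolevSpace : IsModeSpace (sobolevSpace .periodic) Set.univ :=
  ⟨fun z => by simp, trivial, fun _ _ => trivial⟩

theorem isModeSpace_truncatedSpace (d : ℕ) :
    IsModeSpace (truncatedSpace .periodic d) {k | |k| ≤ d} :=
  ⟨fun z => and_congr_right fun _ => forall_congr' fun k => by simp, by simp, fun k hk => by
    simpa using hk⟩

/-- The real function with a single pair of modes. -/
def pair (k : ℤ) (ξ : ℂ) : ℤ → ℂ := Pi.single k ξ + Pi.single (-k) (starRingEnd ℂ ξ)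

theorem pair_apply_of_ne {j k : ℤ} (h1 : j ≠ k) (h2 : j ≠ -k) (ξ : ℂ) : pair k ξ j = 0 := by
  simp [pair, h1, h2]

theorem pair_mem (k : ℤ) (ξ : ℂ) : pair k ξ ∈ sobolevSpace .periodic := by
  refine ⟨fun j => ?_, fun h => absurd h (by simp), ?_⟩
  · simp only [pair, Pi.add_apply, Pi.single_apply, map_add]
    have h1 : -j = k ↔ j = -k := by omega
    have h2 : -j = -k ↔ j = k := by omega
    simp only [h1, h2]
    rw [add_comm]
    congr 1 <;> split_ifs <;> simp
  · refine summable_of_ne_finset_zero (s := {k, -k}) fun j hj => ?_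
    simp only [Finset.mem_insert, Finset.mem_singleton, not_or] at hj
    rw [pair_apply_of_ne hj.1 hj.2]
    simp

theorem pair_one_ne_zero (k : ℤ) : pair k 1 k ≠ 0 := by
  simp only [pair, Pi.add_apply, Pi.single_apply, map_one]
  split_ifs <;> norm_num

theorem tsum_mul_conj_pair {a : ℤ → ℂ} (ha : ∀ k, a (-k) = starRingEnd ℂ (a k)) (k : ℤ) (ξ : ℂ) :
    ∑' j, (a j * starRingEnd ℂ (pair k ξ j)).re = 2 * (a k * starRingEnd ℂ ξ).re := by
  have h1 : ∀ (m : ℤ) (η : ℂ), HasSum (fun j => (a j * starRingEnd ℂ ((Pi.single m η : ℤ → ℂ) j)).re)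
      (a m * starRingEnd ℂ η).re := by
    intro m η
    convert hasSum_single m fun j hj => ?_ using 1
    · simp
    · simp [hj]
  have h2 := (h1 k ξ).add (h1 (-k) (starRingEnd ℂ ξ))
  have h3 : (a (-k) * starRingEnd ℂ (starRingEnd ℂ ξ)).re = (a k * starRingEnd ℂ ξ).re := by
    rw [ha, ← map_mul, Complex.conj_re]
  rw [h3] at h2
  rw [two_mul, ← h2.tsum_eq]
  refine tsum_congr fun j => ?_
  rw [pair, Pi.add_apply, map_add, mul_add, Complex.add_re]

variable {W : Submodule ℝ (ℤ → ℂ)} {S : Set ℤ} {L : ℝ} {U : ℝ → ℝ}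

namespace IsModeSpace

theorem le (hW : IsModeSpace W S) : W ≤ sobolevSpace .periodic := fun _ hz =>
  ((hW.mem_iff _).1 hz).1

theorem pair_mem (hW : IsModeSpace W S) {k : ℤ} (hk : k ∈ S) (ξ : ℂ) : pair k ξ ∈ W := by
  refine (hW.mem_iff _).2 ⟨Periodic.pair_mem k ξ, fun j hj => pair_apply_of_ne ?_ ?_ ξ⟩
  · rintro rfl; exact hj hk
  · rintro rfl; exact hj (hW.neg_mem k hk)

/-- The test element is the pair of modes `±k` with coefficient `a k`, which yields `2 ‖a k‖²`; for
`k ≠ 0` a single mode would not be a real function. -/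
theorem forall_tsum_eq_zero_iff (hW : IsModeSpace W S) {a : ℤ → ℂ}
    (ha : ∀ k, a (-k) = starRingEnd ℂ (a k)) :
    (∀ h : W, ∑' k, (a k * starRingEnd ℂ ((h : ℤ → ℂ) k)).re = 0) ↔ ∀ k ∈ S, a k = 0 := by
  constructor
  · intro h k hk
    have h1 := h ⟨pair k (a k), hW.pair_mem hk _⟩
    rw [tsum_mul_conj_pair ha, Complex.mul_conj, Complex.ofReal_re] at h1
    exact Complex.normSq_eq_zero.1 (by linarith)
  · intro h w
    refine (tsum_congr fun k => ?_).trans tsum_zero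
    by_cases hk : k ∈ S
    · rw [h k hk, zero_mul, Complex.zero_re]
    · rw [((hW.mem_iff _).1 w.2).2 k hk, map_zero, mul_zero, Complex.zero_re]

theorem isCriticalPoint_iff (hW : IsModeSpace W S) (hU : ContDiff ℝ 1 U) (z : W) :
    IsCriticalPoint (fun y : W => potentialEnergy U L .periodic y) z ↔ ∀ k ∈ S,
      waveSq .periodic L k * (z : ℤ → ℂ) k +
        coefficient L (fun x => deriv U (fourierSum .periodic L z x)) k = 0 := by
  rw [isCriticalPoint_potentialEnergy_iff hU L hW.le, ← hW.forall_tsum_eq_zero_iff]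
  · refine forall_congr' fun h => ?_
    have h1 := (summable_gradForm L (hW.le z.2) (hW.le h.2)).hasSum.add
      (hasSum_coefficient_mul_conj (L := L) (hW.le h.2)
        ((hU.continuous_deriv le_rfl).comp (continuous_fourierSum L (hW.le z.2))))
    have h2 := h1.tsum_eq
    unfold gradForm
    simp only [Function.comp_def] at h2
    rw [← h2]
    refine Eq.congr (tsum_congr fun k => ?_) rfl
    rw [add_mul, Complex.add_re, mul_assoc, Complex.re_ofReal_mul]
  · intro k
    rw [coefficient_neg, map_add, map_mul, Complex.conj_ofReal, (hW.le z.2).1, waveSq, waveSq]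
    push_cast
    ring

theorem isHessianEigen_iff (hW : IsModeSpace W S) (hU : ContDiff ℝ 2 U) (z v : W) (μ : ℝ) :
    IsHessianEigen (fun y : W => potentialEnergy U L .periodic y) z μ v ↔ ∀ k ∈ S,
      waveSq .periodic L k * (v : ℤ → ℂ) k + coefficient L (fun x =>
        deriv (deriv U) (fourierSum .periodic L z x) * fourierSum .periodic L v x) k -
        μ * (v : ℤ → ℂ) k = 0 := by
  have hc : Continuous (deriv (deriv U)) :=
    (Neumann.contDiff_deriv hU).continuous_deriv le_rfl
  unfold IsHessianEigen
  rw [← hW.forall_tsum_eq_zero_iff]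
  · refine forall_congr' fun h => ?_
    have hl : Summable fun k => ((v : ℤ → ℂ) k * starRingEnd ℂ ((h : ℤ → ℂ) k)).re := by
      refine Summable.of_norm_bounded ((hW.le v.2).2.2.add (hW.le h.2).2.2) fun k => ?_
      refine (Complex.abs_re_le_norm _).trans ?_
      rw [norm_mul, Complex.norm_conj]
      have h3 : 0 ≤ (k : ℝ) ^ 2 * (‖(v : ℤ → ℂ) k‖ ^ 2 + ‖(h : ℤ → ℂ) k‖ ^ 2) := by positivity
      nlinarith [sq_nonneg (‖(v : ℤ → ℂ) k‖ - ‖(h : ℤ → ℂ) k‖),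
        sq_nonneg ‖(v : ℤ → ℂ) k‖, sq_nonneg ‖(h : ℤ → ℂ) k‖]
    have h1 := ((summable_gradForm L (hW.le v.2) (hW.le h.2)).hasSum.add
      (hasSum_coefficient_mul_conj (L := L) (hW.le h.2)
        ((hc.comp (continuous_fourierSum L (hW.le z.2))).mul
          (continuous_fourierSum L (hW.le v.2))))).sub (hl.hasSum.mul_left μ)
    have h2 := h1.tsum_eq
    rw [hessianForm_potentialEnergy hU L hW.le, ← sub_eq_zero]
    unfold gradForm ellTwoInner
    simp only [Function.comp_def, Pi.mul_def] at h2
    rw [← h2]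
    refine Eq.congr (tsum_congr fun k => ?_) rfl
    rw [sub_mul, add_mul, Complex.sub_re, Complex.add_re, mul_assoc, mul_assoc,
      Complex.re_ofReal_mul, Complex.re_ofReal_mul]
  · intro k
    rw [coefficient_neg, map_sub, map_add, map_mul, map_mul, Complex.conj_ofReal,
      Complex.conj_ofReal, (hW.le v.2).1, waveSq, waveSq]
    push_cast
    ring

end IsModeSpace

/-- The Fourier coefficients of the derivative. -/
def derivCoeff (L : ℝ) (z : ℤ → ℂ) (k : ℤ) : ℂ := Complex.I * freq L k * z k

theorem hasDerivAt_fourierSum {z : ℤ → ℂ} (hz : z ∈ sobolevSpace .periodic)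
    (hz' : derivCoeff L z ∈ sobolevSpace .periodic) (x : ℝ) :
    HasDerivAt (fourierSum .periodic L z) (fourierSum .periodic L (derivCoeff L z) x) x := by
  have h1 := hasDerivAt_tsum (𝕜 := ℝ) (g := fun k x => z k * mode L k x)
    (g' := fun k x => derivCoeff L z k * mode L k x) (y₀ := x)
    ((summable_norm_of_mem_sobolevSpace hz').mul_right (√L)⁻¹)
    (fun k y => ((hasDerivAt_mode k y).const_mul (z k)).congr_deriv (by
      rw [derivCoeff]; ring))
    (fun k y => by rw [norm_mul, norm_mode]) (summable_fourierTerm L hz x) x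
  exact Complex.reCLM.hasFDerivAt.comp_hasDerivAt x h1

theorem fourierSum_length (hL : 0 < L) (z : ℤ → ℂ) :
    fourierSum .periodic L z L = fourierSum .periodic L z 0 := by
  rw [fourierSum_eq, fourierSum_eq]
  congr 1
  refine tsum_congr fun k => ?_
  rw [fourierTerm_eq, fourierTerm_eq, mode_apply_length hL]

theorem coefficient_deriv (hL : 0 < L) {g g' : ℝ → ℝ} (hg : ∀ x, HasDerivAt g (g' x) x)
    (hg' : Continuous g') (hper : g L = g 0) (k : ℤ) :
    coefficient L g' k = Complex.I * freq L k * coefficient L g k := by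
  have h1 := intervalIntegral.integral_mul_deriv_eq_deriv_mul (a := 0) (b := L)
    (u := mode L (-k)) (u' := fun x => Complex.I * freq L (-k) * mode L (-k) x)
    (v := fun x => (g x : ℂ)) (v' := fun x => (g' x : ℂ))
    (fun x _ => hasDerivAt_mode _ x) (fun x _ => (hg x).ofReal_comp)
    ((continuous_const.mul (continuous_mode _)).intervalIntegrable _ _)
    ((Complex.continuous_ofReal.comp hg').intervalIntegrable _ _)
  rw [mode_apply_length hL, hper, sub_self, zero_sub] at h1
  have h2 : coefficient L g' k = ∫ x in (0 : ℝ)..L, mode L (-k) x * (g' x : ℂ) := by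
    unfold coefficient
    simp only [mul_comm]
  have h3 : ∀ x, Complex.I * freq L (-k) * mode L (-k) x * (g x : ℂ) =
      -(Complex.I * freq L k) * ((g x : ℂ) * mode L (-k) x) := fun x => by
    have : freq L (-k) = - freq L k := by unfold freq; push_cast; ring
    rw [this]
    push_cast
    ring
  rw [h2, h1]
  simp only [h3]
  rw [intervalIntegral.integral_const_mul, coefficient, neg_mul, neg_neg]

theorem freq_sq (L : ℝ) (k : ℤ) : freq L k ^ 2 = (2 * π / L) ^ 2 * (k : ℝ) ^ 2 := by
  unfold freq; ring

/-- Elliptic regularity: on `S` the equation identifies `waveSq k * z k` with minus a coefficient of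
the continuous function `U'(u)`, so `k² z k` is square summable and `u'` is again in `H¹`. -/
theorem IsModeSpace.derivCoeff_mem (hW : IsModeSpace W S) (hL : 0 < L) (hU : ContDiff ℝ 1 U)
    (z : W) (hz : IsCriticalPoint (fun y : W => potentialEnergy U L .periodic y) z) :
    derivCoeff L z ∈ W := by
  have hzs := hW.le z.2
  rw [hW.isCriticalPoint_iff hU] at hz
  refine (hW.mem_iff _).2 ⟨⟨fun k => ?_, fun h => absurd h (by simp), ?_⟩, fun k hk => ?_⟩
  · have : freq L (-k) = - freq L k := by unfold freq; push_cast; ring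
    rw [derivCoeff, derivCoeff, this, map_mul, map_mul, Complex.conj_I, Complex.conj_ofReal,
      hzs.1]
    push_cast
    ring
  · have hs := summable_norm_sq_coefficient hL ((hU.continuous_deriv le_rfl).comp
      (continuous_fourierSum L hzs))
    have hq : 0 < (2 * π / L) ^ 2 := by positivity
    refine Summable.of_nonneg_of_le (fun k => by positivity) (fun k => ?_)
      ((hzs.2.2.mul_left ((2 * π / L) ^ 2)).add (hs.mul_left ((2 * π / L) ^ 2)⁻¹))
    have hterm : ‖derivCoeff L z k‖ ^ 2 = (2 * π / L) ^ 2 * (k : ℝ) ^ 2 * ‖(z : ℤ → ℂ) k‖ ^ 2 := by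
      rw [derivCoeff, norm_mul, norm_mul, Complex.norm_I, one_mul, mul_pow, Complex.norm_real,
        Real.norm_eq_abs, sq_abs, freq_sq]
    have hck : ((2 * π / L) ^ 2 * (k : ℝ) ^ 2) ^ 2 * ‖(z : ℤ → ℂ) k‖ ^ 2 ≤
        ‖coefficient L (deriv U ∘ fourierSum .periodic L z) k‖ ^ 2 := by
      by_cases hk : k ∈ S
      · have h1 := eq_neg_of_add_eq_zero_right (hz k hk)
        change coefficient L (deriv U ∘ fourierSum .periodic L z) k = _ at h1
        rw [h1, norm_neg, norm_mul, Complex.norm_real, Real.norm_eq_abs, mul_pow |_|, sq_abs,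
          waveSq_eq, freq_sq]
      · rw [((hW.mem_iff _).1 z.2).2 k hk]
        simp
    set q := (2 * π / L) ^ 2
    set N := ‖(z : ℤ → ℂ) k‖ ^ 2
    have h2 : q⁻¹ * ((q * (k : ℝ) ^ 2) ^ 2 * N) = q * (k : ℝ) ^ 2 * (k : ℝ) ^ 2 * N := by
      field_simp
    rw [hterm]
    have h3 : 0 ≤ q * N := by positivity
    calc (1 + (k : ℝ) ^ 2) * (q * (k : ℝ) ^ 2 * N)
        = q * (k : ℝ) ^ 2 * N + q⁻¹ * ((q * (k : ℝ) ^ 2) ^ 2 * N) := by rw [h2]; ring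
      _ ≤ q * ((1 + (k : ℝ) ^ 2) * N) +
          q⁻¹ * ‖coefficient L (deriv U ∘ fourierSum .periodic L z) k‖ ^ 2 := by
        refine add_le_add ?_ (by gcongr)
        linarith
  · rw [derivCoeff, ((hW.mem_iff _).1 z.2).2 k hk, mul_zero]

/-- Nonconstant critical points are degenerate, by translation invariance. -/
theorem IsModeSpace.apply_eq_zero_of_isNondegenerate (hW : IsModeSpace W S) (hL : 0 < L)
    (hU : ContDiff ℝ 2 U) (z : W)
    (hz : IsCriticalPoint (fun y : W => potentialEnergy U L .periodic y) z)
    (hnd : IsNondegenerate (fun y : W => potentialEnergy U L .periodic y) z) {k : ℤ}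
    (hk : k ≠ 0) : (z : ℤ → ℂ) k = 0 := by
  have hU1 : ContDiff ℝ 1 U := hU.of_le one_le_two
  have hmem := hW.derivCoeff_mem hL hU1 z hz
  have hzs := hW.le z.2
  have hU' := Neumann.contDiff_deriv hU
  have h1 : IsHessianEigen (fun y : W => potentialEnergy U L .periodic y) z 0
      ⟨derivCoeff L z, hmem⟩ := by
    rw [hW.isHessianEigen_iff hU]
    intro j hj
    have h2 := coefficient_deriv hL (g := fun x => deriv U (fourierSum .periodic L z x))
      (g' := fun x => deriv (deriv U) (fourierSum .periodic L z x) *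
        fourierSum .periodic L (derivCoeff L z) x)
      (fun x => ((hU'.differentiable one_ne_zero _).hasDerivAt).comp x
        (hasDerivAt_fourierSum hzs (hW.le hmem) x))
      (((hU'.continuous_deriv le_rfl).comp (continuous_fourierSum L hzs)).mul
        (continuous_fourierSum L (hW.le hmem)))
      (by rw [fourierSum_length hL]) j
    have h3 := (hW.isCriticalPoint_iff hU1 z).1 hz j hj
    dsimp only
    rw [h2, derivCoeff, Complex.ofReal_zero]
    -- The kernel equation for `u'` is the derivative of the stationary equation: mode `j` is
    -- multiplied by `i freq j`.
    linear_combination Complex.I * freq L j * h3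
  have h2 : derivCoeff L z k = 0 := congrFun (congrArg Subtype.val (hnd _ h1)) k
  have h3 : (freq L k : ℂ) ≠ 0 := by
    have : freq L k ≠ 0 := by
      have : (k : ℝ) ≠ 0 := Int.cast_ne_zero.2 hk
      unfold freq
      positivity
    exact_mod_cast this
  exact (mul_eq_zero.1 h2).resolve_left (mul_ne_zero Complex.I_ne_zero h3)

end Periodic

theorem LinearMap.rank_span_image_of_injective {X Y : Type} [AddCommGroup X] [Module ℝ X]
    [AddCommGroup Y] [Module ℝ Y] {f : X →ₗ[ℝ] Y} (hf : Function.Injective f) (A : Set X) :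
    Module.rank ℝ (Submodule.span ℝ (f '' A)) = Module.rank ℝ (Submodule.span ℝ A) := by
  rw [← Submodule.map_span]
  exact (Submodule.equivMapOfInjective f hf (Submodule.span ℝ A)).rank_eq.symm

/-! ### The periodic case -/

namespace Periodic

open Real

variable {W : Submodule ℝ (ℤ → ℂ)} {S : Set ℤ} {L : ℝ} {U : ℝ → ℝ}

theorem fourierSum_of_forall {z : ℤ → ℂ} (hz : ∀ k, k ≠ 0 → z k = 0) (x : ℝ) :
    fourierSum .periodic L z x = fourierSum .periodic L z 0 := by
  have h : ∀ x, fourierSum .periodic L z x = (z 0 * mode L 0 x).re := fun x => by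
    rw [fourierSum_eq, tsum_eq_single 0 fun k hk => by rw [fourierTerm_eq, hz k hk, zero_mul]]
    rfl
  rw [h, h, mode_zero, mode_zero]

theorem coefficient_const (hL : 0 < L) (c : ℝ) (k : ℤ) :
    coefficient L (fun _ => c) k = if 0 = k then ((c * √L : ℝ) : ℂ) else 0 := by
  have hs : √L ≠ 0 := (sqrt_pos.2 hL).ne'
  have h : ∀ x, (c : ℂ) * mode L (-k) x = ((c * √L : ℝ) : ℂ) * (mode L 0 x * mode L (-k) x) := by
    intro x
    rw [mode_zero, ← mul_assoc, ← Complex.ofReal_mul, mul_assoc, mul_inv_cancel₀ hs, mul_one]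
  unfold coefficient
  simp only [h]
  rw [intervalIntegral.integral_const_mul, integral_mode_mul_mode hL, mul_ite, mul_one, mul_zero]

namespace IsModeSpace

/-- At a constant `c` the Hessian is diagonal in Fourier modes, with eigenvalues `waveSq k +
U''(c)`. -/
theorem isHessianEigen_iff_of_forall (hW : IsModeSpace W S) (hL : 0 < L) (hU : ContDiff ℝ 2 U)
    {z : W} (hz : ∀ k, k ≠ 0 → (z : ℤ → ℂ) k = 0) (v : W) (μ : ℝ) :
    IsHessianEigen (fun y : W => potentialEnergy U L .periodic y) z μ v ↔ ∀ k ∈ S,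
      waveSq .periodic L k + deriv (deriv U) (fourierSum .periodic L z 0) = μ ∨
        (v : ℤ → ℂ) k = 0 := by
  rw [hW.isHessianEigen_iff hU]
  refine forall₂_congr fun k _ => ?_
  simp only [fourierSum_of_forall hz]
  rw [coefficient_mul_fourierSum hL (hW.le v.2), ← add_mul, ← sub_mul, mul_eq_zero,
    ← Complex.ofReal_add, ← Complex.ofReal_sub, Complex.ofReal_eq_zero, sub_eq_zero]

theorem mem_nondegenerateCriticalPoints_iff (hW : IsModeSpace W S) (hL : 0 < L)
    (hU : ContDiff ℝ 2 U) (z : W) :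
    z ∈ nondegenerateCriticalPoints (fun y : W => potentialEnergy U L .periodic y) ↔
      (∀ k, k ≠ 0 → (z : ℤ → ℂ) k = 0) ∧ deriv U (fourierSum .periodic L z 0) = 0 ∧
        ∀ k ∈ S, waveSq .periodic L k + deriv (deriv U) (fourierSum .periodic L z 0) ≠ 0 := by
  have hs : √L ≠ 0 := (sqrt_pos.2 hL).ne'
  have hcrit : (∀ k, k ≠ 0 → (z : ℤ → ℂ) k = 0) →
      (IsCriticalPoint (fun y : W => potentialEnergy U L .periodic y) z ↔
        deriv U (fourierSum .periodic L z 0) = 0) := by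
    intro hz
    rw [hW.isCriticalPoint_iff (hU.of_le one_le_two)]
    simp only [fourierSum_of_forall hz, coefficient_const hL]
    constructor
    · intro h
      have h0 := h 0 hW.zero_mem
      simpa [waveSq, hs] using h0
    · intro h k _
      by_cases hk : k = 0
      · subst hk
        simp [waveSq, h]
      · simp [hz k hk, Ne.symm hk]
  have hnd : (∀ k, k ≠ 0 → (z : ℤ → ℂ) k = 0) →
      (IsNondegenerate (fun y : W => potentialEnergy U L .periodic y) z ↔
        ∀ k ∈ S, waveSq .periodic L k + deriv (deriv U) (fourierSum .periodic L z 0) ≠ 0) := by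
    intro hz
    unfold IsNondegenerate
    simp only [hW.isHessianEigen_iff_of_forall hL hU hz]
    constructor
    · intro h k hk hzero
      -- A vanishing diagonal entry at `k` puts this pair in the kernel, because `k` and `-k` have
      -- the same wave number.
      have h1 := h ⟨pair k 1, hW.pair_mem hk 1⟩ fun j _ => by
        by_cases h1 : j = k
        · exact Or.inl (h1 ▸ hzero)
        by_cases h2 : j = -k
        · left
          rw [h2, waveSq_eq, show freq L (-k) = - freq L k by unfold freq; push_cast; ring, neg_sq,
            ← waveSq_eq, hzero]
        · exact Or.inr (pair_apply_of_ne h1 h2 1)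
      exact pair_one_ne_zero k (congrFun (congrArg Subtype.val h1) k)
    · intro h v hv
      refine Subtype.ext (funext fun k => ?_)
      by_cases hk : k ∈ S
      · exact (hv k hk).resolve_left (h k hk)
      · exact ((hW.mem_iff _).1 v.2).2 k hk
  constructor
  · rintro ⟨h1, h2⟩
    have hz : ∀ k, k ≠ 0 → (z : ℤ → ℂ) k = 0 := fun k hk =>
      hW.apply_eq_zero_of_isNondegenerate hL hU z h1 h2 hk
    exact ⟨hz, (hcrit hz).1 h1, (hnd hz).1 h2⟩
  · rintro ⟨hz, h1, h2⟩
    exact ⟨(hcrit hz).2 h1, (hnd hz).2 h2⟩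

end IsModeSpace

theorem apply_zero_eq {z : ℤ → ℂ} (hL : 0 < L) (hzs : z ∈ sobolevSpace .periodic)
    (hz : ∀ k, k ≠ 0 → z k = 0) : z 0 = ((√L * fourierSum .periodic L z 0 : ℝ) : ℂ) := by
  have hs : ((√L : ℝ) : ℂ) ≠ 0 := by exact_mod_cast (sqrt_pos.2 hL).ne'
  rw [Complex.ofReal_mul, ofReal_fourierSum hzs,
    tsum_eq_single 0 fun k hk => by rw [hz k hk, zero_mul], mode_zero, Complex.ofReal_inv]
  field_simp

/-- Nondegenerate critical points of both potentials are constants in the truncated space. The modes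
beyond `d` carry only positive eigenvalues, so they affect neither nondegeneracy nor the negative
eigenvectors, and the bijection is the identity on coefficients. -/
theorem exists_equiv (hU : IsDoubleWell U) (hL : 0 < L) :
    ∃ d₀ : ℕ, ∀ d : ℕ, d₀ ≤ d →
      (nondegenerateCriticalPoints (fullPotential U L .periodic)).Finite ∧
      (nondegenerateCriticalPoints (truncatedPotential U L .periodic d)).Finite ∧
      ∃ e : nondegenerateCriticalPoints (fullPotential U L .periodic) ≃
          nondegenerateCriticalPoints (truncatedPotential U L .periodic d),
        ∀ z : nondegenerateCriticalPoints (fullPotential U L .periodic),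
          negativeEigenvalueCount (truncatedPotential U L .periodic d) (e z) =
            negativeEigenvalueCount (fullPotential U L .periodic) z := by
  have hU2 : ContDiff ℝ 2 U := hU.contDiff_two
  have hlow : ∀ s, deriv U s = 0 → -1 ≤ deriv (deriv U) s := by
    intro s hs
    by_cases h : s = 0
    · rw [h, hU.deriv_deriv_zero]
    · linarith [hU.deriv_deriv_pos hs h]
  have hfin : {s | deriv U s = 0}.Finite := by
    obtain ⟨um, up, -, -, hstat, -⟩ := hU.stationary
    refine (Set.toFinite {um, 0, up}).subset fun s hs => ?_
    simpa using (hstat s).1 hs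
  -- For `|k| > d ≥ L` one has `(2 π k / L)² > 1`, whereas `U'' ≥ -1` at every stationary point.
  refine ⟨⌈L⌉₊, fun d hd => ?_⟩
  have hlarge : ∀ k : ℤ, ¬ |k| ≤ (d : ℤ) → ∀ s, deriv U s = 0 →
      0 < waveSq .periodic L k + deriv (deriv U) s := by
    intro k hk s hs
    have h1 : L ≤ |(k : ℝ)| := by
      have h2 : (d : ℝ) < |(k : ℝ)| := by exact_mod_cast not_le.1 hk
      have h3 : (⌈L⌉₊ : ℝ) ≤ d := by exact_mod_cast hd
      linarith [Nat.le_ceil L]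
    have h2 : 1 < waveSq .periodic L k := by
      rw [waveSq_eq, freq_sq, div_pow, div_mul_eq_mul_div, lt_div_iff₀ (by positivity), one_mul]
      have h3 : L ^ 2 ≤ (k : ℝ) ^ 2 := by
        rw [← sq_abs (k : ℝ)]
        exact pow_le_pow_left₀ hL.le h1 2
      have h4 : 0 < L ^ 2 := by positivity
      have h5 : 1 < (2 * π) ^ 2 := by nlinarith [pi_gt_three]
      nlinarith
    linarith [hlow s hs]
  have hF := fun z => isModeSpace_sobolevSpace.mem_nondegenerateCriticalPoints_iff hL hU2 z
  have hT := fun z => (isModeSpace_truncatedSpace d).mem_nondegenerateCriticalPoints_iff hL hU2 z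
  have hmem : ∀ z : sobolevSpace .periodic,
      z ∈ nondegenerateCriticalPoints (fullPotential U L .periodic) →
      (z : ℤ → ℂ) ∈ truncatedSpace .periodic d := by
    intro z hz
    refine ⟨z.2, fun k hk => ((hF z).1 hz).1 k ?_⟩
    rintro rfl
    simp at hk
    omega
  let e : nondegenerateCriticalPoints (fullPotential U L .periodic) ≃
      nondegenerateCriticalPoints (truncatedPotential U L .periodic d) :=
    { toFun := fun z => ⟨⟨z, hmem z z.2⟩, (hT _).2 (by
        obtain ⟨h1, h2, h3⟩ := (hF z).1 z.2
        exact ⟨h1, h2, fun k _ => h3 k trivial⟩)⟩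
      invFun := fun z => ⟨⟨z, truncatedSpace_le _ d z.1.2⟩, (hF _).2 (by
        obtain ⟨h1, h2, h3⟩ := (hT z).1 z.2
        refine ⟨h1, h2, fun k _ => ?_⟩
        by_cases hk : |k| ≤ (d : ℤ)
        · exact h3 k hk
        · exact (hlarge k hk _ h2).ne')⟩
      left_inv := fun z => rfl
      right_inv := fun z => rfl }
  have hfull : (nondegenerateCriticalPoints (fullPotential U L .periodic)).Finite := by
    refine Set.Finite.of_finite_image (f := fun z => fourierSum .periodic L z 0)
      (hfin.subset ?_) ?_
    · rintro - ⟨z, hz, rfl⟩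
      exact ((hF z).1 hz).2.1
    · intro z hz w hw hzw
      have hz' := ((hF z).1 hz).1
      have hw' := ((hF w).1 hw).1
      refine Subtype.ext (funext fun k => ?_)
      by_cases hk : k = 0
      · subst hk
        rw [apply_zero_eq hL z.2 hz', apply_zero_eq hL w.2 hw']
        exact congrArg (fun s : ℝ => ((√L * s : ℝ) : ℂ)) hzw
      · rw [hz' k hk, hw' k hk]
  have := hfull.to_subtype
  refine ⟨hfull, Set.finite_coe_iff.1 (Finite.of_equiv _ e), e, fun z => ?_⟩
  obtain ⟨h1, h2, -⟩ := (hF z).1 z.2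
  -- For `μ < 0` an eigenvector of the full Hessian has no mode beyond `d`, since the eigenvalue of
  -- such a mode is positive; hence it lies in the truncated space.
  have hset : Submodule.inclusion (truncatedSpace_le .periodic d) ''
      {v | ∃ μ < 0, IsHessianEigen (truncatedPotential U L .periodic d) (e z) μ v} =
      {v | ∃ μ < 0, IsHessianEigen (fullPotential U L .periodic) z μ v} := by
    ext v
    constructor
    · rintro ⟨v, ⟨μ, hμ, hv⟩, rfl⟩
      have hv' := ((isModeSpace_truncatedSpace d).isHessianEigen_iff_of_forall hL hU2
        (z := (e z).1) h1 v μ).1 hv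
      refine ⟨μ, hμ, (isModeSpace_sobolevSpace.isHessianEigen_iff_of_forall hL hU2 h1 _ μ).2
        fun k _ => ?_⟩
      by_cases hk : |k| ≤ (d : ℤ)
      · exact hv' k hk
      · exact Or.inr (v.2.2 k (not_le.1 hk))
    · rintro ⟨μ, hμ, hv⟩
      have hv' := (isModeSpace_sobolevSpace.isHessianEigen_iff_of_forall hL hU2 h1 v μ).1 hv
      have hvm : (v : ℤ → ℂ) ∈ truncatedSpace .periodic d := by
        refine ⟨v.2, fun k hk => (hv' k trivial).resolve_left fun h => ?_⟩
        have := hlarge k (not_le.2 hk) _ h2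
        linarith
      exact ⟨⟨v, hvm⟩, ⟨μ, hμ, ((isModeSpace_truncatedSpace d).isHessianEigen_iff_of_forall hL hU2
        (z := (e z).1) h1 _ μ).2 fun k _ => hv' k trivial⟩, rfl⟩
  unfold negativeEigenvalueCount
  rw [← hset, LinearMap.rank_span_image_of_injective
    (Submodule.inclusion_injective (truncatedSpace_le .periodic d))]

end Periodic

end

theorem mainTheorem9 (U : ℝ → ℝ) (hU : IsDoubleWell U) (L : ℝ) (hL : 0 < L)
    (bc : BoundaryCondition)
    (hnonconst : bc = .neumann → ∀ z : sobolevSpace bc,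
      IsCriticalPoint (fullPotential U L bc) z → (∃ k : ℤ, k ≠ 0 ∧ (z : ℤ → ℂ) k ≠ 0) →
      IsNondegenerate (fullPotential U L bc) z)
    (hbif : bc = .neumann → (∃ n : ℕ, L = n * Real.pi) →
      ContDiff ℝ 4 U ∧ iteratedDeriv 4 U 0 ≠ -(5 / 3) * (iteratedDeriv 3 U 0) ^ 2) :
    ∃ d₀ : ℕ, ∀ d : ℕ, d₀ ≤ d →
      (nondegenerateCriticalPoints (fullPotential U L bc)).Finite ∧
      (nondegenerateCriticalPoints (truncatedPotential U L bc d)).Finite ∧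
      ∃ e : nondegenerateCriticalPoints (fullPotential U L bc) ≃
          nondegenerateCriticalPoints (truncatedPotential U L bc d),
        ∀ z : nondegenerateCriticalPoints (fullPotential U L bc),
          negativeEigenvalueCount (truncatedPotential U L bc d) (e z) =
            negativeEigenvalueCount (fullPotential U L bc) z := by
  cases bc with
  | neumann =>
    exact Neumann.exists_equiv_of_isolated hU.contDiff_two hL hU.exists_sq_sub_deriv_mul_le
      (Neumann.exists_isolating_radius hU hL (hnonconst rfl) (hbif rfl))
  | periodic => exact Periodic.exists_equiv hU hL
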